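/- **Setup.** Work over the field $\mathbb{C}(q)$ with $\iota=\sqrt{-1}\in\mathbb{C}$. For $n\in\mathbb{Z}$ and $\mu\in\mathbb{C}(q)^*$ put $[\mu;n]=\dfrac{q^n\mu-q^{-n}\mu^{-1}}{q-q^{-1}}$, and for elements $a,b$ of a $\mathbb{C}(q)$-algebra put $[a,b]_p=ab-p\,ba$. Consider the linear graph $\bar 1\to\bar\diamondsuit\to\diamondsuit\to 1$, whose edges are labelled $1,0,-1$ in this order. Let $U_q(\mathfrak{gl}_4)$ be the quantum group with generators $E_i,F_i$ ($i\in\{1,0,-1\}$) and $D_j^{\pm1}$ ($j$ a vertex), where the $D_j^{\pm 1}$ commute, $K_i=D_{\sigma(i)}D_{\tau(i)}^{-1}$ for $\sigma(i),\tau(i)$ the source and target of the edge $i$, $$D_jE_iD_j^{-1}=q^{\delta_{\sigma(i),j}-\delta_{\tau(i),j}}E_i,\quad D_jF_iD_j^{-1}=q^{-\delta_{\sigma(i),j}+\delta_{\tau(i),j}}F_i,\quad [E_i,F_{i'}]=\delta_{ii'}\frac{K_i-K_i^{-1}}{q-q^{-1}},$$ and the $E_i$ (and likewise the $F_i$) satisfy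 the usual type $A_3$ quantum Serre relations. Let $U_q'\subset U_q(\mathfrak{gl}_4)$ be the subalgebra generated by $$B_{\pm1}=F_{\pm1}+E_{\mp1}K_{\pm1}^{-1},\quad B_0=F_0+q^{-1}E_0K_0^{-1},\quad \hat D_\diamondsuit^{\pm1}=(D_\diamondsuit D_{\bar\diamondsuit})^{\pm1},\quad \hat D_1^{\pm1}=(D_1D_{\bar1})^{\pm1}.$$ Put $X=[B_0,B_1]_{q^{-1}}$, $Y=[B_0,B_{-1}]_{q^{-1}}$, $Z=[B_1,Y]_{q^{-1}}$. Let $U_+'$ be the subalgebra generated by $B_1,X$, and $U_0'$ the (commutative) subalgebra generated by $\hat D_\diamondsuit^{\pm1},\hat D_1^{\pm1},B_0,Z$; a weight vector in a $U_q'$-module is a simultaneous eigenvector for $U_0'$, and a weight basis is a $\mathbb{C}(q)$-basis of weight vectors. For $\kappa_\diamondsuit,\kappa_1\in\mathbb{Z}$ and $\beta,\zeta\in\mathbb{C}(q)$ let $\mathbb{M}(\kappa_\diamondsuit,\kappa_1,\beta,\zeta)=U_q'\otimes_{U_+'U_0'}\mathbb{C}(q)$ be the Verma module induced from the one-dimensional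 $U_+'U_0'$-module on which $B_1,X$ act by $0$ and $\hat D_\diamondsuit,\hat D_1,B_0,Z$ act by $q^{\kappa_\diamondsuit},q^{\kappa_1},\beta,\zeta$. Its highest weight vectors are the nonzero scalar multiples of $1\otimes1$. Put $\kappa=\kappa_\diamondsuit-\kappa_1$. For $\eta\in\mathbb{C}(q)^*$ let $F_+(\eta)=B_{-1}-\eta^{-1}Y$ and $F_-(\eta)=B_{-1}+\eta Y$, and for a highest weight vector $v$ of $\mathbb{M}(\kappa_\diamondsuit,\kappa_1,[\mu;0],\zeta)$ write $$F_+^aF_-^b v=F_+(q^{b-a+1}\mu)\cdots F_+(q^{b-1}\mu)F_+(q^{b}\mu)\;F_-(q^{b-1}\mu)\cdots F_-(q\mu)F_-(\mu)\,v .$$ **Theorem (Good irreducibles).** Let $\kappa_\diamondsuit,\kappa_1\in\mathbb{Z}$, $\zeta\in\mathbb{C}(q)$ and $\mu\in\mathbb{C}(q)^*$ with $\mu\neq\pm q^l\iota$ for all $l\in\mathbb{Z}$, and let $\mathbb{M}=\mathbb{M}(\kappa_\diamondsuit,\kappa_1,[\mu;0],\zeta)$ (a good Verma module). Then $\mathbb{M}$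 has a finite-dimensional irreducible quotient if and only if $$\zeta=[\mu;\kappa-2i]-q^{-\kappa}[\mu;0]\qquad\text{for some integer } i \text{ with } 0\le i\le\kappa. \tag{$*$}$$ If $(*)$ holds for $i$, then the finite-dimensional irreducible quotient $L$ is unique (there is exactly one submodule $N\subset\mathbb{M}$ such that $\mathbb{M}/N$ is irreducible and finite-dimensional), and for every highest weight vector $v$ of $\mathbb{M}$ the images in $L$ of the vectors $$F_+^aF_-^b v\qquad(0\le a\le i,\ 0\le b\le\kappa-i),$$ indexed by the pairs $(a,b)$, form a weight basis of $L$. -/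

import Mathlib

noncomputable section

namespace QSP

/-! ## The ground field and quantum integers -/

/-- The ground field `ℂ(q)` of rational functions. -/
abbrev Cq : Type := RatFunc ℂ

/-- The variable `q ∈ ℂ(q)`. -/
def q : Cq := RatFunc.X

/-- The root `ι = √-1 ∈ ℂ ⊆ ℂ(q)`. -/
def iota : Cq := RatFunc.C Complex.I

/-- `[μ;n] = (q^n μ - q^{-n} μ⁻¹) / (q - q⁻¹)` for `μ ∈ ℂ(q)^*`. -/
def qBr (μ : Cq) (n : ℤ) : Cq := (q ^ n * μ - q ^ (-n) * μ⁻¹) / (q - q⁻¹)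

/-- The quantum integer `[n] = (q^n - q^{-n}) / (q - q⁻¹)`. -/
def qInt (n : ℤ) : Cq := (q ^ n - q ^ (-n)) / (q - q⁻¹)

/-! ## The quantum group `U_q(𝔤𝔩₄)`

The linear graph has the four vertices `-1 → -♦ → ♦ → 1`, encoded in this order as `0, 1, 2, 3` in
`Fin 4`. Its three edges are labelled (in this order) by `1, 0, -1`, encoded as `0, 1, 2` in `Fin 3`,
so the edge `i : Fin 3` has source `i.castSucc` and target `i.succ`. In both cases the sign change
of labels is the reversal `Fin.rev`. -/

/-- Generators of `U_q(𝔤𝔩₄)`; `Dinv j` stands for `D_j⁻¹`. -/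
inductive Gen : Type
  | E (i : Fin 3)
  | F (i : Fin 3)
  | D (j : Fin 4)
  | Dinv (j : Fin 4)

namespace Gen

/-- A generator as an element of the free algebra. -/
abbrev ι (x : Gen) : FreeAlgebra Cq Gen := FreeAlgebra.ι Cq x

/-- `K_i = D_{source i} D_{target i}⁻¹` in the free algebra. -/
abbrev K (i : Fin 3) : FreeAlgebra Cq Gen := (D i.castSucc).ι * (Dinv i.succ).ι

/-- `K_i⁻¹ = D_{source i}⁻¹ D_{target i}` in the free algebra. -/
abbrev Kinv (i : Fin 3) : FreeAlgebra Cq Gen := (Dinv i.castSucc).ι * (D i.succ).ι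

end Gen

/-- The exponent `δ_{source i, j} - δ_{target i, j}`. -/
def wt (i : Fin 3) (j : Fin 4) : ℤ :=
  (if i.castSucc = j then 1 else 0) - (if i.succ = j then 1 else 0)

/-- Two edges are adjacent if they share a vertex (and are distinct). -/
def Adjacent (i i' : Fin 3) : Prop := i.succ = i'.castSucc ∨ i'.succ = i.castSucc

/-- Defining relations of `U_q(𝔤𝔩₄)`. -/
inductive GLRel : FreeAlgebra Cq Gen → FreeAlgebra Cq Gen → Prop
  | D_mul_Dinv (j : Fin 4) : GLRel ((Gen.D j).ι * (Gen.Dinv j).ι) 1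
  | Dinv_mul_D (j : Fin 4) : GLRel ((Gen.Dinv j).ι * (Gen.D j).ι) 1
  | D_comm (j k : Fin 4) : GLRel ((Gen.D j).ι * (Gen.D k).ι) ((Gen.D k).ι * (Gen.D j).ι)
  | D_E (i : Fin 3) (j : Fin 4) :
      GLRel ((Gen.D j).ι * (Gen.E i).ι * (Gen.Dinv j).ι) (q ^ wt i j • (Gen.E i).ι)
  | D_F (i : Fin 3) (j : Fin 4) :
      GLRel ((Gen.D j).ι * (Gen.F i).ι * (Gen.Dinv j).ι) (q ^ (-wt i j) • (Gen.F i).ι)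
  | E_F_same (i : Fin 3) :
      GLRel ((Gen.E i).ι * (Gen.F i).ι - (Gen.F i).ι * (Gen.E i).ι)
        ((q - q⁻¹)⁻¹ • (Gen.K i - Gen.Kinv i))
  | E_F_ne (i i' : Fin 3) (h : i ≠ i') :
      GLRel ((Gen.E i).ι * (Gen.F i').ι - (Gen.F i').ι * (Gen.E i).ι) 0
  | E_comm (i i' : Fin 3) (h : ¬ Adjacent i i') :
      GLRel ((Gen.E i).ι * (Gen.E i').ι) ((Gen.E i').ι * (Gen.E i).ι)
  | F_comm (i i' : Fin 3) (h : ¬ Adjacent i i') :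
      GLRel ((Gen.F i).ι * (Gen.F i').ι) ((Gen.F i').ι * (Gen.F i).ι)
  | E_serre (i i' : Fin 3) (h : Adjacent i i') :
      GLRel ((Gen.E i).ι ^ 2 * (Gen.E i').ι
        - qInt 2 • ((Gen.E i).ι * (Gen.E i').ι * (Gen.E i).ι)
        + (Gen.E i').ι * (Gen.E i).ι ^ 2) 0
  | F_serre (i i' : Fin 3) (h : Adjacent i i') :
      GLRel ((Gen.F i).ι ^ 2 * (Gen.F i').ι
        - qInt 2 • ((Gen.F i).ι * (Gen.F i').ι * (Gen.F i).ι)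
        + (Gen.F i').ι * (Gen.F i).ι ^ 2) 0

/-- The quantum group `U_q(𝔤𝔩₄)` over `ℂ(q)`. -/
def UqGL : Type := RingQuot GLRel

instance : Ring UqGL := inferInstanceAs (Ring (RingQuot GLRel))

instance : Algebra Cq UqGL := inferInstanceAs (Algebra Cq (RingQuot GLRel))

namespace UqGL

/-- The image of a generator in `U_q(𝔤𝔩₄)`. -/
def gen (x : Gen) : UqGL := RingQuot.mkAlgHom Cq GLRel x.ι

def E (i : Fin 3) : UqGL := gen (Gen.E i)

def F (i : Fin 3) : UqGL := gen (Gen.F i)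

def D (j : Fin 4) : UqGL := gen (Gen.D j)

/-- `D_j⁻¹`. -/
def Dinv (j : Fin 4) : UqGL := gen (Gen.Dinv j)

/-- `K_i⁻¹ = D_{source i}⁻¹ D_{target i}`. -/
def Kinv (i : Fin 3) : UqGL := Dinv i.castSucc * D i.succ

/-! ### Generators of the coideal subalgebra -/

/-- `B_i = F_i + E_{-i} K_i⁻¹`, to be used for the labels `i = 1` (edge `0`) and `i = -1`
(edge `2`). -/
def B (i : Fin 3) : UqGL := F i + E i.rev * Kinv i

/-- `B_0 = F_0 + q⁻¹ E_0 K_0⁻¹`; the label `0` is the edge `1`. -/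
def Bzero : UqGL := F 1 + q⁻¹ • (E 1 * Kinv 1)

/-- `D̂_j = D_j D_{-j}`. -/
def Dhat (j : Fin 4) : UqGL := D j * D j.rev

/-- `D̂_j⁻¹`. -/
def DhatInv (j : Fin 4) : UqGL := Dinv j.rev * Dinv j

end UqGL

/-! ## The coideal subalgebra `U_q'` -/

/-- The quantum symmetric pair coideal subalgebra `U_q' = U_q'(𝔤𝔩₂ × 𝔤𝔩₂)` of `U_q(𝔤𝔩₄)`, the
subalgebra generated by `B_1`, `B_{-1}`, `B_0` and all `D̂_j^{±1}`. -/
def Uq' : Subalgebra Cq UqGL :=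
  Algebra.adjoin Cq
    ({UqGL.B 0, UqGL.B 2, UqGL.Bzero} ∪ Set.range UqGL.Dhat ∪ Set.range UqGL.DhatInv)

/-- `B_1 ∈ U_q'`. -/
def B1 : Uq' := ⟨UqGL.B 0, Algebra.subset_adjoin (by simp)⟩

/-- `B_{-1} ∈ U_q'`. -/
def Bm1 : Uq' := ⟨UqGL.B 2, Algebra.subset_adjoin (by simp)⟩

/-- `B_0 ∈ U_q'`. -/
def B0 : Uq' := ⟨UqGL.Bzero, Algebra.subset_adjoin (by simp)⟩

/-- `D̂_♦ = D_♦ D_{-♦} ∈ U_q'`. -/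
def Dd : Uq' := ⟨UqGL.Dhat 2, Algebra.subset_adjoin (Or.inl (Or.inr ⟨2, rfl⟩))⟩

/-- `D̂_1 = D_1 D_{-1} ∈ U_q'`. -/
def D1 : Uq' := ⟨UqGL.Dhat 3, Algebra.subset_adjoin (Or.inl (Or.inr ⟨3, rfl⟩))⟩

/-- `D̂_♦⁻¹ ∈ U_q'`. -/
def DdInv : Uq' := ⟨UqGL.DhatInv 2, Algebra.subset_adjoin (Or.inr ⟨2, rfl⟩)⟩

/-- `D̂_1⁻¹ ∈ U_q'`. -/
def D1Inv : Uq' := ⟨UqGL.DhatInv 3, Algebra.subset_adjoin (Or.inr ⟨3, rfl⟩)⟩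

/-- The `p`-commutator `[a,b]_p = ab - p ba`. -/
def qComm (p : Cq) (a b : Uq') : Uq' := a * b - p • (b * a)

/-- `X = [B_0, B_1]_{q⁻¹}`. -/
def X : Uq' := qComm q⁻¹ B0 B1

/-- `Y = [B_0, B_{-1}]_{q⁻¹}`. -/
def Y : Uq' := qComm q⁻¹ B0 Bm1

/-- `Z = [B_1, Y]_{q⁻¹}`. -/
def Z : Uq' := qComm q⁻¹ B1 Y

/-- The Cartan subalgebra `U_0'`, generated by `D̂_♦^{±1}`, `D̂_1^{±1}`, `B_0` and `Z`. -/
def U0' : Subalgebra Cq Uq' := Algebra.adjoin Cq {Dd, DdInv, D1, D1Inv, B0, Z}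

/-- A weight vector of a `U_q'`-module: a simultaneous eigenvector for `U_0'`. -/
def IsWeightVector {M : Type*} [AddCommGroup M] [Module Cq M] [Module Uq' M] (w : M) : Prop :=
  w ≠ 0 ∧ ∀ u ∈ U0', ∃ c : Cq, u • w = c • w

/-- A family of vectors is a weight basis if it is a `ℂ(q)`-basis consisting of weight vectors. -/
def IsWeightBasis {M : Type*} [AddCommGroup M] [Module Cq M] [Module Uq' M]
    {I : Type*} (w : I → M) : Prop :=
  LinearIndependent Cq w ∧ Submodule.span Cq (Set.range w) = ⊤ ∧ ∀ i, IsWeightVector (w i)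

/-! ## Verma modules -/

/-- The left ideal of `U_q'` generated by `B_1`, `X`, `D̂_♦ - q^{κ_♦}`, `D̂_1 - q^{κ_1}`, `B_0 - β`
and `Z - ζ`. -/
def vermaIdeal (κd κ1 : ℤ) (β ζ : Cq) : Submodule Uq' Uq' :=
  Submodule.span Uq'
    {B1, X, Dd - algebraMap Cq Uq' (q ^ κd), D1 - algebraMap Cq Uq' (q ^ κ1),
      B0 - algebraMap Cq Uq' β, Z - algebraMap Cq Uq' ζ}

/-- The Verma module `𝕄(κ_♦, κ_1, β, ζ)`, i.e. the module induced from the one-dimensional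
`U_+' U_0'`-module `ℂ(q) · 1` on which `B_1`, `X` act by zero and `D̂_♦`, `D̂_1`, `B_0`, `Z` act by
`q^{κ_♦}`, `q^{κ_1}`, `β`, `ζ`. Inducing this cyclic module amounts to dividing `U_q'` by the left
ideal generated by the annihilator of its generator `1`; the vector `1 ⊗ 1` is the class of `1`. -/
abbrev Verma (κd κ1 : ℤ) (β ζ : Cq) : Type := Uq' ⧸ vermaIdeal κd κ1 β ζ

/-- The canonical generator `1 ⊗ 1` of the Verma module. -/
def vermaGen (κd κ1 : ℤ) (β ζ : Cq) : Verma κd κ1 β ζ :=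
  Submodule.Quotient.mk (p := vermaIdeal κd κ1 β ζ) 1

/-- The highest weight vectors of a Verma module are the nonzero multiples of `1 ⊗ 1`. -/
def IsHighestWeightVector {κd κ1 : ℤ} {β ζ : Cq} (v : Verma κd κ1 β ζ) : Prop :=
  ∃ c : Cq, c ≠ 0 ∧ v = c • vermaGen κd κ1 β ζ

/-- The quotient of the `U_q'`-module `M` by `N` is a finite dimensional irreducible module. -/
def IsFDIrreducibleQuotient {M : Type*} [AddCommGroup M] [Module Cq M] [Module Uq' M]
    [IsScalarTower Cq Uq' M] (N : Submodule Uq' M) : Prop :=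
  IsSimpleModule Uq' (M ⧸ N) ∧ FiniteDimensional Cq (M ⧸ N)

/-- The condition `μ ≠ ± q^l ι` for all `l ∈ ℤ` (with `μ ∈ ℂ(q)^*`), which defines the good Verma
modules `𝕄(κ_♦, κ_1, [μ;0], ζ)`. -/
def IsGood (μ : Cq) : Prop :=
  μ ≠ 0 ∧ ∀ l : ℤ, μ ≠ q ^ l * iota ∧ μ ≠ -(q ^ l * iota)

/-! ## Magical operators -/

/-- `F_+(η) = B_{-1} - η⁻¹ Y`. -/
def Fplus (η : Cq) : Uq' := Bm1 - η⁻¹ • Y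

/-- `F_-(η) = B_{-1} + η Y`. -/
def Fminus (η : Cq) : Uq' := Bm1 + η • Y

/-- The power `F_+^a` on vectors of `B_0`-weight `[η;0]`. As `F_+(η)` maps the `B_0`-weight `[η;0]`
to `[q⁻¹η;0]`, it is `F_+(q^{-(a-1)} η) ⋯ F_+(q⁻¹ η) F_+(η)`. -/
def FplusPow (η : Cq) : ℕ → Uq'
  | 0 => 1
  | a + 1 => Fplus (q ^ (-(a : ℤ)) * η) * FplusPow η a

/-- The power `F_-^b` on vectors of `B_0`-weight `[η;0]`. As `F_-(η)` maps the `B_0`-weight `[η;0]`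
to `[qη;0]`, it is `F_-(q^{b-1} η) ⋯ F_-(q η) F_-(η)`. -/
def FminusPow (η : Cq) : ℕ → Uq'
  | 0 => 1
  | b + 1 => Fminus (q ^ (b : ℤ) * η) * FminusPow η b

/-- The vector `F_+^a F_-^b v` for a vector `v` of `B_0`-weight `[μ;0]`; here `F_-^b v` has
`B_0`-weight `[q^b μ;0]`. -/
def FFvec {M : Type*} [AddCommGroup M] [Module Uq' M] (μ : Cq) (v : M) (a b : ℕ) : M :=
  FplusPow (q ^ (b : ℤ) * μ) a • FminusPow μ b • v

end QSP

end

/-!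
For good `μ` the elements `D̂_♦` and `B_0` already separate the vectors `F_+^a F_-^b v`, which span
the Verma module. Everything rests on the coefficient by which a raising operator brings `F_-^b v`
back to `F_-^{b-1} v`: it is a nonzero multiple of a factor which is linear in `ζ`. In a
finite-dimensional module `F_-^b v` has to vanish for large `b`, so this factor vanishes for some
`b = κ - i + 1`, which is condition `(*)`. The symmetry `μ ↦ -μ⁻¹` exchanges `F_-` and `F_+` and
replaces `i` by `κ - i`. In an irreducible quotient the singular vectors `F_-^{κ-i+1} v` and
`F_+^{i+1} v` are zero, and the remaining vectors form the weight basis. The irreducible quotient is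
unique because a proper submodule has no component along the generator.

Conversely, the subalgebra `U_q'` is a coideal, so that its modules can be tensored with the vector
representation of `U_q(𝔤𝔩₄)`. Each such step yields a highest weight vector with `κ` raised by one
and `μ` multiplied by `q` or `q⁻¹`, and one starts from a one-dimensional module on which `B_0` acts
by an arbitrary scalar.
-/

noncomputable section

namespace QSP

/-! ### Quantum commutation and Serre relations -/

theorem q_ne_zero : q ≠ 0 := RatFunc.X_ne_zero

theorem q_zpow_ne_zero (n : ℤ) : q ^ n ≠ 0 := zpow_ne_zero _ q_ne_zero

theorem q_zpow_injective : Function.Injective fun n : ℤ => q ^ n := by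
  have hdeg (n : ℤ) : (q ^ n).intDegree = n := by
    induction n with
    | zero => rw [zpow_zero, RatFunc.intDegree_one]
    | succ n ih =>
      rw [zpow_add_one₀ q_ne_zero, RatFunc.intDegree_mul (q_zpow_ne_zero _) q_ne_zero, ih, q,
        RatFunc.intDegree_X]
    | pred n ih =>
      rw [zpow_sub_one₀ q_ne_zero, RatFunc.intDegree_mul (q_zpow_ne_zero _)
        (inv_ne_zero q_ne_zero), ih, RatFunc.intDegree_inv, q, RatFunc.intDegree_X, sub_eq_add_neg]
  exact Function.LeftInverse.injective hdeg

theorem q_zpow_ne_one {n : ℤ} (hn : n ≠ 0) : q ^ n ≠ 1 := fun h =>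
  hn (q_zpow_injective (h.trans (zpow_zero q).symm))

theorem q_sq_sub_one_ne_zero : q ^ 2 - 1 ≠ 0 :=
  sub_ne_zero.2 (q_zpow_ne_one (n := 2) two_ne_zero)

theorem q_sq_add_one_ne_zero : q ^ 2 + 1 ≠ 0 := fun h =>
  q_zpow_ne_one (n := 4) four_ne_zero <| by
    rw [zpow_ofNat]
    linear_combination (q ^ 2 - 1) * h

theorem sub_inv_ne_zero {𝕜 : Type*} [Field 𝕜] {x : 𝕜} (h0 : x ≠ 0) (h1 : x ^ 2 - 1 ≠ 0) :
    x - x⁻¹ ≠ 0 := fun h => h1 (by linear_combination x * h + mul_inv_cancel₀ h0)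

theorem q_sub_inv_ne_zero : q - q⁻¹ ≠ 0 := sub_inv_ne_zero q_ne_zero q_sq_sub_one_ne_zero

theorem qInt_two : qInt 2 = q + q⁻¹ := by
  rw [qInt, div_eq_iff q_sub_inv_ne_zero, zpow_neg, zpow_ofNat]
  ring

section QCommute

variable {𝕜 A A' : Type*} [Field 𝕜] [Ring A] [Algebra 𝕜 A] [Ring A'] [Algebra 𝕜 A'] {q : 𝕜}
  {m n : ℤ} {x y z : A}

/-- `x` and `y` commute up to the scalar `q ^ n`, with `x` on the left of the left-hand side. -/
def QCommute (q : 𝕜) (n : ℤ) (x y : A) : Prop := x * y = q ^ n • (y * x)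

namespace QCommute

theorem eq (h : QCommute q n x y) : x * y = q ^ n • (y * x) := h

theorem commute (h : QCommute q 0 x y) : Commute x y :=
  h.eq.trans (by rw [zpow_zero, one_smul])

theorem of_commute (h : Commute x y) : QCommute q 0 x y :=
  h.eq.trans (by rw [zpow_zero, one_smul])

theorem add_right (hy : QCommute q n x y) (hz : QCommute q n x z) : QCommute q n x (y + z) := by
  rw [QCommute, mul_add, hy.eq, hz.eq, add_mul, smul_add]

theorem smul_right (c : 𝕜) (h : QCommute q n x y) : QCommute q n x (c • y) := by
  rw [QCommute, mul_smul_comm, h.eq, smul_mul_assoc, smul_comm]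

theorem mul_left (hq : q ≠ 0) (hx : QCommute q m x z) (hy : QCommute q n y z) :
    QCommute q (m + n) (x * y) z := by
  rw [QCommute, mul_assoc, hy.eq, mul_smul_comm, ← mul_assoc, hx.eq, smul_mul_assoc, smul_smul,
    mul_assoc, ← zpow_add₀ hq, add_comm]

theorem mul_right (hq : q ≠ 0) (hy : QCommute q m x y) (hz : QCommute q n x z) :
    QCommute q (m + n) x (y * z) := by
  rw [QCommute, ← mul_assoc, hy.eq, smul_mul_assoc, mul_assoc, hz.eq, mul_smul_comm, smul_smul,
    mul_assoc, ← zpow_add₀ hq]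

theorem sub_right (hy : QCommute q n x y) (hz : QCommute q n x z) : QCommute q n x (y - z) := by
  rw [QCommute, mul_sub, hy.eq, hz.eq, sub_mul, smul_sub]

theorem units_inv_left (hq : q ≠ 0) {u : Aˣ} (h : QCommute q n (u : A) y) :
    QCommute q (-n) (↑u⁻¹ : A) y := by
  have hy : y = q ^ n • (↑u⁻¹ * y * u) := by
    rw [mul_assoc, ← mul_smul_comm, ← h.eq, Units.inv_mul_cancel_left]
  have hyu : y * ↑u⁻¹ = q ^ n • (↑u⁻¹ * y) := by
    nth_rw 1 [hy]
    rw [smul_mul_assoc, Units.mul_inv_cancel_right]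
  rw [QCommute, hyu, smul_smul, ← zpow_add₀ hq, neg_add_cancel, zpow_zero, one_smul]

theorem map (h : QCommute q n x y) (φ : A →ₐ[𝕜] A') : QCommute q n (φ x) (φ y) := by
  rw [QCommute, ← map_mul, h.eq, map_smul, map_mul]

end QCommute

theorem mul_mul_of_mul_eq {M : Type*} [Semigroup M] {x y z : M} (h : x * y = z) (c : M) :
    x * (y * c) = z * c := by
  rw [← mul_assoc, h]

/-- The quantum Serre expression `a²b - (q + q⁻¹)aba + ba²`. -/
def serre (q : 𝕜) (a b : A) : A := a * (a * b) - (q + q⁻¹) • (a * (b * a)) + b * (a * a)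

theorem map_serre (φ : A →ₐ[𝕜] A') (a b : A) : φ (serre q a b) = serre q (φ a) (φ b) := by
  simp only [serre, map_add, map_sub, map_smul, map_mul]

theorem serre_eq_mul_sub (h0 : q ≠ 0) (a b : A) :
    serre q a b = a * (a * b - q⁻¹ • (b * a)) - q • ((a * b - q⁻¹ • (b * a)) * a) := by
  simp only [serre, mul_sub, sub_mul, mul_smul_comm, smul_mul_assoc, mul_assoc]
  match_scalars <;> field_simp
  ring

theorem serre_eq_sub_mul (h0 : q ≠ 0) (a b : A) :
    serre q a b = (b * a - q⁻¹ • (a * b)) * a - q • (a * (b * a - q⁻¹ • (a * b))) := by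
  simp only [serre, mul_sub, sub_mul, mul_smul_comm, smul_mul_assoc, mul_assoc]
  match_scalars <;> field_simp
  ring

theorem serre_smul_right (c : 𝕜) (a b : A) : serre q a (c • b) = c • serre q a b := by
  simp only [serre, mul_smul_comm, smul_mul_assoc, smul_add, smul_sub, smul_comm c]

theorem serre_mul_mul {u v a b : A} (huv : Commute u v) (hua : Commute u a)
    (hub : QCommute q n u b) (hva : QCommute q n v a) :
    serre q (a * u) (b * v) = (q ^ n) ^ 2 • (serre q a b * (u * (u * v))) := by
  simp only [serre, sub_mul, add_mul, smul_mul_assoc, mul_smul_comm, mul_assoc,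
    huv.symm.eq, mul_mul_of_mul_eq hua.eq, mul_mul_of_mul_eq huv.symm.eq,
    mul_mul_of_mul_eq hub.eq, mul_mul_of_mul_eq hva.eq]
  module

theorem serre_add_eq_zero {a b a' b' : A} (h0 : q ≠ 0) (hba : QCommute q 2 b a)
    (hba' : QCommute q (-1) b a') (hb'a : QCommute q (-1) b' a)
    (ha : serre q a a' = 0) (hb : serre q b b' = 0) : serre q (a + b) (a' + b') = 0 := by
  simp only [serre] at ha hb ⊢
  simp only [mul_add, add_mul, mul_assoc, smul_mul_assoc, mul_smul_comm, smul_smul, smul_add,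
    hba.eq, hba'.eq, hb'a.eq, mul_mul_of_mul_eq hba.eq, mul_mul_of_mul_eq hba'.eq,
    mul_mul_of_mul_eq hb'a.eq, zpow_neg, zpow_ofNat]
  linear_combination (norm := skip) ha + hb
  match_scalars <;> field_simp <;> ring

end QCommute

theorem Adjacent.symm {i j : Fin 3} (h : Adjacent i j) : Adjacent j i := Or.symm h

theorem Adjacent.rev {i j : Fin 3} (h : Adjacent i j) : Adjacent i.rev j.rev := by
  revert i j; unfold Adjacent; decide

/-- The Cartan matrix of type `A₃`: `K_i` and `E_j` commute up to `q` to the power `cartan i j`. -/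
def cartan (i j : Fin 3) : ℤ := wt j i.castSucc - wt j i.succ

theorem cartan_self (i : Fin 3) : cartan i i = 2 := by
  revert i; decide

theorem cartan_comm (i j : Fin 3) : cartan i j = cartan j i := by
  revert i j; decide

theorem cartan_of_adjacent {i j : Fin 3} (h : Adjacent i j) : cartan i j = -1 := by
  revert i j; unfold Adjacent; decide

theorem cartan_of_not_adjacent {i j : Fin 3} (hij : i ≠ j) (h : ¬ Adjacent i j) :
    cartan i j = 0 := by
  revert i j; unfold Adjacent; decide

/-- Elements `E_i`, `F_i` and units `D_j` of an algebra which satisfy the defining relations of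
`U_q(𝔤𝔩₄)`; a homomorphism from `U_q(𝔤𝔩₄)` amounts to such a family. -/
structure GLRelations {R : Type*} [Ring R] [Algebra Cq R] (E F : Fin 3 → R) (D : Fin 4 → Rˣ) :
    Prop where
  D_D (j k : Fin 4) : Commute (D j) (D k)
  D_E (i : Fin 3) (j : Fin 4) : QCommute q (wt i j) (D j : R) (E i)
  D_F (i : Fin 3) (j : Fin 4) : QCommute q (-wt i j) (D j : R) (F i)
  E_F_same (i : Fin 3) : E i * F i = F i * E i +
    (q - q⁻¹)⁻¹ • (((D i.castSucc / D i.succ : Rˣ) : R) - (D i.succ / D i.castSucc : Rˣ))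
  E_F_ne {i j : Fin 3} (h : i ≠ j) : Commute (E i) (F j)
  E_E {i j : Fin 3} (h : ¬ Adjacent i j) : Commute (E i) (E j)
  F_F {i j : Fin 3} (h : ¬ Adjacent i j) : Commute (F i) (F j)
  E_serre {i j : Fin 3} (h : Adjacent i j) : serre q (E i) (E j) = 0
  F_serre {i j : Fin 3} (h : Adjacent i j) : serre q (F i) (F j) = 0

namespace GLRelations

variable {R : Type*} [Ring R] [Algebra Cq R] {E F : Fin 3 → R} {D : Fin 4 → Rˣ}

theorem D_div_E (h : GLRelations E F D) (i : Fin 3) (j k : Fin 4) :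
    QCommute q (wt i j - wt i k) ((D j / D k : Rˣ) : R) (E i) := by
  simpa only [div_eq_mul_inv, Units.val_mul, sub_eq_add_neg] using
    (h.D_E i j).mul_left q_ne_zero ((h.D_E i k).units_inv_left q_ne_zero)

theorem D_div_F (h : GLRelations E F D) (i : Fin 3) (j k : Fin 4) :
    QCommute q (wt i k - wt i j) ((D j / D k : Rˣ) : R) (F i) := by
  simpa only [div_eq_mul_inv, Units.val_mul, neg_neg, neg_add_eq_sub] using
    (h.D_F i j).mul_left q_ne_zero ((h.D_F i k).units_inv_left q_ne_zero)

theorem D_D_div (h : GLRelations E F D) (j k l : Fin 4) : Commute (D j) (D k / D l) :=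
  div_eq_mul_inv (D k) (D l) ▸ (h.D_D j k).mul_right (h.D_D j l).inv_right

theorem D_div_D_div (h : GLRelations E F D) (j k l m : Fin 4) :
    Commute (D j / D k) (D l / D m) :=
  div_eq_mul_inv (D j) (D k) ▸ (h.D_D_div j l m).mul_left (h.D_D_div k l m).inv_left

end GLRelations

namespace UqGL

section Lift

variable {R : Type*} [Ring R] [Algebra Cq R] {E F : Fin 3 → R} {D : Fin 4 → Rˣ}

/-- The images of the generators prescribed by families `E`, `F`, `D`. -/
def genValue (E F : Fin 3 → R) (D : Fin 4 → Rˣ) : Gen → R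
  | .E i => E i
  | .F i => F i
  | .D j => D j
  | .Dinv j => ↑(D j)⁻¹

theorem lift_genValue_rel (h : GLRelations E F D) ⦃x y : FreeAlgebra Cq Gen⦄ (hxy : GLRel x y) :
    FreeAlgebra.lift Cq (genValue E F D) x = FreeAlgebra.lift Cq (genValue E F D) y := by
  induction hxy with
  | D_mul_Dinv j => simp [genValue]
  | Dinv_mul_D j => simp [genValue]
  | D_comm j k => simpa [genValue] using congrArg Units.val (h.D_D j k).eq
  | D_E i j => simp [genValue, (h.D_E i j).eq]
  | D_F i j => simp [genValue, (h.D_F i j).eq]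
  | E_F_same i =>
    have hD : D i.succ / D i.castSucc = (D i.castSucc)⁻¹ * D i.succ :=
      div_eq_mul_inv (D i.succ) _ ▸ (h.D_D _ _).inv_right.eq
    simp [genValue, h.E_F_same, hD, div_eq_mul_inv]
  | E_F_ne i j hij => simp [genValue, (h.E_F_ne hij).eq]
  | E_comm i j hij => simp [genValue, (h.E_E hij).eq]
  | F_comm i j hij => simp [genValue, (h.F_F hij).eq]
  | E_serre i j hij => simpa [genValue, serre, sq, qInt_two, mul_assoc] using h.E_serre hij
  | F_serre i j hij => simpa [genValue, serre, sq, qInt_two, mul_assoc] using h.F_serre hij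

/-- The universal property of `U_q(𝔤𝔩₄)`. -/
def lift (h : GLRelations E F D) : UqGL →ₐ[Cq] R :=
  RingQuot.liftAlgHom Cq ⟨FreeAlgebra.lift Cq (genValue E F D), lift_genValue_rel h⟩

theorem lift_gen (h : GLRelations E F D) (x : Gen) : lift h (gen x) = genValue E F D x :=
  (RingQuot.liftAlgHom_mkAlgHom_apply ..).trans (FreeAlgebra.lift_ι_apply _ _)

end Lift

/-- The quotient map of the presentation of `U_q(𝔤𝔩₄)`. -/
def ofFree : FreeAlgebra Cq Gen →ₐ[Cq] UqGL := RingQuot.mkAlgHom Cq GLRel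

theorem ofFree_eq {x y : FreeAlgebra Cq Gen} (h : GLRel x y) : ofFree x = ofFree y :=
  RingQuot.mkAlgHom_rel Cq h

/-- The generator `D_j` as a unit of `U_q(𝔤𝔩₄)`. -/
def unitD (j : Fin 4) : UqGLˣ where
  val := D j
  inv := Dinv j
  val_inv := (map_mul ofFree _ _).symm.trans ((ofFree_eq (.D_mul_Dinv j)).trans (map_one _))
  inv_val := (map_mul ofFree _ _).symm.trans ((ofFree_eq (.Dinv_mul_D j)).trans (map_one _))

theorem commute_unitD (j k : Fin 4) : Commute (unitD j) (unitD k) := by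
  have h := ofFree_eq (.D_comm j k)
  simp only [map_mul] at h
  exact Units.ext h

theorem unitD_div_comm (i : Fin 3) :
    ((unitD i.succ / unitD i.castSucc : UqGLˣ) : UqGL) = Kinv i := by
  rw [div_eq_mul_inv, (commute_unitD _ _).inv_right.eq]
  rfl

theorem glRelations : GLRelations E F unitD where
  D_D := commute_unitD
  D_E i j := by
    have h := ofFree_eq (.D_E i j)
    simp only [map_mul, map_smul] at h
    rw [QCommute, ← smul_mul_assoc, ← Units.mul_inv_eq_iff_eq_mul]
    exact h
  D_F i j := by
    have h := ofFree_eq (.D_F i j)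
    simp only [map_mul, map_smul] at h
    rw [QCommute, ← smul_mul_assoc, ← Units.mul_inv_eq_iff_eq_mul]
    exact h
  E_F_same i := by
    have h := ofFree_eq (.E_F_same i)
    simp only [map_mul, map_smul, map_sub] at h
    rw [unitD_div_comm, ← sub_eq_iff_eq_add', div_eq_mul_inv]
    exact h
  E_F_ne {i j} hij := by
    have h := ofFree_eq (.E_F_ne i j hij)
    simp only [map_mul, map_sub, map_zero] at h
    exact sub_eq_zero.1 h
  E_E {i j} hij := by
    have h := ofFree_eq (.E_comm i j hij)
    simp only [map_mul] at h
    exact h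
  F_F {i j} hij := by
    have h := ofFree_eq (.F_comm i j hij)
    simp only [map_mul] at h
    exact h
  E_serre {i j} hij := by
    have h := ofFree_eq (.E_serre i j hij)
    simp only [map_mul, map_sub, map_add, map_smul, map_zero, sq, qInt_two, mul_assoc] at h
    exact h
  F_serre {i j} hij := by
    have h := ofFree_eq (.F_serre i j hij)
    simp only [map_mul, map_sub, map_add, map_smul, map_zero, sq, qInt_two, mul_assoc] at h
    exact h

end UqGL

/-! ### Relations in the coideal subalgebra -/

section CoidealSerre

variable {𝕜 A : Type*} [Field 𝕜] [Ring A] [Algebra 𝕜 A] {q : 𝕜} {e f g h k : A}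

theorem coideal_serre_left {l : A} (h0 : q ≠ 0) (hfg : serre q f g = 0) (heh : serre q e h = 0)
    (hef : Commute e f) (heg : Commute e g) (hhf : Commute h f)
    (hkf : QCommute q 2 k f) (hkg : QCommute q (-1) k g) (hke : Commute k e)
    (hkh : QCommute q 1 k h) (hlf : QCommute q (-1) l f) (hle : QCommute q 1 l e)
    (hkl : Commute k l) : serre q (f + e * k) (g + q⁻¹ • (h * l)) = 0 := by
  refine serre_add_eq_zero h0 ?_ ?_ ?_ hfg ?_
  · simpa only [zero_add] using (QCommute.of_commute hef).mul_left h0 hkf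
  · simpa only [zero_add] using (QCommute.of_commute heg).mul_left h0 hkg
  · rw [QCommute, smul_mul_assoc, ((QCommute.of_commute hhf).mul_left h0 hlf).eq, zero_add,
      mul_smul_comm, smul_comm]
  · have hserre := serre_mul_mul hkl hke hkh hle
    rw [heh, zero_mul, smul_zero] at hserre
    rw [serre_smul_right, hserre, smul_zero]

theorem coideal_serre_right {l : Aˣ} (h0 : q ≠ 0) (h1 : q ^ 2 - 1 ≠ 0)
    (hgf : serre q g f = 0) (hhe : serre q h e = 0) (heg : Commute e g) (hhf : Commute h f)
    (hhg : h * g = g * h + (q - q⁻¹)⁻¹ • ((↑l⁻¹ : A) - l))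
    (hkg : QCommute q (-1) k g) (hkh : QCommute q 1 k h)
    (hlf : QCommute q (-1) (l : A) f) (hle : QCommute q 1 (l : A) e)
    (hlg : QCommute q 2 (l : A) g) (hlh : QCommute q (-2) (l : A) h) (hlk : Commute (l : A) k) :
    serre q (g + q⁻¹ • (h * l)) (f + e * k) = f + e * k := by
  have _ : q - q⁻¹ ≠ 0 := sub_inv_ne_zero h0 h1
  have hKf : QCommute q 1 (↑l⁻¹ : A) f := hlf.units_inv_left h0
  have hKe : QCommute q (-1) (↑l⁻¹ : A) e := hle.units_inv_left h0
  have hKk : Commute (↑l⁻¹ : A) k := hlk.units_inv_left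
  have hKl : (↑l⁻¹ : A) * l = 1 := l.inv_mul
  have hserre := congrArg (· * (k * (↑l * (↑l : A)))) hhe
  simp only [serre] at hgf hserre ⊢
  simp only [mul_add, add_mul, mul_assoc, smul_mul_assoc, mul_smul_comm, smul_smul, smul_add,
    mul_sub, sub_mul, smul_sub, mul_one, hkg.eq, hlf.eq, hlk.eq, hlg.eq, hKl,
    mul_mul_of_mul_eq heg.eq, mul_mul_of_mul_eq hhf.eq, mul_mul_of_mul_eq hkg.eq,
    mul_mul_of_mul_eq hkh.eq, mul_mul_of_mul_eq hlf.eq, mul_mul_of_mul_eq hle.eq,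
    mul_mul_of_mul_eq hlk.eq, mul_mul_of_mul_eq hhg, mul_mul_of_mul_eq hlg.eq,
    mul_mul_of_mul_eq hlh.eq, mul_mul_of_mul_eq hKf.eq, mul_mul_of_mul_eq hKe.eq,
    mul_mul_of_mul_eq hKk.eq]
  simp only [sub_mul, add_mul, smul_mul_assoc, mul_assoc, zero_mul, zpow_neg, zpow_ofNat]
    at hserre ⊢
  linear_combination (norm := skip) hgf + (q ^ 2)⁻¹ • hserre
  match_scalars <;> field_simp <;> ring

end CoidealSerre

/-- The relations between the generators `B₁`, `B₋₁`, `B₀`, `K = D̂_♦ D̂_1⁻¹` of the coideal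
subalgebra and the elements `X`, `Y`, `Z`. -/
structure CoidealRelations {𝕜 A : Type*} [Field 𝕜] [Ring A] [Algebra 𝕜 A] (q : 𝕜)
    (B₁ Bₘ B₀ : A) (K : Aˣ) (X Y Z : A) : Prop where
  K_Bₘ : QCommute q (-2) (K : A) Bₘ
  K_B₀ : QCommute q 0 (K : A) B₀
  B₁_Bₘ : B₁ * Bₘ = Bₘ * B₁ + (q - q⁻¹)⁻¹ • ((K : A) - ↑K⁻¹)
  B₀_B₁ : B₀ * B₁ = X + q⁻¹ • (B₁ * B₀)
  B₀_Bₘ : B₀ * Bₘ = Y + q⁻¹ • (Bₘ * B₀)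
  B₁_Y : B₁ * Y = Z + q⁻¹ • (Y * B₁)
  B₀_X : B₀ * X = q • (X * B₀) + B₁
  B₀_Y : B₀ * Y = q • (Y * B₀) + Bₘ
  Y_Bₘ : Y * Bₘ = q • (Bₘ * Y)

namespace CoidealRelations

variable {𝕜 A : Type*} [Field 𝕜] [Ring A] [Algebra 𝕜 A] {q : 𝕜} {B₁ Bₘ B₀ X Y Z : A} {K : Aˣ}

theorem X_eq (h : CoidealRelations q B₁ Bₘ B₀ K X Y Z) : X = B₀ * B₁ - q⁻¹ • (B₁ * B₀) :=
  eq_sub_of_add_eq h.B₀_B₁.symm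

theorem Y_eq (h : CoidealRelations q B₁ Bₘ B₀ K X Y Z) : Y = B₀ * Bₘ - q⁻¹ • (Bₘ * B₀) :=
  eq_sub_of_add_eq h.B₀_Bₘ.symm

theorem Z_eq (h : CoidealRelations q B₁ Bₘ B₀ K X Y Z) : Z = B₁ * Y - q⁻¹ • (Y * B₁) :=
  eq_sub_of_add_eq h.B₁_Y.symm

theorem K_Y (h : CoidealRelations q B₁ Bₘ B₀ K X Y Z) (h0 : q ≠ 0) :
    QCommute q (-2) (K : A) Y := by
  rw [h.Y_eq]
  have hB₀Bₘ : QCommute q (-2) (K : A) (B₀ * Bₘ) := h.K_B₀.mul_right h0 h.K_Bₘ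
  have hBₘB₀ : QCommute q (-2) (K : A) (Bₘ * B₀) := h.K_Bₘ.mul_right h0 h.K_B₀
  exact hB₀Bₘ.sub_right (hBₘB₀.smul_right _)

theorem Kinv_Y (h : CoidealRelations q B₁ Bₘ B₀ K X Y Z) (h0 : q ≠ 0) :
    QCommute q 2 (↑K⁻¹ : A) Y := (h.K_Y h0).units_inv_left h0

theorem Kinv_B₀ (h : CoidealRelations q B₁ Bₘ B₀ K X Y Z) : Commute (↑K⁻¹ : A) B₀ :=
  h.K_B₀.commute.units_inv_left

theorem X_Bₘ (h : CoidealRelations q B₁ Bₘ B₀ K X Y Z) :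
    X * Bₘ = q⁻¹ • (Bₘ * X) + (1 - (q ^ 2)⁻¹) • (Y * B₁)
      + ((1 - (q ^ 2)⁻¹) * (q - q⁻¹)⁻¹) • (B₀ * ((K : A) - ↑K⁻¹)) - q⁻¹ • Z := by
  calc
    X * Bₘ = B₀ * (B₁ * Bₘ) - q⁻¹ • (B₁ * (B₀ * Bₘ)) := by
      nth_rw 1 [h.X_eq]
      simp only [sub_mul, smul_mul_assoc, mul_assoc]
    _ = _ := by
      simp only [mul_sub, sub_mul, mul_add, add_mul, mul_assoc, smul_mul_assoc, mul_smul_comm,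
        smul_add, smul_sub, smul_smul, h.B₁_Bₘ, h.B₀_Bₘ, h.B₀_B₁, h.B₁_Y, h.K_B₀.commute.eq,
        h.Kinv_B₀.eq, mul_mul_of_mul_eq h.B₁_Bₘ, mul_mul_of_mul_eq h.B₀_Bₘ]
      module

theorem X_Y_add (h : CoidealRelations q B₁ Bₘ B₀ K X Y Z) (h0 : q ≠ 0) :
    X * Y = Y * X - (q⁻¹ * (q - q⁻¹)⁻¹) • ((K : A) - ↑K⁻¹) - (q ^ 2)⁻¹ • (B₀ * Z - Z * B₀) := by
  have hXB₀ : X * B₀ = q⁻¹ • (B₀ * X) - q⁻¹ • B₁ := by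
    rw [h.B₀_X, smul_add, smul_smul, inv_mul_cancel₀ h0, one_smul, add_sub_cancel_right]
  calc
    X * Y = q⁻¹ • (B₀ * (X * Bₘ)) - q⁻¹ • (B₁ * Bₘ) - q⁻¹ • (X * Bₘ * B₀) := by
      nth_rw 1 [h.Y_eq]
      rw [mul_sub, ← mul_assoc, hXB₀, sub_mul, smul_mul_assoc, smul_mul_assoc, mul_smul_comm,
        mul_assoc, mul_assoc]
    _ = _ := by
      simp only [h.X_Bₘ, mul_sub, sub_mul, mul_add, add_mul, mul_assoc, smul_mul_assoc,
        mul_smul_comm, smul_add, smul_sub, smul_smul, h.B₁_Bₘ, h.B₀_B₁, h.B₀_X,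
        h.K_B₀.commute.eq, h.Kinv_B₀.eq, mul_mul_of_mul_eq h.B₀_Bₘ, mul_mul_of_mul_eq h.B₀_Y]
      match_scalars <;> field_simp <;> ring

theorem B₀_Z_sub (h : CoidealRelations q B₁ Bₘ B₀ K X Y Z) (h0 : q ≠ 0) :
    B₀ * Z - Z * B₀ = X * Y - Y * X + (q⁻¹ * (q - q⁻¹)⁻¹) • ((K : A) - ↑K⁻¹) := by
  have hK : (q - q⁻¹)⁻¹ • ((K : A) - ↑K⁻¹) = B₁ * Bₘ - Bₘ * B₁ :=
    (sub_eq_of_eq_add' h.B₁_Bₘ).symm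
  rw [mul_smul, hK, h.Z_eq]
  simp only [mul_sub, sub_mul, mul_add, add_mul, mul_assoc, smul_mul_assoc, mul_smul_comm,
    smul_add, smul_sub, smul_smul, h.B₀_B₁, h.B₀_Y, mul_mul_of_mul_eq h.B₀_B₁,
    mul_mul_of_mul_eq h.B₀_Y]
  match_scalars <;> field_simp <;> ring

-- The two expressions for `[X, Y]` contain the commutator `[B₀, Z]` with different coefficients.
theorem B₀_Z (h : CoidealRelations q B₁ Bₘ B₀ K X Y Z) (h0 : q ≠ 0) (h2 : q ^ 2 + 1 ≠ 0) :
    Commute B₀ Z := by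
  have hcomm : (q ^ 2 + 1) • (B₀ * Z - Z * B₀) = 0 := by
    have hsub := h.B₀_Z_sub h0
    rw [h.X_Y_add h0] at hsub
    linear_combination (norm := skip) q ^ 2 • hsub
    match_scalars <;> field_simp <;> ring
  exact sub_eq_zero.1 ((smul_eq_zero_iff_right h2).1 hcomm)

theorem X_Y (h : CoidealRelations q B₁ Bₘ B₀ K X Y Z) (h0 : q ≠ 0) (h2 : q ^ 2 + 1 ≠ 0) :
    X * Y = Y * X - (q⁻¹ * (q - q⁻¹)⁻¹) • ((K : A) - ↑K⁻¹) := by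
  rw [h.X_Y_add h0, (h.B₀_Z h0 h2).eq, sub_self, smul_zero, sub_zero]

theorem Z_Bₘ (h : CoidealRelations q B₁ Bₘ B₀ K X Y Z) (h0 : q ≠ 0) (h1 : q ^ 2 - 1 ≠ 0) :
    Z * Bₘ = q • (Bₘ * Z) - (q ^ 2 + 1) • (Y * (↑K⁻¹ : A)) := by
  have _ : q - q⁻¹ ≠ 0 := sub_inv_ne_zero h0 h1
  calc
    Z * Bₘ = B₁ * (Y * Bₘ) - q⁻¹ • (Y * (B₁ * Bₘ)) := by
      nth_rw 1 [h.Z_eq]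
      simp only [sub_mul, smul_mul_assoc, mul_assoc]
    _ = _ := by
      simp only [mul_sub, sub_mul, mul_add, add_mul, mul_assoc, smul_mul_assoc, mul_smul_comm,
        smul_add, smul_sub, smul_smul, h.B₁_Bₘ, h.B₁_Y, h.Y_Bₘ, (h.K_Y h0).eq, (h.Kinv_Y h0).eq,
        mul_mul_of_mul_eq h.Y_Bₘ, mul_mul_of_mul_eq h.B₁_Bₘ, zpow_neg, zpow_ofNat]
      match_scalars <;> field_simp <;> ring

theorem Z_Y (h : CoidealRelations q B₁ Bₘ B₀ K X Y Z) (h0 : q ≠ 0) (h1 : q ^ 2 - 1 ≠ 0)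
    (h2 : q ^ 2 + 1 ≠ 0) :
    Z * Y = q • (Y * Z)
      - (q ^ 2 + 1) • (Bₘ * (↑K⁻¹ : A) + (q - q⁻¹) • (Y * (B₀ * (↑K⁻¹ : A)))) := by
  have hB₀Z := h.B₀_Z h0 h2
  calc
    Z * Y = B₀ * (Z * Bₘ) - q⁻¹ • (Z * Bₘ * B₀) := by
      nth_rw 1 [h.Y_eq]
      rw [mul_sub, ← mul_assoc, ← hB₀Z.eq, mul_smul_comm, mul_assoc, mul_assoc]
    _ = _ := by
      simp only [h.Z_Bₘ h0 h1, mul_sub, sub_mul, mul_add, add_mul, mul_assoc, smul_mul_assoc,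
        mul_smul_comm, smul_add, smul_sub, smul_smul, h.Kinv_B₀.eq, hB₀Z.eq,
        mul_mul_of_mul_eq h.B₀_Bₘ, mul_mul_of_mul_eq h.B₀_Y]
      match_scalars <;> field_simp <;> ring

theorem lower_comm (h : CoidealRelations q B₁ Bₘ B₀ K X Y Z) (h0 : q ≠ 0) {c : 𝕜} (hc : c ≠ 0) :
    (Bₘ - (q * c)⁻¹ • Y) * (Bₘ + c • Y) = (Bₘ + (q⁻¹ * c) • Y) * (Bₘ - c⁻¹ • Y) := by
  simp only [mul_add, add_mul, mul_sub, sub_mul, smul_mul_assoc, mul_smul_comm, smul_add, smul_sub,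
    smul_smul, h.Y_Bₘ]
  match_scalars <;> field_simp
  ring

end CoidealRelations

namespace UqGL

/-- `K_i⁻¹` as a unit of `U_q(𝔤𝔩₄)`. -/
def unitKinv (i : Fin 3) : UqGLˣ := unitD i.succ / unitD i.castSucc

theorem unitKinv_val (i : Fin 3) : (unitKinv i : UqGL) = Kinv i := unitD_div_comm i

theorem Kinv_E (i j : Fin 3) : QCommute q (-cartan i j) (Kinv i) (E j) := by
  rw [← unitKinv_val, cartan, neg_sub]
  exact glRelations.D_div_E ..

theorem Kinv_F (i j : Fin 3) : QCommute q (cartan i j) (Kinv i) (F j) := by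
  rw [← unitKinv_val]
  exact glRelations.D_div_F ..

theorem Kinv_E_of_adjacent {i j : Fin 3} (h : Adjacent i j) : QCommute q 1 (Kinv i) (E j) := by
  simpa only [cartan_of_adjacent h, neg_neg] using Kinv_E i j

theorem Kinv_F_of_adjacent {i j : Fin 3} (h : Adjacent i j) : QCommute q (-1) (Kinv i) (F j) :=
  cartan_of_adjacent h ▸ Kinv_F i j

theorem E_F_same (i : Fin 3) : E i * F i = F i * E i +
    (q - q⁻¹)⁻¹ • ((↑(unitKinv i)⁻¹ : UqGL) - unitKinv i) := by
  rw [unitKinv, inv_div]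
  exact glRelations.E_F_same i

theorem commute_unitKinv (i j : Fin 3) : Commute (unitKinv i) (unitKinv j) :=
  glRelations.D_div_D_div ..

theorem commute_Kinv (i j : Fin 3) : Commute (Kinv i) (Kinv j) := by
  rw [← unitKinv_val, ← unitKinv_val]
  exact (commute_unitKinv i j).units_val

theorem serre_B_Bzero {i : Fin 3} (hi : Adjacent i 1) : serre q (B i) Bzero = 0 := by
  have hi' : Adjacent i.rev 1 := hi.rev
  have hne : i ≠ 1 ∧ i.rev ≠ i ∧ i.rev ≠ 1 := by
    revert i; unfold Adjacent; decide
  have hcartan : cartan i i.rev = 0 := by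
    revert i; unfold Adjacent; decide
  refine coideal_serre_left q_ne_zero (glRelations.F_serre hi) (glRelations.E_serre hi')
    (glRelations.E_F_ne hne.2.1) (glRelations.E_F_ne hne.2.2) (glRelations.E_F_ne hne.1.symm)
    (cartan_self i ▸ Kinv_F i i) (Kinv_F_of_adjacent hi) ?_
    (Kinv_E_of_adjacent hi) (Kinv_F_of_adjacent hi.symm)
    (Kinv_E_of_adjacent hi'.symm) (commute_Kinv _ _)
  exact (hcartan ▸ Kinv_E i i.rev : QCommute q (-0) _ _).commute

theorem serre_Bzero_B {i : Fin 3} (hi : Adjacent i 1) : serre q Bzero (B i) = B i := by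
  have hi' : Adjacent i.rev 1 := hi.rev
  have hne : i ≠ 1 ∧ i.rev ≠ 1 := by
    revert i; unfold Adjacent; decide
  rw [Bzero, B, ← unitKinv_val 1]
  refine coideal_serre_right q_ne_zero q_sq_sub_one_ne_zero (glRelations.F_serre hi.symm)
    (glRelations.E_serre hi'.symm)
    (glRelations.E_F_ne hne.2) (glRelations.E_F_ne hne.1.symm) (E_F_same 1)
    (Kinv_F_of_adjacent hi) (Kinv_E_of_adjacent hi) ?_ ?_ ?_ ?_ ?_
  all_goals rw [unitKinv_val]
  · exact Kinv_F_of_adjacent hi.symm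
  · exact Kinv_E_of_adjacent hi'.symm
  · exact cartan_self 1 ▸ Kinv_F 1 1
  · exact cartan_self 1 ▸ Kinv_E 1 1
  · exact commute_Kinv _ _

/-- `D̂_j` as a unit of `U_q(𝔤𝔩₄)`. -/
def unitDhat (j : Fin 4) : UqGLˣ := unitD j * unitD j.rev

theorem unitDhat_rev (j : Fin 4) : unitDhat j.rev = unitDhat j := by
  rw [unitDhat, unitDhat, Fin.rev_rev, (commute_unitD _ _).eq]

theorem unitDhat_eq (j : Fin 4) : unitDhat j = unitDhat 2 ∨ unitDhat j = unitDhat 3 := by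
  fin_cases j
  exacts [.inr (unitDhat_rev 3), .inl (unitDhat_rev 2), .inl rfl, .inr rfl]

theorem Dhat_Kinv (j : Fin 4) (i : Fin 3) : QCommute q 0 (unitDhat j : UqGL) (Kinv i) := by
  rw [← unitKinv_val]
  exact .of_commute ((glRelations.D_D_div j _ _).mul_left (glRelations.D_D_div j.rev _ _)).units_val

theorem Dhat_B (j : Fin 4) (i : Fin 3) :
    QCommute q (wt i.rev j + wt i.rev j.rev) (unitDhat j : UqGL) (B i) := by
  have hrev : -wt i j + -wt i j.rev = wt i.rev j + wt i.rev j.rev := by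
    revert i j; decide
  have hF : QCommute q (wt i.rev j + wt i.rev j.rev) (unitDhat j : UqGL) (F i) :=
    hrev ▸ (glRelations.D_F i j).mul_left q_ne_zero (glRelations.D_F i j.rev)
  have hE := ((glRelations.D_E i.rev j).mul_left q_ne_zero (glRelations.D_E i.rev j.rev)).mul_right
    q_ne_zero (Dhat_Kinv j i)
  rw [add_zero] at hE
  exact hF.add_right hE

theorem Dhat_Bzero (j : Fin 4) : QCommute q 0 (unitDhat j : UqGL) Bzero := by
  have hwt : wt 1 j + wt 1 j.rev = 0 ∧ -wt 1 j + -wt 1 j.rev = 0 := by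
    revert j; decide
  have hF : QCommute q 0 (unitDhat j : UqGL) (F 1) :=
    hwt.2 ▸ (glRelations.D_F 1 j).mul_left q_ne_zero (glRelations.D_F 1 j.rev)
  have hE : QCommute q 0 (unitDhat j : UqGL) (E 1) :=
    hwt.1 ▸ (glRelations.D_E 1 j).mul_left q_ne_zero (glRelations.D_E 1 j.rev)
  exact hF.add_right (.smul_right _ (hE.mul_right q_ne_zero (Dhat_Kinv j 1)))

theorem unitDhat_div : unitDhat 2 / unitDhat 3 = unitKinv 0 * (unitKinv 2)⁻¹ := by
  have hD := commute_unitD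
  change unitD 2 * unitD 1 / (unitD 3 * unitD 0) = unitD 1 / unitD 0 * (unitD 3 / unitD 2)⁻¹
  simp only [div_eq_mul_inv, mul_inv_rev, inv_inv, ← mul_assoc]
  rw [mul_assoc (unitD 2), ((hD 2 1).mul_right (hD 2 0).inv_right).eq]

theorem B_commutator : B 0 * B 2 = B 2 * B 0 + (q - q⁻¹)⁻¹ •
    (((unitDhat 2 / unitDhat 3 : UqGLˣ) : UqGL) - ↑(unitDhat 2 / unitDhat 3)⁻¹) := by
  have hB0 : B 0 = F 0 + E 2 * unitKinv 0 := congrArg (F 0 + E 2 * ·) (unitKinv_val 0).symm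
  have hB2 : B 2 = F 2 + E 0 * unitKinv 2 := congrArg (F 2 + E 0 * ·) (unitKinv_val 2).symm
  have hEE : E 0 * E 2 = E 2 * E 0 := (glRelations.E_E (by unfold Adjacent; decide)).eq
  have hFF : F 0 * F 2 = F 2 * F 0 := (glRelations.F_F (by unfold Adjacent; decide)).eq
  have hK0F2 : (unitKinv 0 : UqGL) * F 2 = F 2 * unitKinv 0 :=
    unitKinv_val 0 ▸ (Kinv_F 0 2 : QCommute q 0 _ _).commute.eq
  have hK2F0 : (unitKinv 2 : UqGL) * F 0 = F 0 * unitKinv 2 :=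
    unitKinv_val 2 ▸ (Kinv_F 2 0 : QCommute q 0 _ _).commute.eq
  have hK0E0 := unitKinv_val 0 ▸ (Kinv_E 0 0 : QCommute q (-2) _ _).eq
  have hK2E2 := unitKinv_val 2 ▸ (Kinv_E 2 2 : QCommute q (-2) _ _).eq
  have hK02 : (unitKinv 0 : UqGL) * unitKinv 2 = unitKinv 2 * unitKinv 0 :=
    (commute_unitKinv 0 2).units_val.eq
  have hK02' : (unitKinv 0 : UqGL) * ↑(unitKinv 2)⁻¹ = ↑(unitKinv 2)⁻¹ * unitKinv 0 :=
    (commute_unitKinv 0 2).inv_right.units_val.eq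
  rw [unitDhat_div, mul_inv_rev, inv_inv, (commute_unitKinv 2 0).inv_right.eq, Units.val_mul,
    Units.val_mul, hB0, hB2]
  simp only [mul_add, add_mul, mul_assoc, smul_mul_assoc, mul_smul_comm, smul_sub, sub_mul,
    hK0F2, hK2F0, hFF, mul_mul_of_mul_eq hEE, mul_mul_of_mul_eq hK0E0, mul_mul_of_mul_eq hK2E2,
    hK02, hK02', mul_mul_of_mul_eq (E_F_same _)]
  abel

end UqGL

/-- `D̂_♦` as a unit of `U_q'`. -/
def unitDd : Uq'ˣ where
  val := Dd
  inv := DdInv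
  val_inv := Subtype.ext (UqGL.unitDhat 2).mul_inv
  inv_val := Subtype.ext (UqGL.unitDhat 2).inv_mul

/-- `D̂_1` as a unit of `U_q'`. -/
def unitD1 : Uq'ˣ where
  val := D1
  inv := D1Inv
  val_inv := Subtype.ext (UqGL.unitDhat 3).mul_inv
  inv_val := Subtype.ext (UqGL.unitDhat 3).inv_mul

theorem Dd_Bm1 : QCommute q (-1) Dd Bm1 := Subtype.ext (UqGL.Dhat_B 2 2)

theorem D1_Bm1 : QCommute q 1 D1 Bm1 := Subtype.ext (UqGL.Dhat_B 3 2)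

theorem Dd_B0 : QCommute q 0 Dd B0 := Subtype.ext (UqGL.Dhat_Bzero 2)

theorem D1_B0 : QCommute q 0 D1 B0 := Subtype.ext (UqGL.Dhat_Bzero 3)

theorem QCommute.Y_right {n : ℤ} {x : Uq'} (h0 : QCommute q 0 x B0) (hm : QCommute q n x Bm1) :
    QCommute q n x Y := by
  have h : QCommute q n x (B0 * Bm1) := zero_add n ▸ h0.mul_right q_ne_zero hm
  have h' : QCommute q n x (Bm1 * B0) := add_zero n ▸ hm.mul_right q_ne_zero h0
  exact h.sub_right (h'.smul_right _)

theorem QCommute.Fminus_right {n : ℤ} {x : Uq'} (h0 : QCommute q 0 x B0)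
    (hm : QCommute q n x Bm1) (c : Cq) : QCommute q n x (Fminus c) :=
  hm.add_right ((QCommute.Y_right h0 hm).smul_right c)

/-- `K̂ = D̂_♦ D̂_1⁻¹`. -/
def unitK : Uq'ˣ := unitDd / unitD1

theorem qComm_qComm {a b : Uq'} (h : serre q a b = b) :
    a * qComm q⁻¹ a b = q • (qComm q⁻¹ a b * a) + b :=
  sub_eq_iff_eq_add'.1 ((serre_eq_mul_sub q_ne_zero a b).symm.trans h)

theorem qComm_mul {a b : Uq'} (h : serre q b a = 0) :
    qComm q⁻¹ a b * b = q • (b * qComm q⁻¹ a b) :=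
  sub_eq_zero.1 ((serre_eq_sub_mul q_ne_zero b a).symm.trans h)

theorem coidealRelations : CoidealRelations q B1 Bm1 B0 unitK X Y Z where
  K_Bₘ := Dd_Bm1.mul_left q_ne_zero (QCommute.units_inv_left (u := unitD1) q_ne_zero D1_Bm1)
  K_B₀ := Dd_B0.mul_left q_ne_zero (QCommute.units_inv_left (u := unitD1) q_ne_zero D1_B0)
  B₁_Bₘ := Subtype.ext UqGL.B_commutator
  B₀_B₁ := (sub_add_cancel _ _).symm
  B₀_Bₘ := (sub_add_cancel _ _).symm
  B₁_Y := (sub_add_cancel _ _).symm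
  B₀_X := qComm_qComm (Subtype.ext (UqGL.serre_Bzero_B (i := 0) (by unfold Adjacent; decide)))
  B₀_Y := qComm_qComm (Subtype.ext (UqGL.serre_Bzero_B (i := 2) (by unfold Adjacent; decide)))
  Y_Bₘ := qComm_mul (Subtype.ext (UqGL.serre_B_Bzero (i := 2) (by unfold Adjacent; decide)))

theorem uq'_induction {P : Uq' → Prop} (hB1 : P B1) (hBm1 : P Bm1) (hB0 : P B0) (hDd : P Dd)
    (hDdInv : P DdInv) (hD1 : P D1) (hD1Inv : P D1Inv) (hc : ∀ c : Cq, P (algebraMap Cq Uq' c))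
    (hadd : ∀ x y, P x → P y → P (x + y)) (hmul : ∀ x y, P x → P y → P (x * y)) (x : Uq') :
    P x := by
  obtain ⟨x, hx⟩ := x
  induction hx using Algebra.adjoin_induction with
  | mem x hx =>
    rcases hx with ((rfl | rfl | rfl) | ⟨j, rfl⟩) | ⟨j, rfl⟩
    · exact hB1
    · exact hBm1
    · exact hB0
    · rcases UqGL.unitDhat_eq j with hj | hj
      · exact (Subtype.ext (congrArg Units.val hj.symm) : Dd = ⟨UqGL.Dhat j, _⟩) ▸ hDd
      · exact (Subtype.ext (congrArg Units.val hj.symm) : D1 = ⟨UqGL.Dhat j, _⟩) ▸ hD1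
    · rcases UqGL.unitDhat_eq j with hj | hj
      · exact (Subtype.ext (congrArg Units.inv hj.symm) : DdInv = ⟨UqGL.DhatInv j, _⟩) ▸ hDdInv
      · exact (Subtype.ext (congrArg Units.inv hj.symm) : D1Inv = ⟨UqGL.DhatInv j, _⟩) ▸ hD1Inv
  | algebraMap c => exact hc c
  | add x y _ _ hx hy => exact hadd _ _ hx hy
  | mul x y _ _ hx hy => exact hmul _ _ hx hy

/-! ### Lowering and raising operators -/

section Module

variable {𝕜 A M : Type*} [Field 𝕜] [Ring A] [Algebra 𝕜 A] [AddCommGroup M] [Module 𝕜 M]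
  [Module A M] [IsScalarTower 𝕜 A M]

theorem smul_smul_of_mul_eq {x y z : A} (h : x * y = z) (m : M) : x • y • m = z • m := by
  rw [smul_smul, h]

theorem units_inv_smul {u : Aˣ} {c : 𝕜} {m : M} (h : (u : A) • m = c • m) :
    (↑u⁻¹ : A) • m = c⁻¹ • m := by
  rcases eq_or_ne c 0 with rfl | hc
  · rw [zero_smul] at h
    rw [inv_zero, zero_smul, ← one_smul A m, ← u.inv_mul, mul_smul, h, smul_zero, smul_zero]
  · rw [eq_inv_smul_iff₀ hc, ← smul_comm, ← h, smul_smul, u.inv_mul, one_smul]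

theorem QCommute.smul_smul {q c : 𝕜} {n : ℤ} {x y : A} {m : M} (h : QCommute q n x y)
    (hx : x • m = c • m) : x • y • m = (q ^ n * c) • y • m := by
  rw [smul_smul_of_mul_eq h.eq, smul_assoc, mul_smul, hx, smul_comm y, mul_smul]

end Module

namespace CoidealRelations

variable {𝕜 A M : Type*} [Field 𝕜] [Ring A] [Algebra 𝕜 A] [AddCommGroup M] [Module 𝕜 M]
  [Module A M] [IsScalarTower 𝕜 A M] {q : 𝕜} {B₁ Bₘ B₀ X Y Z : A} {K : Aˣ} {m : M} {k c z : 𝕜}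

theorem B₀_lower (h : CoidealRelations q B₁ Bₘ B₀ K X Y Z) (h0 : q ≠ 0) (h1 : q ^ 2 - 1 ≠ 0)
    (hc : c ≠ 0) (hB₀ : B₀ • m = ((c - c⁻¹) / (q - q⁻¹)) • m) :
    B₀ • (Bₘ + c • Y) • m = ((q * c - (q * c)⁻¹) / (q - q⁻¹)) • (Bₘ + c • Y) • m := by
  have _ : q - q⁻¹ ≠ 0 := sub_inv_ne_zero h0 h1
  simp only [add_smul, smul_add, smul_assoc, smul_comm (_ : A) (_ : 𝕜) (_ : M),
    smul_smul_of_mul_eq h.B₀_Bₘ, smul_smul_of_mul_eq h.B₀_Y, mul_smul, hB₀]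
  generalize Bₘ • m = Bm, Y • m = Ym
  match_scalars <;> field_simp <;> ring

theorem Z_lower (h : CoidealRelations q B₁ Bₘ B₀ K X Y Z) (h0 : q ≠ 0) (h1 : q ^ 2 - 1 ≠ 0)
    (h2 : q ^ 2 + 1 ≠ 0) (hc : c ≠ 0) (hB₀ : B₀ • m = ((c - c⁻¹) / (q - q⁻¹)) • m)
    (hK : (K : A) • m = k • m) (hZ : Z • m = z • m) :
    Z • (Bₘ + c • Y) • m = (q * z - (q ^ 2 + 1) * k⁻¹ * c) • (Bₘ + c • Y) • m := by
  have _ : q - q⁻¹ ≠ 0 := sub_inv_ne_zero h0 h1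
  simp only [add_smul, smul_add, smul_assoc, smul_comm (_ : A) (_ : 𝕜) (_ : M),
    smul_smul_of_mul_eq (h.Z_Bₘ h0 h1), smul_smul_of_mul_eq (h.Z_Y h0 h1 h2), mul_smul, sub_smul,
    hB₀, units_inv_smul hK, hZ]
  generalize Bₘ • m = Bm, Y • m = Ym
  match_scalars <;> field_simp <;> ring

theorem raise_lower (h : CoidealRelations q B₁ Bₘ B₀ K X Y Z) (h0 : q ≠ 0) (h1 : q ^ 2 - 1 ≠ 0)
    (h2 : q ^ 2 + 1 ≠ 0) (hc : c ≠ 0) (hB₀ : B₀ • m = ((c - c⁻¹) / (q - q⁻¹)) • m)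
    (hK : (K : A) • m = k • m) (hZ : Z • m = z • m) :
    (B₁ + (q * c) • X) • (Bₘ + c • Y) • m = (Bₘ + (q * c) • Y) • (B₁ + c • X) • m := by
  have _ : q - q⁻¹ ≠ 0 := sub_inv_ne_zero h0 h1
  simp only [add_smul, smul_add, smul_assoc, smul_comm (_ : A) (_ : 𝕜) (_ : M),
    smul_smul_of_mul_eq h.B₁_Bₘ, smul_smul_of_mul_eq h.B₁_Y, smul_smul_of_mul_eq h.X_Bₘ,
    smul_smul_of_mul_eq (h.X_Y h0 h2), mul_smul, sub_smul, smul_sub, hB₀, hK, units_inv_smul hK, hZ]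
  generalize Bₘ • B₁ • m = m₁, Bₘ • X • m = m₂, Y • B₁ • m = m₃, Y • X • m = m₄
  match_scalars <;> field_simp <;> ring

theorem raise_inv_lower (h : CoidealRelations q B₁ Bₘ B₀ K X Y Z) (h0 : q ≠ 0)
    (h1 : q ^ 2 - 1 ≠ 0) (h2 : q ^ 2 + 1 ≠ 0) (hc : c ≠ 0) (hc' : c ^ 2 + 1 ≠ 0)
    (hB₀ : B₀ • m = ((c - c⁻¹) / (q - q⁻¹)) • m)
    (hK : (K : A) • m = k • m) (hZ : Z • m = z • m) :
    (B₁ - (q * c)⁻¹ • X) • (Bₘ + c • Y) • m =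
      ((c ^ 2 + (q ^ 2)⁻¹) / (c ^ 2 + 1)) • (Bₘ + (q⁻¹ * c) • Y) • (B₁ - c⁻¹ • X) • m
      + ((1 - (q ^ 2)⁻¹) / (c ^ 2 + 1)) • (Bₘ - (q * c)⁻¹ • Y) • (B₁ + c • X) • m
      + ((1 + (q ^ 2)⁻¹ * (c ^ 2)⁻¹) * ((k - k⁻¹) / (q - q⁻¹) + z * c)) • m := by
  have _ : q - q⁻¹ ≠ 0 := sub_inv_ne_zero h0 h1
  simp only [add_smul, smul_add, smul_assoc, smul_comm (_ : A) (_ : 𝕜) (_ : M),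
    smul_smul_of_mul_eq h.B₁_Bₘ, smul_smul_of_mul_eq h.B₁_Y, smul_smul_of_mul_eq h.X_Bₘ,
    smul_smul_of_mul_eq (h.X_Y h0 h2), mul_smul, sub_smul, smul_sub, hB₀, hK, units_inv_smul hK, hZ]
  generalize Bₘ • B₁ • m = m₁, Bₘ • X • m = m₂, Y • B₁ • m = m₃, Y • X • m = m₄
  match_scalars <;> field_simp <;> ring

end CoidealRelations

theorem qBr_zero (c : Cq) : qBr c 0 = (c - c⁻¹) / (q - q⁻¹) := by
  simp only [qBr, neg_zero, zpow_zero, one_mul]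

theorem qBr_eq (c : Cq) (n : ℤ) : qBr c n = qBr (q ^ n * c) 0 := by
  rw [qBr_zero, qBr, mul_inv, zpow_neg]

theorem neg_inv_inv {𝕜 : Type*} [Field 𝕜] (c : 𝕜) : (-c⁻¹)⁻¹ = -c := by
  rw [inv_neg, inv_inv]

theorem qBr_neg_inv (c : Cq) (n : ℤ) : qBr (-c⁻¹) n = qBr c (-n) := by
  rw [qBr, qBr, neg_neg, neg_inv_inv]
  ring

theorem eq_or_mul_eq_neg_one_of_qBr_eq {x y : Cq} (hx : x ≠ 0) (hy : y ≠ 0)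
    (h : qBr x 0 = qBr y 0) : x = y ∨ x * y = -1 := by
  rw [qBr_zero, qBr_zero, div_left_inj' q_sub_inv_ne_zero] at h
  have hfactor : (x - y) * (x * y + 1) = 0 := by
    field_simp at h
    linear_combination h
  exact (mul_eq_zero.1 hfactor).imp sub_eq_zero.1 eq_neg_of_add_eq_zero_left

theorem iota_sq : iota ^ 2 = -1 := by
  rw [iota, ← map_pow, Complex.I_sq, map_neg, map_one]

theorem isGood_iff {μ : Cq} : IsGood μ ↔ μ ≠ 0 ∧ ∀ l : ℤ, (q ^ l * μ) ^ 2 ≠ -1 := by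
  have hiff (l : ℤ) : (q ^ (-l) * μ) ^ 2 = -1 ↔ μ = q ^ l * iota ∨ μ = -(q ^ l * iota) := by
    rw [← iota_sq, ← sq_eq_sq_iff_eq_or_eq_neg, zpow_neg, inv_mul_eq_div, div_pow,
      div_eq_iff (pow_ne_zero 2 (q_zpow_ne_zero l)), mul_pow, mul_comm (iota ^ 2)]
  simp only [IsGood, ← not_or, ← hiff]
  exact and_congr_right fun _ =>
    (Equiv.neg ℤ).surjective.forall (p := fun l => (q ^ l * μ) ^ 2 ≠ -1) |>.symm

theorem IsGood.ne_zero {μ : Cq} (h : IsGood μ) : μ ≠ 0 := h.1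

theorem IsGood.sq_add_one_ne_zero {μ : Cq} (h : IsGood μ) (l : ℤ) : (q ^ l * μ) ^ 2 + 1 ≠ 0 :=
  fun h0 => (isGood_iff.1 h).2 l (eq_neg_of_add_eq_zero_left h0)

theorem IsGood.neg_inv {μ : Cq} (h : IsGood μ) : IsGood (-μ⁻¹) := by
  refine isGood_iff.2 ⟨neg_ne_zero.2 (inv_ne_zero h.ne_zero), fun l hl => ?_⟩
  refine (isGood_iff.1 h).2 (-l) ?_
  rw [mul_neg, neg_sq, ← inv_inj, inv_neg_one] at hl
  rw [← hl, ← inv_pow, mul_inv, inv_inv, zpow_neg]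

theorem IsGood.qBr_injective {μ : Cq} (h : IsGood μ) {m n l : ℤ} (hmn : m + n = 2 * l)
    (he : qBr μ m = qBr μ n) : m = n := by
  rw [qBr_eq, qBr_eq μ n] at he
  rcases eq_or_mul_eq_neg_one_of_qBr_eq (mul_ne_zero (q_zpow_ne_zero m) h.ne_zero)
    (mul_ne_zero (q_zpow_ne_zero n) h.ne_zero) he with heq | hmul
  · exact q_zpow_injective (mul_right_cancel₀ h.ne_zero heq)
  · refine absurd ?_ ((isGood_iff.1 h).2 l)
    rw [← hmul, sq, mul_mul_mul_comm, mul_mul_mul_comm (q ^ m), ← zpow_add₀ q_ne_zero,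
      ← zpow_add₀ q_ne_zero, hmn, two_mul]

theorem Fplus_eq (η : Cq) : Fplus η = Fminus (-η⁻¹) := by
  rw [Fplus, Fminus, neg_smul, sub_eq_add_neg]

theorem FplusPow_eq (η : Cq) (a : ℕ) : FplusPow η a = FminusPow (-η⁻¹) a := by
  induction a with
  | zero => rfl
  | succ a ih => rw [FplusPow, FminusPow, ih, Fplus_eq, mul_inv, zpow_neg, inv_inv, mul_neg]

theorem Fplus_mul_Fminus {c : Cq} (hc : c ≠ 0) :
    Fplus (q * c) * Fminus c = Fminus (q⁻¹ * c) * Fplus c :=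
  coidealRelations.lower_comm q_ne_zero hc

theorem FplusPow_mul_Fminus {c : Cq} (hc : c ≠ 0) (a : ℕ) :
    FplusPow (q * c) a * Fminus c = Fminus (q ^ (-(a : ℤ)) * c) * FplusPow c a := by
  induction a with
  | zero => simp [FplusPow]
  | succ a ih =>
    have hcomm := Fplus_mul_Fminus (mul_ne_zero (q_zpow_ne_zero (-a)) hc)
    have hsucc : q ^ (-((a + 1 : ℕ) : ℤ)) = q⁻¹ * q ^ (-(a : ℤ)) := by
      rw [Nat.cast_add, neg_add_rev, zpow_add₀ q_ne_zero, Nat.cast_one, zpow_neg_one]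
    rw [FplusPow, FplusPow, mul_assoc, ih, ← mul_assoc, mul_left_comm, hcomm, hsucc, mul_assoc,
      mul_assoc]

theorem FplusPow_mul_FminusPow {c : Cq} (hc : c ≠ 0) (a b : ℕ) :
    FplusPow (q ^ (b : ℤ) * c) a * FminusPow c b
      = FminusPow (q ^ (-(a : ℤ)) * c) b * FplusPow c a := by
  induction b with
  | zero => simp [FminusPow]
  | succ b ih =>
    have hcomm := FplusPow_mul_Fminus (mul_ne_zero (q_zpow_ne_zero b) hc) a
    have hsucc : q ^ ((b + 1 : ℕ) : ℤ) = q * q ^ (b : ℤ) := by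
      rw [Nat.cast_add, add_comm, zpow_add₀ q_ne_zero, Nat.cast_one, zpow_one]
    rw [FminusPow, FminusPow, hsucc, mul_assoc q, ← mul_assoc, hcomm, mul_assoc, ih, ← mul_assoc,
      mul_left_comm]

/-- The raising operator `E_-(η) = B_1 + η X`, the counterpart of `F_-(η)`. -/
def Eminus (η : Cq) : Uq' := B1 + η • X

/-- The raising operator `E_+(η) = B_1 - η⁻¹ X`, the counterpart of `F_+(η)`. -/
def Eplus (η : Cq) : Uq' := B1 - η⁻¹ • X

theorem Eminus_neg_inv (η : Cq) : Eminus (-η⁻¹) = Eplus η := by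
  rw [Eminus, Eplus, neg_smul, sub_eq_add_neg]

theorem add_inv_ne_zero {𝕜 : Type*} [Field 𝕜] {c : 𝕜} (hc : c ≠ 0) (hc' : c ^ 2 + 1 ≠ 0) :
    c + c⁻¹ ≠ 0 :=
  fun h => hc' (by linear_combination c * h - mul_inv_cancel₀ hc)

section Weight

variable {M : Type*} [AddCommGroup M] [Module Cq M] [Module Uq' M]

theorem unitK_smul_of_smul [IsScalarTower Cq Uq' M] {d d₁ : ℤ} {m : M} (hd : Dd • m = q ^ d • m)
    (h₁ : D1 • m = q ^ d₁ • m) : (unitK : Uq') • m = q ^ (d - d₁) • m := by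
  have h₁' : D1Inv • m = (q ^ d₁)⁻¹ • m := units_inv_smul (u := unitD1) h₁
  change (Dd * D1Inv) • m = _
  rw [mul_smul, h₁', smul_comm Dd, hd, smul_smul, zpow_sub₀ q_ne_zero,
    mul_comm, div_eq_mul_inv]

/-- The vector `m`, possibly zero, has weight `(q ^ d, q ^ d₁, [c;0], z)` with respect to `D̂_♦`,
`D̂_1`, `B_0`, `Z`. -/
structure IsWt (d d₁ : ℤ) (c z : Cq) (m : M) : Prop where
  Dd_smul : Dd • m = q ^ d • m
  D1_smul : D1 • m = q ^ d₁ • m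
  B0_smul : B0 • m = qBr c 0 • m
  Z_smul : Z • m = z • m

namespace IsWt

variable {d d₁ : ℤ} {c z : Cq} {m : M}

theorem neg_inv (h : IsWt d d₁ c z m) : IsWt d d₁ (-c⁻¹) z m :=
  ⟨h.Dd_smul, h.D1_smul, by rw [h.B0_smul, qBr_neg_inv, neg_zero], h.Z_smul⟩

variable [IsScalarTower Cq Uq' M]

theorem const_smul (h : IsWt d d₁ c z m) (a : Cq) : IsWt d d₁ c z (a • m) :=
  ⟨by rw [smul_comm Dd a m, h.Dd_smul, smul_comm], by rw [smul_comm D1 a m, h.D1_smul, smul_comm],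
    by rw [smul_comm B0 a m, h.B0_smul, smul_comm], by rw [smul_comm Z a m, h.Z_smul, smul_comm]⟩

theorem DdInv_smul (h : IsWt d d₁ c z m) : DdInv • m = (q ^ d)⁻¹ • m :=
  units_inv_smul (u := unitDd) h.Dd_smul

theorem D1Inv_smul (h : IsWt d d₁ c z m) : D1Inv • m = (q ^ d₁)⁻¹ • m :=
  units_inv_smul (u := unitD1) h.D1_smul

theorem unitK_smul (h : IsWt d d₁ c z m) : (unitK : Uq') • m = q ^ (d - d₁) • m :=
  unitK_smul_of_smul h.Dd_smul h.D1_smul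

theorem isWeightVector (h : IsWt d d₁ c z m) (hm : m ≠ 0) : IsWeightVector m := by
  refine ⟨hm, fun u hu => ?_⟩
  induction hu using Algebra.adjoin_induction with
  | mem x hx =>
    rcases hx with rfl | rfl | rfl | rfl | rfl | rfl
    exacts [⟨_, h.Dd_smul⟩, ⟨_, h.DdInv_smul⟩, ⟨_, h.D1_smul⟩, ⟨_, h.D1Inv_smul⟩, ⟨_, h.B0_smul⟩,
      ⟨_, h.Z_smul⟩]
  | algebraMap a => exact ⟨a, algebraMap_smul _ _ _⟩
  | add x y _ _ hx hy =>
    obtain ⟨a, ha⟩ := hx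
    obtain ⟨b, hb⟩ := hy
    exact ⟨a + b, by rw [add_smul, ha, hb, add_smul]⟩
  | mul x y _ _ hx hy =>
    obtain ⟨a, ha⟩ := hx
    obtain ⟨b, hb⟩ := hy
    exact ⟨b * a, by rw [mul_smul, hb, smul_comm, ha, smul_smul]⟩

theorem smul_Fminus (h : IsWt d d₁ c z m) (hc : c ≠ 0) :
    IsWt (d - 1) (d₁ + 1) (q * c) (q * z - (q ^ 2 + 1) * (q ^ (d - d₁))⁻¹ * c) (Fminus c • m) := by
  have hB0 := qBr_zero c ▸ h.B0_smul
  refine ⟨?_, ?_, ?_, ?_⟩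
  · rw [(QCommute.Fminus_right Dd_B0 Dd_Bm1 c).smul_smul h.Dd_smul, ← zpow_add₀ q_ne_zero,
      neg_add_eq_sub]
  · rw [(QCommute.Fminus_right D1_B0 D1_Bm1 c).smul_smul h.D1_smul, ← zpow_add₀ q_ne_zero,
      add_comm]
  · rw [qBr_zero]
    exact coidealRelations.B₀_lower q_ne_zero q_sq_sub_one_ne_zero hc hB0
  · exact coidealRelations.Z_lower q_ne_zero q_sq_sub_one_ne_zero q_sq_add_one_ne_zero hc hB0
      h.unitK_smul h.Z_smul

theorem Eminus_smul_Fminus (h : IsWt d d₁ c z m) (hc : c ≠ 0) :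
    Eminus (q * c) • Fminus c • m = Fminus (q * c) • Eminus c • m :=
  coidealRelations.raise_lower q_ne_zero q_sq_sub_one_ne_zero q_sq_add_one_ne_zero hc
    (qBr_zero c ▸ h.B0_smul) h.unitK_smul h.Z_smul

theorem Eplus_smul_Fminus (h : IsWt d d₁ c z m) (hc : c ≠ 0) (hc' : c ^ 2 + 1 ≠ 0) :
    Eplus (q * c) • Fminus c • m =
      ((c ^ 2 + (q ^ 2)⁻¹) / (c ^ 2 + 1)) • Fminus (q⁻¹ * c) • Eplus c • m
      + ((1 - (q ^ 2)⁻¹) / (c ^ 2 + 1)) • Fplus (q * c) • Eminus c • m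
      + ((1 + (q ^ 2)⁻¹ * (c ^ 2)⁻¹) *
          ((q ^ (d - d₁) - (q ^ (d - d₁))⁻¹) / (q - q⁻¹) + z * c)) • m :=
  coidealRelations.raise_inv_lower q_ne_zero q_sq_sub_one_ne_zero q_sq_add_one_ne_zero hc hc'
    (qBr_zero c ▸ h.B0_smul) h.unitK_smul h.Z_smul

end IsWt

end Weight

section Coefficients

variable {𝕜 : Type*} [Field 𝕜] {q k μ ζ Q I : 𝕜}

/-- The eigenvalue of `Z` on `F_-^b v`, where `Q = q ^ b` and `k = q ^ κ`. -/
def zCoeff (q k μ ζ Q : 𝕜) : 𝕜 :=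
  Q * ζ - (q ^ 2 + 1) * k⁻¹ * μ * (Q * q⁻¹) * (Q ^ 2 - 1) / (q ^ 2 - 1)

theorem zCoeff_mul (h0 : q ≠ 0) (h1 : q ^ 2 - 1 ≠ 0) (hk : k ≠ 0) (hQ : Q ≠ 0) :
    q * zCoeff q k μ ζ Q - (q ^ 2 + 1) * (k * (Q ^ 2)⁻¹)⁻¹ * (Q * μ) =
      zCoeff q k μ ζ (Q * q) := by
  rw [zCoeff, zCoeff]
  field_simp
  ring

/-- The coefficient of `F_-^{b-1} v` in `E_+ F_-^b v`, where `Q = q ^ b` and `k = q ^ κ`. -/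
def raiseCoeff (q k μ ζ Q : 𝕜) : 𝕜 :=
  ((Q * μ) ^ 2 + 1) * (Q ^ 2)⁻¹ * (μ ^ 2)⁻¹ * ((Q - Q⁻¹) / (q - q⁻¹)) *
    ((k * q * Q⁻¹ - k⁻¹ * Q * q⁻¹) / (q - q⁻¹) + Q * q⁻¹ * ζ * μ
      - Q ^ 2 * (q ^ 2)⁻¹ * k⁻¹ * μ ^ 2 * ((Q * q⁻¹ - Q⁻¹ * q) / (q - q⁻¹)))

theorem raiseCoeff_one : raiseCoeff q k μ ζ 1 = 0 := by
  simp only [raiseCoeff, inv_one, sub_self, zero_div, mul_zero, zero_mul]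

theorem raiseCoeff_mul (h0 : q ≠ 0) (h1 : q ^ 2 - 1 ≠ 0) (hk : k ≠ 0) (hμ : μ ≠ 0) (hQ : Q ≠ 0)
    (hc : (Q * μ) ^ 2 + 1 ≠ 0) :
    raiseCoeff q k μ ζ (Q * q) =
      ((Q * μ) ^ 2 + (q ^ 2)⁻¹) / ((Q * μ) ^ 2 + 1) * raiseCoeff q k μ ζ Q
      + (1 + (q ^ 2)⁻¹ * ((Q * μ) ^ 2)⁻¹) * ((k * (Q ^ 2)⁻¹ - (k * (Q ^ 2)⁻¹)⁻¹) / (q - q⁻¹)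
        + zCoeff q k μ ζ Q * (Q * μ)) := by
  have _ : q - q⁻¹ ≠ 0 := sub_inv_ne_zero h0 h1
  rw [mul_pow] at hc
  simp only [raiseCoeff, zCoeff, mul_pow]
  field_simp
  ring

/-- The central value `ζ = [μ;κ - 2i] - q^{-κ} [μ;0]` with `k = q ^ κ` and `I = q ^ i`. -/
def zetaValue (q k μ I : 𝕜) : 𝕜 :=
  (k * (I ^ 2)⁻¹ * μ - (k * (I ^ 2)⁻¹ * μ)⁻¹) / (q - q⁻¹) - k⁻¹ * ((μ - μ⁻¹) / (q - q⁻¹))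

theorem raiseCoeff_zetaValue (h0 : q ≠ 0) (h1 : q ^ 2 - 1 ≠ 0) (hk : k ≠ 0) (hμ : μ ≠ 0)
    (hQ : Q ≠ 0) (hI : I ≠ 0) :
    raiseCoeff q k μ (zetaValue q k μ I) Q =
      ((Q * μ) ^ 2 + 1) * (Q ^ 2)⁻¹ * (μ ^ 2)⁻¹ * ((Q - Q⁻¹) / (q - q⁻¹)) *
      (I * ((Q * q⁻¹ * I⁻¹ * μ) ^ 2 + 1) *
        ((k * I⁻¹ * Q⁻¹ * q - (k * I⁻¹ * Q⁻¹ * q)⁻¹) / (q - q⁻¹))) := by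
  have _ : q - q⁻¹ ≠ 0 := sub_inv_ne_zero h0 h1
  rw [raiseCoeff, zetaValue]
  field_simp
  ring

theorem eq_zetaValue_of_raiseCoeff_eq_zero (h0 : q ≠ 0) (h1 : q ^ 2 - 1 ≠ 0) (hk : k ≠ 0)
    (hμ : μ ≠ 0) (hQ : Q ≠ 0) (hQ' : Q - Q⁻¹ ≠ 0) (hc : (Q * μ) ^ 2 + 1 ≠ 0)
    (h : raiseCoeff q k μ ζ Q = 0) : ζ = zetaValue q k μ (k * Q⁻¹ * q) := by
  have hq' : q - q⁻¹ ≠ 0 := sub_inv_ne_zero h0 h1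
  have hfactor : ((Q * μ) ^ 2 + 1) * (Q ^ 2)⁻¹ * (μ ^ 2)⁻¹ * ((Q - Q⁻¹) / (q - q⁻¹)) ≠ 0 := by
    positivity
  have hlinear := (mul_eq_zero.1 h).resolve_left hfactor
  have hζ : q * Q⁻¹ * μ⁻¹ * (Q * q⁻¹ * ζ * μ) = ζ := by field_simp
  have hsolve : ζ = q * Q⁻¹ * μ⁻¹ * (Q ^ 2 * (q ^ 2)⁻¹ * k⁻¹ * μ ^ 2 *
      ((Q * q⁻¹ - Q⁻¹ * q) / (q - q⁻¹)) - (k * q * Q⁻¹ - k⁻¹ * Q * q⁻¹) / (q - q⁻¹)) := by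
    linear_combination (q * Q⁻¹ * μ⁻¹) * hlinear - hζ
  rw [hsolve, zetaValue]
  field_simp
  ring

end Coefficients

theorem q_zpow_succ (b : ℕ) : q ^ ((b + 1 : ℕ) : ℤ) = q ^ (b : ℤ) * q := by
  rw [Nat.cast_add_one, zpow_add_one₀ q_ne_zero]

theorem q_zpow_succ_mul (b : ℕ) (c : Cq) : q ^ ((b + 1 : ℕ) : ℤ) * c = q * (q ^ (b : ℤ) * c) := by
  rw [q_zpow_succ, mul_comm (q ^ (b : ℤ)) q, mul_assoc]

theorem q_zpow_sub_sub_add (d d₁ : ℤ) (b : ℕ) :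
    q ^ (d - b - (d₁ + b)) = q ^ (d - d₁) * ((q ^ (b : ℤ)) ^ 2)⁻¹ := by
  rw [show d - b - (d₁ + b) = d - d₁ - b * (2 : ℕ) by push_cast; ring, zpow_sub₀ q_ne_zero,
    zpow_mul, zpow_natCast (q ^ (b : ℤ)), div_eq_mul_inv]

section FFvec

variable {M : Type*} [AddCommGroup M] [Module Uq' M] {μ : Cq}

theorem FFvec_eq (μ : Cq) (v : M) (a b : ℕ) :
    FFvec μ v a b = FminusPow (-(q ^ (b : ℤ) * μ)⁻¹) a • FminusPow μ b • v := by
  rw [FFvec, FplusPow_eq]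

theorem FFvec_zero_zero (μ : Cq) (v : M) : FFvec μ v 0 0 = v := by
  rw [FFvec, FplusPow, FminusPow, one_smul, one_smul]

theorem Fminus_smul_FFvec (hμ : μ ≠ 0) (v : M) (a b : ℕ) :
    Fminus (q ^ ((b : ℤ) - a) * μ) • FFvec μ v a b = FFvec μ v a (b + 1) := by
  have hcomm := FplusPow_mul_Fminus (mul_ne_zero (q_zpow_ne_zero b) hμ) a
  rw [FFvec, FFvec, FminusPow, mul_smul, q_zpow_succ_mul, smul_smul (FplusPow _ _) (Fminus _),
    hcomm, smul_smul, ← mul_assoc, ← zpow_add₀ q_ne_zero, neg_add_eq_sub]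

theorem Fplus_smul_FFvec (μ : Cq) (v : M) (a b : ℕ) :
    Fplus (q ^ ((b : ℤ) - a) * μ) • FFvec μ v a b = FFvec μ v (a + 1) b := by
  rw [FFvec, FFvec, FplusPow, mul_smul, ← mul_assoc, ← zpow_add₀ q_ne_zero, neg_add_eq_sub]

end FFvec

section HighestWeight

variable {M : Type*} [AddCommGroup M] [Module Cq M] [Module Uq' M] {d d₁ : ℤ} {c z μ ζ : Cq}
  {m v : M}

theorem IsWt.smul_FminusPow [IsScalarTower Cq Uq' M] (h : IsWt d d₁ c z m) (hc : c ≠ 0) (b : ℕ) :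
    IsWt (d - b) (d₁ + b) (q ^ (b : ℤ) * c) (zCoeff q (q ^ (d - d₁)) c z (q ^ (b : ℤ)))
      (FminusPow c b • m) := by
  induction b with
  | zero => simpa [FminusPow, zCoeff] using h
  | succ b ih =>
    have hlower := ih.smul_Fminus (mul_ne_zero (q_zpow_ne_zero b) hc)
    rw [q_zpow_sub_sub_add, zCoeff_mul q_ne_zero q_sq_sub_one_ne_zero (q_zpow_ne_zero _)
      (q_zpow_ne_zero b), ← q_zpow_succ_mul, ← q_zpow_succ, ← mul_smul, sub_sub, add_assoc,
      ← Nat.cast_add_one] at hlower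
    exact hlower

/-- The vector `v`, possibly zero, satisfies the defining relations of the generator of
`𝕄(d, d₁, [μ;0], ζ)`. -/
structure IsHW (d d₁ : ℤ) (μ ζ : Cq) (v : M) : Prop extends IsWt d d₁ μ ζ v where
  B1_smul : B1 • v = 0
  X_smul : X • v = 0

namespace IsHW

theorem neg_inv (h : IsHW d d₁ μ ζ v) : IsHW d d₁ (-μ⁻¹) ζ v :=
  ⟨h.toIsWt.neg_inv, h.B1_smul, h.X_smul⟩

variable [IsScalarTower Cq Uq' M]

theorem Eminus_smul (h : IsHW d d₁ μ ζ v) (η : Cq) : Eminus η • v = 0 := by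
  rw [Eminus, add_smul, smul_assoc, h.B1_smul, h.X_smul, smul_zero, add_zero]

theorem Eminus_smul_FminusPow (h : IsHW d d₁ μ ζ v) (hμ : μ ≠ 0) (b : ℕ) :
    Eminus (q ^ (b : ℤ) * μ) • FminusPow μ b • v = 0 := by
  induction b with
  | zero => simp [FminusPow, h.Eminus_smul]
  | succ b ih =>
    rw [FminusPow, mul_smul, q_zpow_succ_mul, (h.toIsWt.smul_FminusPow hμ b).Eminus_smul_Fminus
      (mul_ne_zero (q_zpow_ne_zero b) hμ), ih, smul_zero]

theorem Eplus_smul_FminusPow (h : IsHW d d₁ μ ζ v) (hμ : IsGood μ) (b : ℕ) :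
    Eplus (q ^ ((b + 1 : ℕ) : ℤ) * μ) • FminusPow μ (b + 1) • v
      = raiseCoeff q (q ^ (d - d₁)) μ ζ (q ^ ((b + 1 : ℕ) : ℤ)) • FminusPow μ b • v := by
  have hrec (b : ℕ) (hb : Fminus (q⁻¹ * (q ^ (b : ℤ) * μ)) • Eplus (q ^ (b : ℤ) * μ) •
        FminusPow μ b • v
        = raiseCoeff q (q ^ (d - d₁)) μ ζ (q ^ (b : ℤ)) • FminusPow μ b • v) :
      Eplus (q ^ ((b + 1 : ℕ) : ℤ) * μ) • FminusPow μ (b + 1) • v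
        = raiseCoeff q (q ^ (d - d₁)) μ ζ (q ^ ((b + 1 : ℕ) : ℤ)) • FminusPow μ b • v := by
    have hc := hμ.sq_add_one_ne_zero b
    rw [q_zpow_succ_mul, FminusPow, mul_smul, (h.toIsWt.smul_FminusPow hμ.ne_zero b
        ).Eplus_smul_Fminus (mul_ne_zero (q_zpow_ne_zero b) hμ.ne_zero) hc, hb,
      h.Eminus_smul_FminusPow hμ.ne_zero b, smul_zero, smul_zero, add_zero, smul_smul, ← add_smul,
      q_zpow_sub_sub_add, q_zpow_succ, raiseCoeff_mul q_ne_zero q_sq_sub_one_ne_zero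
        (q_zpow_ne_zero _) hμ.ne_zero (q_zpow_ne_zero b) hc]
  induction b with
  | zero =>
    apply hrec
    rw [← Eminus_neg_inv, FminusPow, one_smul, h.Eminus_smul, Nat.cast_zero, zpow_zero,
      raiseCoeff_one, smul_zero, zero_smul]
  | succ b ih =>
    apply hrec
    rw [ih, smul_comm (Fminus _) (_ : Cq), FminusPow, mul_smul, q_zpow_succ_mul,
      inv_mul_cancel_left₀ q_ne_zero]

end IsHW

theorem B1_X_smul_eq_zero [IsScalarTower Cq Uq' M] (hc : c ≠ 0) (hc' : c ^ 2 + 1 ≠ 0)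
    (hminus : Eminus c • m = 0) (hplus : Eplus c • m = 0) : B1 • m = 0 ∧ X • m = 0 := by
  rw [Eminus, add_smul, smul_assoc] at hminus
  rw [Eplus, sub_smul, smul_assoc] at hplus
  have hX : (c + c⁻¹) • X • m = 0 := by
    rw [add_smul, ← add_sub_sub_cancel (B1 • m), hminus, hplus, sub_zero]
  have hX0 := (smul_eq_zero_iff_right (add_inv_ne_zero hc hc')).1 hX
  rw [hX0, smul_zero, add_zero] at hminus
  exact ⟨hminus, hX0⟩

theorem IsWt.exists_FFvec [IsScalarTower Cq Uq' M] (h : IsWt d d₁ μ ζ v) (hμ : μ ≠ 0)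
    (a b : ℕ) : ∃ z, IsWt (d - b - a) (d₁ + b + a) (q ^ ((b : ℤ) - a) * μ) z (FFvec μ v a b) := by
  have hwt := ((h.smul_FminusPow hμ b).neg_inv.smul_FminusPow
    (neg_ne_zero.2 (inv_ne_zero (mul_ne_zero (q_zpow_ne_zero b) hμ))) a).neg_inv
  have hweight {𝕜 : Type} [Field 𝕜] (x y z : 𝕜) : -(x * -(y * z)⁻¹)⁻¹ = y / x * z := by
    rw [mul_neg, inv_neg, neg_neg, mul_inv, inv_inv]
    ring
  rw [← FFvec_eq, hweight, ← zpow_sub₀ q_ne_zero] at hwt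
  exact ⟨_, hwt⟩

end HighestWeight

/-! ### Separation of the lowered vectors by their weights -/

section Separation

variable {𝕜 A M ι : Type*} [Field 𝕜] [Ring A] [AddCommGroup M] [Module 𝕜 M] [Module A M]
  {w : ι → M} {y : ι}

/-- Any two vectors of the family `w` are distinguished by an element of `A` of which the whole
family consists of eigenvectors. -/
def IsSeparated (𝕜 A : Type*) {M ι : Type*} [SMul 𝕜 M] [SMul A M] (w : ι → M) : Prop :=
  ∀ x y, x ≠ y → ∃ (T : A) (f : ι → 𝕜), (∀ z, T • w z = f z • w z) ∧ f x ≠ f y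

namespace IsSeparated

theorem comp {κ : Type*} (h : IsSeparated 𝕜 A w) {g : κ → ι} (hg : Function.Injective g) :
    IsSeparated 𝕜 A (w ∘ g) := fun x y hxy => by
  obtain ⟨T, f, hT, hf⟩ := h (g x) (g y) (hg.ne hxy)
  exact ⟨T, f ∘ g, fun z => hT (g z), hf⟩

variable [Algebra 𝕜 A] [IsScalarTower 𝕜 A M]

theorem exists_isolating (h : IsSeparated 𝕜 A w) {t : Finset ι} (hy : y ∉ t) :
    ∃ P : A, (∀ x ∈ t, P • w x = 0) ∧ P • w y = w y := by
  classical
  induction t using Finset.induction_on with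
  | empty => exact ⟨1, by simp, one_smul A _⟩
  | insert x t _ ih =>
    rw [Finset.mem_insert, not_or] at hy
    obtain ⟨P, hPt, hPy⟩ := ih hy.2
    obtain ⟨T, f, hT, hf⟩ := h x y (Ne.symm hy.1)
    have hT' (z : ι) : ((f y - f x)⁻¹ • (T - algebraMap 𝕜 A (f x))) • w z
        = ((f y - f x)⁻¹ * (f z - f x)) • w z := by
      rw [smul_assoc, sub_smul, hT, algebraMap_smul, ← sub_smul, smul_smul]
    refine ⟨P * ((f y - f x)⁻¹ • (T - algebraMap 𝕜 A (f x))), fun z hz => ?_, ?_⟩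
    · rw [mul_smul, hT', smul_comm P]
      rcases Finset.mem_insert.1 hz with rfl | hz
      · rw [sub_self, mul_zero, zero_smul]
      · rw [hPt z hz, smul_zero]
    · rw [mul_smul, hT', inv_mul_cancel₀ (sub_ne_zero.2 hf.symm), one_smul, hPy]

theorem exists_smul_linearCombination_eq (h : IsSeparated 𝕜 A w) {g : ι →₀ 𝕜} (hy : g y ≠ 0) :
    ∃ P : A, P • Finsupp.linearCombination 𝕜 w g = w y := by
  classical
  obtain ⟨P, hP, hPy⟩ := h.exists_isolating (Finset.notMem_erase y g.support)
  have hsum : P • Finsupp.linearCombination 𝕜 w g = g y • w y := by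
    rw [Finsupp.linearCombination_apply, Finsupp.sum, Finset.smul_sum,
      Finset.sum_eq_single_of_mem y (Finsupp.mem_support_iff.2 hy), smul_comm P, hPy]
    intro x hx hxy
    rw [smul_comm P, hP x (Finset.mem_erase.2 ⟨hxy, hx⟩), smul_zero]
  exact ⟨(g y)⁻¹ • P, by rw [smul_assoc, hsum, inv_smul_smul₀ hy]⟩

theorem eq_zero_of_mem_span (h : IsSeparated 𝕜 A w)
    (hy : w y ∈ Submodule.span 𝕜 (w '' {y}ᶜ)) : w y = 0 := by
  obtain ⟨g, hg, hgy⟩ := (Finsupp.mem_span_image_iff_linearCombination 𝕜).1 hy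
  have hgy0 : g y = 0 := Finsupp.notMem_support_iff.1 fun hmem => hg hmem rfl
  obtain ⟨P, hP⟩ := h.exists_smul_linearCombination_eq (g := Finsupp.single y 1 - g) (y := y)
    (by simp [hgy0])
  rw [← hP, map_sub, Finsupp.linearCombination_single, one_smul, hgy, sub_self, smul_zero]

theorem linearIndependent (h : IsSeparated 𝕜 A w) (hw : ∀ x, w x ≠ 0) :
    LinearIndependent 𝕜 w := by
  refine linearIndependent_iff_notMem_span.2 fun y hy => hw y (h.eq_zero_of_mem_span ?_)
  rwa [Set.compl_eq_univ_sdiff]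

theorem le_span_of_notMem (h : IsSeparated 𝕜 A w) (hspan : Submodule.span 𝕜 (Set.range w) = ⊤)
    {N : Submodule A M} (hN : w y ∉ N) :
    N.restrictScalars 𝕜 ≤ Submodule.span 𝕜 (w '' {y}ᶜ) := by
  intro m hm
  obtain ⟨g, rfl⟩ := (Finsupp.mem_span_range_iff_exists_finsupp).1
    (hspan ▸ Submodule.mem_top : m ∈ Submodule.span 𝕜 (Set.range w))
  refine (Finsupp.mem_span_image_iff_linearCombination 𝕜).2 ⟨g, fun x hx hxy => hN ?_, rfl⟩
  obtain ⟨P, hP⟩ := h.exists_smul_linearCombination_eq (Finsupp.mem_support_iff.1 hx)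
  rw [← Set.mem_singleton_iff.1 hxy, ← hP]
  exact N.smul_mem P hm

end IsSeparated

end Separation

section Preserving

variable {𝕜 A M : Type*} [Field 𝕜] [Ring A] [Algebra 𝕜 A] [AddCommGroup M] [Module 𝕜 M]
  [Module A M] [IsScalarTower 𝕜 A M]

/-- The subalgebra of those elements of `A` under whose action the subspace `W` is stable. -/
def preserving (A : Type*) [Ring A] [Algebra 𝕜 A] [Module A M] [IsScalarTower 𝕜 A M]
    (W : Submodule 𝕜 M) : Subalgebra 𝕜 A where
  carrier := {x | ∀ m ∈ W, x • m ∈ W}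
  mul_mem' hx hy m hm := by
    rw [mul_smul]
    exact hx _ (hy _ hm)
  add_mem' hx hy m hm := by
    rw [add_smul]
    exact add_mem (hx _ hm) (hy _ hm)
  algebraMap_mem' c m hm := by
    rw [algebraMap_smul]
    exact W.smul_mem c hm

theorem mem_preserving_span {S : Set M} {x : A}
    (h : ∀ m ∈ S, x • m ∈ Submodule.span 𝕜 S) : x ∈ preserving A (Submodule.span 𝕜 S) :=
  fun _ hm => (Submodule.span_le (p := (Submodule.span 𝕜 S).comap (Algebra.lsmul 𝕜 𝕜 M x))).2 h hm

end Preserving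

section LowerSpan

variable {M : Type*} [AddCommGroup M] [Module Cq M] [Module Uq' M] {d d₁ : ℤ} {c z μ ζ : Cq}
  {m v : M}

/-- The span of the vectors `F_+^a F_-^b v`. -/
def lowerSpan (μ : Cq) (v : M) : Submodule Cq M :=
  Submodule.span Cq (Set.range fun p : ℕ × ℕ => FFvec μ v p.1 p.2)

theorem FFvec_mem_lowerSpan (μ : Cq) (v : M) (a b : ℕ) : FFvec μ v a b ∈ lowerSpan μ v :=
  Submodule.subset_span ⟨(a, b), rfl⟩

theorem mem_lowerSpan (μ : Cq) (v : M) : v ∈ lowerSpan μ v := by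
  simpa only [FFvec_zero_zero] using FFvec_mem_lowerSpan μ v 0 0

variable [IsScalarTower Cq Uq' M]

theorem IsWt.isSeparated_FFvec (h : IsWt d d₁ μ ζ v) (hμ : IsGood μ) :
    IsSeparated Cq Uq' fun p : ℕ × ℕ => FFvec μ v p.1 p.2 := by
  intro x y hxy
  by_cases hs : x.1 + x.2 = y.1 + y.2
  · refine ⟨B0, fun p => qBr μ (p.2 - p.1), fun p => ?_, fun he => hxy ?_⟩
    · obtain ⟨z, hz⟩ := h.exists_FFvec hμ.ne_zero p.1 p.2
      rw [hz.B0_smul, ← qBr_eq μ]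
    · have := hμ.qBr_injective (l := x.2 - y.1) (by omega) he
      ext <;> omega
  · refine ⟨Dd, fun p => q ^ (d - p.2 - p.1), fun p => ?_, fun he => hs ?_⟩
    · obtain ⟨z, hz⟩ := h.exists_FFvec hμ.ne_zero p.1 p.2
      exact hz.Dd_smul
    · have := q_zpow_injective he
      omega

theorem mem_preserving_lowerSpan {x : Uq'} (h : ∀ a b, x • FFvec μ v a b ∈ lowerSpan μ v) :
    x ∈ preserving Uq' (lowerSpan μ v) :=
  mem_preserving_span (Set.forall_mem_range.2 fun p => h p.1 p.2)

theorem IsWt.mem_preserving_lowerSpan (h : IsWt d d₁ μ ζ v) (hμ : μ ≠ 0) {x : Uq'}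
    (hx : ∀ {d d₁ c z} {m : M}, IsWt d d₁ c z m → ∃ a : Cq, x • m = a • m) :
    x ∈ preserving Uq' (lowerSpan μ v) := by
  refine QSP.mem_preserving_lowerSpan fun a b => ?_
  obtain ⟨z, hz⟩ := h.exists_FFvec hμ a b
  obtain ⟨e, he⟩ := hx hz
  rw [he]
  exact Submodule.smul_mem _ _ (FFvec_mem_lowerSpan _ _ _ _)

theorem Y_mem_preserving_lowerSpan (hμ : IsGood μ) (v : M) :
    Y ∈ preserving Uq' (lowerSpan μ v) := by
  refine mem_preserving_lowerSpan fun a b => ?_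
  have hc := add_inv_ne_zero (mul_ne_zero (q_zpow_ne_zero (b - a)) hμ.ne_zero)
    (hμ.sq_add_one_ne_zero (b - a))
  have hY : FFvec μ v a (b + 1) - FFvec μ v (a + 1) b =
      (q ^ ((b : ℤ) - a) * μ + (q ^ ((b : ℤ) - a) * μ)⁻¹) • Y • FFvec μ v a b := by
    rw [← Fminus_smul_FFvec hμ.ne_zero, ← Fplus_smul_FFvec, ← sub_smul, Fminus, Fplus,
      add_sub_sub_cancel, ← smul_assoc, ← add_smul, add_comm]
  rw [← Submodule.smul_mem_iff _ hc, ← hY]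
  exact sub_mem (FFvec_mem_lowerSpan _ _ _ _) (FFvec_mem_lowerSpan _ _ _ _)

theorem Bm1_mem_preserving_lowerSpan (hμ : IsGood μ) (v : M) :
    Bm1 ∈ preserving Uq' (lowerSpan μ v) := by
  refine mem_preserving_lowerSpan fun a b => ?_
  have hBm1 : Bm1 • FFvec μ v a b =
      FFvec μ v a (b + 1) - (q ^ ((b : ℤ) - a) * μ) • Y • FFvec μ v a b := by
    rw [← Fminus_smul_FFvec hμ.ne_zero, Fminus, add_smul, smul_assoc, add_sub_cancel_right]
  rw [hBm1]
  exact sub_mem (FFvec_mem_lowerSpan _ _ _ _) (Submodule.smul_mem _ _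
    (Y_mem_preserving_lowerSpan hμ v _ (FFvec_mem_lowerSpan _ _ _ _)))

/-- The largest subspace of `W` which `B_1` and `X` map to `W`. -/
def raisable (W : Submodule Cq M) : Submodule Cq M :=
  W ⊓ W.comap (Algebra.lsmul Cq Cq M B1) ⊓ W.comap (Algebra.lsmul Cq Cq M X)

section Raisable

variable {W : Submodule Cq M}

theorem Bm1_mem_preserving_raisable (hBm1 : Bm1 ∈ preserving Uq' W) (hY : Y ∈ preserving Uq' W)
    (hB0 : B0 ∈ preserving Uq' W) (hZ : Z ∈ preserving Uq' W)
    (hK : (unitK - ↑unitK⁻¹ : Uq') ∈ preserving Uq' W) : Bm1 ∈ preserving Uq' (raisable W) := by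
  rintro m ⟨⟨hm, hB1m⟩, hXm⟩
  refine ⟨⟨hBm1 m hm, ?_⟩, ?_⟩
  · change B1 • Bm1 • m ∈ W
    rw [smul_smul_of_mul_eq coidealRelations.B₁_Bₘ, add_smul, mul_smul]
    exact add_mem (hBm1 _ hB1m) (Subalgebra.smul_mem _ hK _ m hm)
  · change X • Bm1 • m ∈ W
    rw [smul_smul_of_mul_eq coidealRelations.X_Bₘ, sub_smul, add_smul, add_smul, smul_assoc,
      smul_assoc, mul_smul, mul_smul]
    exact sub_mem (add_mem (add_mem (W.smul_mem _ (hBm1 _ hXm)) (W.smul_mem _ (hY _ hB1m)))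
      (Subalgebra.smul_mem _ (mul_mem hB0 hK) _ m hm)) (Subalgebra.smul_mem _ hZ _ m hm)

theorem Y_mem_preserving_raisable (hY : Y ∈ preserving Uq' W) (hZ : Z ∈ preserving Uq' W)
    (hK : (unitK - ↑unitK⁻¹ : Uq') ∈ preserving Uq' W) : Y ∈ preserving Uq' (raisable W) := by
  rintro m ⟨⟨hm, hB1m⟩, hXm⟩
  refine ⟨⟨hY m hm, ?_⟩, ?_⟩
  · change B1 • Y • m ∈ W
    rw [smul_smul_of_mul_eq coidealRelations.B₁_Y, add_smul, smul_assoc, mul_smul]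
    exact add_mem (hZ m hm) (W.smul_mem _ (hY _ hB1m))
  · change X • Y • m ∈ W
    rw [smul_smul_of_mul_eq (coidealRelations.X_Y q_ne_zero q_sq_add_one_ne_zero), sub_smul,
      mul_smul]
    exact sub_mem (hY _ hXm) (Subalgebra.smul_mem _ hK _ m hm)

end Raisable

theorem FminusPow_mem {S : Subalgebra Cq Uq'} (hBm1 : Bm1 ∈ S) (hY : Y ∈ S) (c : Cq) (b : ℕ) :
    FminusPow c b ∈ S := by
  induction b with
  | zero => exact one_mem S
  | succ b ih => exact mul_mem (add_mem hBm1 (S.smul_mem hY _)) ih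

theorem IsHW.lowerSpan_le_raisable (h : IsHW d d₁ μ ζ v) (hμ : IsGood μ) :
    lowerSpan μ v ≤ raisable (lowerSpan μ v) := by
  have hdiag {x : Uq'} (hx : ∀ {d d₁ c z} {m : M}, IsWt d d₁ c z m → ∃ a : Cq, x • m = a • m) :
      x ∈ preserving Uq' (lowerSpan μ v) := h.toIsWt.mem_preserving_lowerSpan hμ.ne_zero hx
  have hY := Y_mem_preserving_lowerSpan hμ v
  have hZ := hdiag (x := Z) fun hw => ⟨_, hw.Z_smul⟩
  have hK := sub_mem (hdiag (x := unitK) fun hw => ⟨_, hw.unitK_smul⟩)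
    (hdiag (x := (↑unitK⁻¹ : Uq')) fun hw => ⟨_, units_inv_smul hw.unitK_smul⟩)
  have hBm1' := Bm1_mem_preserving_raisable (Bm1_mem_preserving_lowerSpan hμ v) hY
    (hdiag (x := B0) fun hw => ⟨_, hw.B0_smul⟩) hZ hK
  have hY' := Y_mem_preserving_raisable hY hZ hK
  have hv : v ∈ raisable (lowerSpan μ v) := by
    refine ⟨⟨mem_lowerSpan μ v, ?_⟩, ?_⟩
    · exact (h.B1_smul ▸ zero_mem _ : B1 • v ∈ lowerSpan μ v)
    · exact (h.X_smul ▸ zero_mem _ : X • v ∈ lowerSpan μ v)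
  refine Submodule.span_le.2 (Set.range_subset_iff.2 fun p => ?_)
  rw [FFvec_eq]
  exact FminusPow_mem hBm1' hY' _ _ _ (FminusPow_mem hBm1' hY' _ _ _ hv)

theorem IsHW.preserving_lowerSpan_eq_top (h : IsHW d d₁ μ ζ v) (hμ : IsGood μ) :
    preserving Uq' (lowerSpan μ v) = ⊤ := by
  have hdiag {x : Uq'} (hx : ∀ {d d₁ c z} {m : M}, IsWt d d₁ c z m → ∃ a : Cq, x • m = a • m) :
      x ∈ preserving Uq' (lowerSpan μ v) := h.toIsWt.mem_preserving_lowerSpan hμ.ne_zero hx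
  refine eq_top_iff.2 fun x _ => ?_
  induction x using uq'_induction with
  | hB1 => exact fun m hm => (h.lowerSpan_le_raisable hμ hm).1.2
  | hBm1 => exact Bm1_mem_preserving_lowerSpan hμ v
  | hB0 => exact hdiag fun hw => ⟨_, hw.B0_smul⟩
  | hDd => exact hdiag fun hw => ⟨_, hw.Dd_smul⟩
  | hDdInv => exact hdiag fun hw => ⟨_, hw.DdInv_smul⟩
  | hD1 => exact hdiag fun hw => ⟨_, hw.D1_smul⟩
  | hD1Inv => exact hdiag fun hw => ⟨_, hw.D1Inv_smul⟩
  | hc c => exact Subalgebra.algebraMap_mem _ c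
  | hadd x y hx hy => exact add_mem (hx trivial) (hy trivial)
  | hmul x y hx hy => exact mul_mem (hx trivial) (hy trivial)

theorem IsHW.lowerSpan_eq_top (h : IsHW d d₁ μ ζ v) (hμ : IsGood μ)
    (hv : ∀ m : M, ∃ x : Uq', x • v = m) : lowerSpan μ v = ⊤ := by
  refine eq_top_iff.2 fun m _ => ?_
  obtain ⟨x, rfl⟩ := hv m
  have hx : x ∈ preserving Uq' (lowerSpan μ v) := h.preserving_lowerSpan_eq_top hμ ▸ trivial
  exact hx v (mem_lowerSpan μ v)

end LowerSpan

/-! ### Finite-dimensional simple modules with a highest weight vector -/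

theorem q_zpow_sub_inv_eq_zero_iff {n : ℤ} : q ^ n - (q ^ n)⁻¹ = 0 ↔ n = 0 := by
  rw [sub_eq_zero, ← zpow_neg, q_zpow_injective.eq_iff]
  omega

theorem IsGood.zpow_mul {μ : Cq} (h : IsGood μ) (n : ℤ) : IsGood (q ^ n * μ) := by
  refine isGood_iff.2 ⟨mul_ne_zero (q_zpow_ne_zero n) h.ne_zero, fun l => ?_⟩
  rw [← mul_assoc, ← zpow_add₀ q_ne_zero]
  exact (isGood_iff.1 h).2 (l + n)

/-- The value `[μ;κ - 2i] - q^{-κ} [μ;0]` of `ζ` for which `𝕄(κ_♦, κ_1, [μ;0], ζ)`, with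
`κ = κ_♦ - κ_1` and `0 ≤ i ≤ κ`, has a finite-dimensional irreducible quotient. -/
def zetaOf (κ : ℤ) (μ : Cq) (i : ℤ) : Cq := qBr μ (κ - 2 * i) - q ^ (-κ) * qBr μ 0

theorem zetaOf_neg_inv (κ : ℤ) (μ : Cq) (i : ℤ) : zetaOf κ (-μ⁻¹) (κ - i) = zetaOf κ μ i := by
  rw [zetaOf, zetaOf, qBr_neg_inv, qBr_neg_inv, neg_zero]
  congr 2
  ring

theorem zetaOf_eq (κ : ℤ) (μ : Cq) (i : ℤ) : zetaOf κ μ i = zetaValue q (q ^ κ) μ (q ^ i) := by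
  rw [zetaOf, zetaValue, qBr_eq, qBr_zero, qBr_zero, zpow_sub₀ q_ne_zero, mul_comm 2 i, zpow_mul,
    div_eq_mul_inv (q ^ κ), zpow_neg, ← zpow_natCast (q ^ i), Nat.cast_ofNat]

theorem raiseCoeff_eq_zero_iff {μ : Cq} (hμ : IsGood μ) (κ i : ℤ) (b : ℕ) :
    raiseCoeff q (q ^ κ) μ (zetaOf κ μ i) (q ^ ((b + 1 : ℕ) : ℤ)) = 0 ↔ (b : ℤ) = κ - i := by
  have hq (m n : ℤ) : q ^ m * (q ^ n)⁻¹ = q ^ (m - n) := by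
    rw [zpow_sub₀ q_ne_zero, div_eq_mul_inv]
  have hb : q ^ ((b + 1 : ℕ) : ℤ) - (q ^ ((b + 1 : ℕ) : ℤ))⁻¹ ≠ 0 := by
    rw [Ne, q_zpow_sub_inv_eq_zero_iff]
    omega
  have hb' : q ^ ((b + 1 : ℕ) : ℤ) * q⁻¹ = q ^ (b : ℤ) := by
    rw [q_zpow_succ, mul_inv_cancel_right₀ q_ne_zero]
  rw [zetaOf_eq, raiseCoeff_zetaValue q_ne_zero q_sq_sub_one_ne_zero (q_zpow_ne_zero κ) hμ.ne_zero
    (q_zpow_ne_zero _) (q_zpow_ne_zero i)]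
  rw [hb', hq, hq, hq, ← zpow_add_one₀ q_ne_zero]
  simp only [mul_eq_zero, div_eq_zero_iff, inv_eq_zero, pow_eq_zero_iff, ne_eq, OfNat.ofNat_ne_zero,
    not_false_eq_true, hμ.sq_add_one_ne_zero, hμ.ne_zero, hb, q_sub_inv_ne_zero, q_zpow_ne_zero,
    false_or, or_false, q_zpow_sub_inv_eq_zero_iff]
  omega

theorem notMem_of_ne_top {A M : Type*} [Ring A] [AddCommGroup M] [Module A M] {v : M}
    (hgen : ∀ m : M, ∃ x : A, x • v = m) {N : Submodule A M} (hN : N ≠ ⊤) : v ∉ N := fun hv =>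
  hN <| eq_top_iff.2 fun m _ => by
    obtain ⟨x, rfl⟩ := hgen m
    exact N.smul_mem x hv

section FiniteDimensional

variable {M : Type*} [AddCommGroup M] [Module Uq' M] {d d₁ : ℤ} {c z μ ζ : Cq} {m v : M}

theorem exists_smul_eq_of_isSimpleModule [IsSimpleModule Uq' M] (hv : v ≠ 0) (m : M) :
    ∃ x : Uq', x • v = m :=
  IsSimpleModule.toSpanSingleton_surjective Uq' hv m

theorem FminusPow_smul_eq_zero_of_le {b b' : ℕ} (h : FminusPow μ b • v = 0) (hb : b ≤ b') :
    FminusPow μ b' • v = 0 := by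
  induction b', hb using Nat.le_induction with
  | base => exact h
  | succ n _ ih => rw [FminusPow, mul_smul, ih, smul_zero]

theorem FFvec_zero_left (μ : Cq) (v : M) (b : ℕ) : FFvec μ v 0 b = FminusPow μ b • v := by
  rw [FFvec, FplusPow, one_smul]

theorem FFvec_zero_right (μ : Cq) (v : M) (a : ℕ) : FFvec μ v a 0 = FminusPow (-μ⁻¹) a • v := by
  rw [FFvec_eq, Nat.cast_zero, zpow_zero, one_mul, FminusPow, one_smul]

variable [Module Cq M] [IsScalarTower Cq Uq' M]

theorem IsWt.exists_FminusPow_smul_eq_zero [FiniteDimensional Cq M] (h : IsWt d d₁ μ ζ v)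
    (hμ : IsGood μ) : ∃ b, FminusPow μ b • v = 0 := by
  by_contra! hne
  have hli := ((h.isSeparated_FFvec hμ).comp (Prod.mk_right_injective 0)).linearIndependent
    fun b => (FFvec_zero_left μ v b).trans_ne (hne b)
  have := hli.finite_of_isNoetherian
  exact not_finite ℕ

theorem IsHW.exists_eq_zetaOf_sub [FiniteDimensional Cq M] (h : IsHW d d₁ μ ζ v) (hv : v ≠ 0)
    (hμ : IsGood μ) : ∃ B : ℕ, ζ = zetaOf (d - d₁) μ (d - d₁ - B) := by
  classical
  have hex := h.toIsWt.exists_FminusPow_smul_eq_zero hμ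
  obtain ⟨B, hB⟩ := Nat.exists_eq_succ_of_ne_zero (n := Nat.find hex) fun h0 =>
    hv (by simpa only [h0, FminusPow, one_smul] using Nat.find_spec hex)
  have hlast : FminusPow μ B • v ≠ 0 := Nat.find_min hex (by omega)
  have hraise := h.Eplus_smul_FminusPow hμ B
  rw [← Nat.succ_eq_add_one, ← hB, Nat.find_spec hex, smul_zero, hB] at hraise
  refine ⟨B, (eq_zetaValue_of_raiseCoeff_eq_zero q_ne_zero q_sq_sub_one_ne_zero (q_zpow_ne_zero _)
    hμ.ne_zero (q_zpow_ne_zero _) ?_ (hμ.sq_add_one_ne_zero _)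
    ((smul_eq_zero.1 hraise.symm).resolve_right hlast)).trans ?_⟩
  · rw [Ne, q_zpow_sub_inv_eq_zero_iff]
    omega
  · rw [zetaOf_eq, ← div_eq_mul_inv, ← zpow_sub₀ q_ne_zero, ← zpow_add_one₀ q_ne_zero]
    congr 2
    push_cast
    ring

theorem IsHW.exists_eq_zetaOf [FiniteDimensional Cq M] (h : IsHW d d₁ μ ζ v) (hv : v ≠ 0)
    (hμ : IsGood μ) : ∃ i : ℕ, (i : ℤ) ≤ d - d₁ ∧ ζ = zetaOf (d - d₁) μ i := by
  obtain ⟨B, hB⟩ := h.exists_eq_zetaOf_sub hv hμ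
  obtain ⟨A, hA⟩ := h.neg_inv.exists_eq_zetaOf_sub hv hμ.neg_inv
  rw [zetaOf_neg_inv] at hA
  have hBr : qBr μ (d - d₁ - 2 * (d - d₁ - B)) = qBr μ (d - d₁ - 2 * A) :=
    sub_left_injective (hB.symm.trans hA)
  have := hμ.qBr_injective (l := B - A) (by ring) hBr
  exact ⟨A, by omega, hA⟩

theorem IsWt.disjoint_lowerSpan (h : IsWt d d₁ μ ζ v) (hμ : μ ≠ 0) {n : ℤ} (hn : d < n) :
    Disjoint (Module.End.eigenspace (Algebra.lsmul Cq Cq M Dd) (q ^ n)) (lowerSpan μ v) := by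
  refine (Module.End.eigenspaces_iSupIndep (Algebra.lsmul Cq Cq M Dd) (q ^ n)).mono_right
    (Submodule.span_le.2 (Set.range_subset_iff.2 fun p => ?_))
  obtain ⟨z, hz⟩ := h.exists_FFvec hμ p.1 p.2
  have hne : q ^ (d - p.2 - p.1) ≠ q ^ n := fun he => by
    have := q_zpow_injective he
    omega
  exact Submodule.mem_iSup_of_mem _ (Submodule.mem_iSup_of_mem hne
    (Module.End.mem_eigenspace_iff.2 hz.Dd_smul))

/-- The singular vector `F_-^{κ-i+1} v` generates a submodule of lower `D̂_♦`-weights than `v`. -/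
theorem IsHW.FminusPow_smul_eq_zero [IsSimpleModule Uq' M] {i : ℤ}
    (h : IsHW d d₁ μ (zetaOf (d - d₁) μ i) v) (hv : v ≠ 0) (hμ : IsGood μ) {B : ℕ}
    (hB : (B : ℤ) = d - d₁ - i) : FminusPow μ (B + 1) • v = 0 := by
  by_contra hu
  have hraise := h.Eplus_smul_FminusPow hμ B
  rw [(raiseCoeff_eq_zero_iff hμ _ i B).2 hB, zero_smul] at hraise
  obtain ⟨hB1, hX⟩ := B1_X_smul_eq_zero (hμ.zpow_mul (B + 1 : ℕ)).ne_zero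
    (hμ.sq_add_one_ne_zero _) (h.Eminus_smul_FminusPow hμ.ne_zero (B + 1)) hraise
  have hsingular : IsHW _ _ _ _ (FminusPow μ (B + 1) • v) :=
    ⟨h.toIsWt.smul_FminusPow hμ.ne_zero (B + 1), hB1, hX⟩
  have htop := hsingular.lowerSpan_eq_top (hμ.zpow_mul _) (exists_smul_eq_of_isSimpleModule hu)
  have hdisj := hsingular.toIsWt.disjoint_lowerSpan (hμ.zpow_mul (B + 1 : ℕ)).ne_zero
    (n := d) (by omega)
  exact hv (Submodule.disjoint_def.1 hdisj v (Module.End.mem_eigenspace_iff.2 h.Dd_smul)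
    (htop ▸ Submodule.mem_top))

theorem IsHW.Eplus_smul_FFvec (h : IsHW d d₁ μ ζ v) (hμ : IsGood μ) (a b : ℕ) :
    Eplus (q ^ (((b + 1 : ℕ) : ℤ) - a) * μ) • FFvec μ v a (b + 1)
      = raiseCoeff q (q ^ (d - d₁)) μ ζ (q ^ ((b + 1 : ℕ) : ℤ)) • FFvec μ v a b := by
  induction a with
  | zero =>
    rw [FFvec_zero_left, FFvec_zero_left, Nat.cast_zero, sub_zero, h.Eplus_smul_FminusPow hμ]
  | succ a ih =>
    obtain ⟨z, hz⟩ := h.toIsWt.exists_FFvec hμ.ne_zero a (b + 1)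
    have hη : -(q ^ (((b + 1 : ℕ) : ℤ) - a) * μ)⁻¹ ≠ 0 :=
      neg_ne_zero.2 (inv_ne_zero (hμ.zpow_mul _).ne_zero)
    have hweight : q ^ (((b + 1 : ℕ) : ℤ) - a) * μ = q * (q ^ ((b : ℤ) - a) * μ) := by
      rw [Nat.cast_add_one, add_sub_right_comm, zpow_add_one₀ q_ne_zero, mul_comm _ q, mul_assoc]
    have hweight' : -(q ^ ((b : ℤ) - a) * μ)⁻¹ = q * -(q ^ (((b + 1 : ℕ) : ℤ) - a) * μ)⁻¹ := by
      rw [hweight, mul_inv q, mul_neg, mul_inv_cancel_left₀ q_ne_zero]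
    rw [← Fplus_smul_FFvec μ v a (b + 1), ← Fplus_smul_FFvec μ v a b, Fplus_eq, Fplus_eq,
      Nat.cast_add_one a, Nat.cast_add_one b, add_sub_add_right_eq_sub, ← Eminus_neg_inv, hweight',
      ← Nat.cast_add_one b, hz.neg_inv.Eminus_smul_Fminus hη, Eminus_neg_inv, ih, smul_comm]

theorem IsHW.FFvec_ne_zero_of_FFvec_zero_ne_zero {i : ℤ}
    (h : IsHW d d₁ μ (zetaOf (d - d₁) μ i) v) (hμ : IsGood μ) {a b : ℕ}
    (ha : FFvec μ v a 0 ≠ 0) (hb : (b : ℤ) ≤ d - d₁ - i) : FFvec μ v a b ≠ 0 := by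
  induction b with
  | zero => exact ha
  | succ b ih =>
    intro hzero
    have hraise := h.Eplus_smul_FFvec hμ a b
    rw [hzero, smul_zero, eq_comm, smul_eq_zero_iff_left (ih (by push_cast at hb; omega)),
      raiseCoeff_eq_zero_iff hμ] at hraise
    push_cast at hb
    omega

theorem IsHW.FFvec_ne_zero {i : ℕ} (h : IsHW d d₁ μ (zetaOf (d - d₁) μ i) v) (hv : v ≠ 0)
    (hμ : IsGood μ) {a b : ℕ} (ha : a ≤ i) (hb : (b : ℤ) ≤ d - d₁ - i) : FFvec μ v a b ≠ 0 := by
  have hflip := h.neg_inv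
  rw [← zetaOf_neg_inv] at hflip
  refine h.FFvec_ne_zero_of_FFvec_zero_ne_zero hμ ?_ hb
  rw [FFvec_zero_right, ← FFvec_zero_left]
  exact hflip.FFvec_ne_zero_of_FFvec_zero_ne_zero hμ.neg_inv
    ((FFvec_zero_zero _ v).trans_ne hv) (by omega)

theorem IsHW.FFvec_eq_zero [IsSimpleModule Uq' M] {i : ℕ}
    (h : IsHW d d₁ μ (zetaOf (d - d₁) μ i) v) (hv : v ≠ 0) (hμ : IsGood μ)
    (hi : (i : ℤ) ≤ d - d₁) {a b : ℕ} (hab : ¬ (a ≤ i ∧ (b : ℤ) ≤ d - d₁ - i)) :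
    FFvec μ v a b = 0 := by
  by_cases ha : a ≤ i
  · obtain ⟨B, hB⟩ := Int.eq_ofNat_of_zero_le (sub_nonneg.2 hi)
    have hzero := FminusPow_smul_eq_zero_of_le (b' := b)
      (h.FminusPow_smul_eq_zero hv hμ hB.symm) (by omega)
    rw [FFvec, hzero, smul_zero]
  · have hflip := h.neg_inv
    rw [← zetaOf_neg_inv] at hflip
    have hzero := FminusPow_smul_eq_zero_of_le (b' := a)
      (hflip.FminusPow_smul_eq_zero hv hμ.neg_inv (B := i) (by ring)) (by omega)
    rw [FFvec, smul_smul, FplusPow_mul_FminusPow hμ.ne_zero, FplusPow_eq, mul_smul, hzero,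
      smul_zero]

theorem IsHW.isWeightBasis [IsSimpleModule Uq' M] {i : ℕ}
    (h : IsHW d d₁ μ (zetaOf (d - d₁) μ i) v) (hv : v ≠ 0) (hμ : IsGood μ)
    (hi : (i : ℤ) ≤ d - d₁) :
    IsWeightBasis fun p : {p : ℕ × ℕ // p.1 ≤ i ∧ (p.2 : ℤ) ≤ d - d₁ - i} =>
      FFvec μ v p.1.1 p.1.2 := by
  have hne (p : {p : ℕ × ℕ // p.1 ≤ i ∧ (p.2 : ℤ) ≤ d - d₁ - i}) : FFvec μ v p.1.1 p.1.2 ≠ 0 :=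
    h.FFvec_ne_zero hv hμ p.2.1 p.2.2
  refine ⟨((h.toIsWt.isSeparated_FFvec hμ).comp Subtype.val_injective).linearIndependent hne,
    eq_top_iff.2 ?_, fun p => ?_⟩
  · rw [← h.lowerSpan_eq_top hμ (exists_smul_eq_of_isSimpleModule hv)]
    refine Submodule.span_le.2 (Set.range_subset_iff.2 fun p => ?_)
    by_cases hp : p.1 ≤ i ∧ (p.2 : ℤ) ≤ d - d₁ - i
    · exact Submodule.subset_span ⟨⟨p, hp⟩, rfl⟩
    · rw [h.FFvec_eq_zero hv hμ hi hp]
      exact zero_mem _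
  · obtain ⟨z, hz⟩ := h.toIsWt.exists_FFvec hμ.ne_zero p.1.1 p.1.2
    exact hz.isWeightVector (hne p)

theorem IsHW.isCoatom_unique (h : IsHW d d₁ μ ζ v) (hμ : IsGood μ)
    (hgen : ∀ m : M, ∃ x : Uq', x • v = m) {N₁ N₂ : Submodule Uq' M} (h₁ : IsCoatom N₁)
    (h₂ : IsCoatom N₂) : N₁ = N₂ := by
  have hsep := h.toIsWt.isSeparated_FFvec hμ
  have hle {N : Submodule Uq' M} (hN : IsCoatom N) : N.restrictScalars Cq ≤
      Submodule.span Cq ((fun p : ℕ × ℕ => FFvec μ v p.1 p.2) '' {(0, 0)}ᶜ) := by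
    refine hsep.le_span_of_notMem (h.lowerSpan_eq_top hμ hgen) fun hvN => ?_
    exact notMem_of_ne_top hgen hN.1 (FFvec_zero_zero μ v ▸ hvN)
  by_contra hne
  obtain ⟨n₁, hn₁, n₂, hn₂, hsum⟩ := Submodule.mem_sup.1
    (h₁.sup_eq_top_of_ne h₂ hne ▸ Submodule.mem_top : v ∈ N₁ ⊔ N₂)
  have hmem := add_mem (hle h₁ hn₁) (hle h₂ hn₂)
  rw [hsum] at hmem
  have hzero : FFvec μ v 0 0 = 0 := hsep.eq_zero_of_mem_span (y := (0, 0)) <| by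
    rw [FFvec_zero_zero]
    exact hmem
  rw [FFvec_zero_zero] at hzero
  exact notMem_of_ne_top hgen h₁.1 (hzero ▸ zero_mem N₁)

end FiniteDimensional

/-! ### Tensor products with the vector representation -/

section CommutingHoms

variable {𝕜 A A' R : Type*} [Field 𝕜] [Ring A] [Algebra 𝕜 A] [Ring A'] [Algebra 𝕜 A'] [Ring R]
  [Algebra 𝕜 R] {q : 𝕜} {n : ℤ} {φ : A →ₐ[𝕜] R} {ψ : A' →ₐ[𝕜] R} {a a' k k' : A} {c c' : A'}

theorem QCommute.map_mul_map (hc : ∀ x y, Commute (φ x) (ψ y)) (h : QCommute q n k a) :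
    QCommute q n (φ k * ψ c) (φ a) := by
  rw [QCommute, mul_assoc, (hc a c).symm.eq, ← mul_assoc, (h.map φ).eq, smul_mul_assoc, mul_assoc]

theorem commute_map_mul_map (hc : ∀ x y, Commute (φ x) (ψ y)) (hk : Commute k k')
    (hcc' : Commute c c') : Commute (φ k * ψ c) (φ k' * ψ c') :=
  ((hk.map φ).mul_right (hc k c')).mul_left ((hc k' c).symm.mul_right (hcc'.map ψ))

theorem commute_map_add_map_mul_map (hc : ∀ x y, Commute (φ x) (ψ y)) (haa' : Commute a a')
    (hka' : Commute k a') (hk'a : Commute k' a) (hkk' : Commute k k') (hcc' : Commute c c') :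
    Commute (φ a + φ k * ψ c) (φ a' + φ k' * ψ c') :=
  ((haa'.map φ).add_right ((hk'a.symm.map φ).mul_right (hc a c'))).add_left
    (((hka'.map φ).mul_left (hc a' c).symm).add_right (commute_map_mul_map hc hkk' hcc'))

theorem serre_map_add_map_mul_map (hq : q ≠ 0) (hc : ∀ x y, Commute (φ x) (ψ y))
    (hka : QCommute q 2 k a) (hka' : QCommute q (-1) k a') (hk'a : QCommute q (-1) k' a)
    (hkk' : Commute k k') (ha : serre q a a' = 0) (hcc' : serre q c c' = 0) :
    serre q (φ a + φ k * ψ c) (φ a' + φ k' * ψ c') = 0 := by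
  refine serre_add_eq_zero hq (hka.map_mul_map hc) (hka'.map_mul_map hc) (hk'a.map_mul_map hc)
    (by rw [← map_serre, ha, map_zero]) ?_
  rw [(hc k c).eq, (hc k' c').eq, serre_mul_mul (hkk'.map φ) (hc k c)
    (.of_commute (hc k c')) (.of_commute (hc k' c)), ← map_serre, hcc', map_zero, zero_mul,
    smul_zero]

theorem commute_map_mul_map_of_qCommute {f : A} {e' l : A'} (hc : ∀ x y, Commute (φ x) (ψ y))
    (hkf : QCommute q n k f) (hle' : QCommute q n l e') :
    Commute (φ k * ψ e') (ψ l * φ f) := by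
  have hleft : φ k * ψ e' * (ψ l * φ f) = φ (k * f) * ψ (e' * l) := by
    simp only [map_mul, mul_assoc, (hc f l).eq, mul_mul_of_mul_eq (hc f e').eq]
  have hright : ψ l * φ f * (φ k * ψ e') = φ (f * k) * ψ (l * e') := by
    simp only [map_mul, mul_assoc, mul_mul_of_mul_eq (hc k l).eq,
      mul_mul_of_mul_eq (hc f l).eq]
  rw [Commute, SemiconjBy, hleft, hright, hkf.eq, hle'.eq, map_smul, map_smul, smul_mul_assoc,
    mul_smul_comm]

theorem map_add_map_mul_map_commutator {e f : A} {e' f' l : A'}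
    (hc : ∀ x y, Commute (φ x) (ψ y)) (hkf : QCommute q n k f) (hle' : QCommute q n l e') :
    (φ e + φ k * ψ e') * (ψ f' + ψ l * φ f) - (ψ f' + ψ l * φ f) * (φ e + φ k * ψ e')
      = ψ l * φ (e * f - f * e) + φ k * ψ (e' * f' - f' * e') := by
  simp only [mul_add, add_mul, map_sub, map_mul, mul_sub,
    (commute_map_mul_map_of_qCommute hc hkf hle').eq, mul_assoc, (hc e f').eq,
    mul_mul_of_mul_eq (hc e l).eq, mul_mul_of_mul_eq (hc k f').symm.eq]
  abel

end CommutingHoms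

namespace UqGL

theorem K_E (i j : Fin 3) : QCommute q (cartan i j) (↑(unitKinv i)⁻¹ : UqGL) (E j) :=
  neg_neg (cartan i j) ▸
    (unitKinv_val i ▸ Kinv_E i j : QCommute q _ (unitKinv i : UqGL) _).units_inv_left q_ne_zero

theorem K_F (i j : Fin 3) : QCommute q (-cartan i j) (↑(unitKinv i)⁻¹ : UqGL) (F j) :=
  (unitKinv_val i ▸ Kinv_F i j : QCommute q _ (unitKinv i : UqGL) _).units_inv_left q_ne_zero

section TensorHom

variable {R : Type*} [Ring R] [Algebra Cq R] (φ ψ : UqGL →ₐ[Cq] R)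

/-- The image of `u ⊗ v` under two commuting homomorphisms, for units `u` and `v`. -/
def tensorUnits (hc : ∀ x y, Commute (φ x) (ψ y)) : UqGLˣ × UqGLˣ →* Rˣ :=
  (Units.map (φ : UqGL →* R)).noncommCoprod (Units.map (ψ : UqGL →* R))
    fun u v => Units.ext (hc u v)

variable {φ ψ} (hc : ∀ x y, Commute (φ x) (ψ y))

theorem tensorUnits_val (u v : UqGLˣ) : (tensorUnits φ ψ hc (u, v) : R) = φ u * ψ v := rfl

theorem tensorUnits_div (u v u' v' : UqGLˣ) :
    tensorUnits φ ψ hc (u, u') / tensorUnits φ ψ hc (v, v') =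
      tensorUnits φ ψ hc (u / v, u' / v') := (map_div _ _ _).symm

theorem tensorUnits_qCommute_E (i : Fin 3) (j : Fin 4) :
    QCommute q (wt i j) (tensorUnits φ ψ hc (unitD j, unitD j) : R)
      (φ (E i) + φ ↑(unitKinv i)⁻¹ * ψ (E i)) := by
  have hK : QCommute q 0 (φ (unitD j)) (φ ↑(unitKinv i)⁻¹) :=
    .of_commute ((glRelations.D_D_div j _ _).inv_right.units_val.map φ)
  have hE : QCommute q (wt i j) (φ (unitD j)) (φ (E i)) := (glRelations.D_E i j).map φ
  have hE' : QCommute q (wt i j) (ψ (unitD j)) (ψ (E i)) := (glRelations.D_E i j).map ψ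
  have hcE := hE.mul_left q_ne_zero (.of_commute (hc (E i) (unitD j)).symm)
  have hcKE := ((hK.mul_left q_ne_zero (.of_commute (hc _ (unitD j)).symm))).mul_right q_ne_zero
    (QCommute.mul_left q_ne_zero (.of_commute (hc (unitD j) _)) hE')
  simp only [add_zero, zero_add] at hcE hcKE
  exact hcE.add_right hcKE

theorem tensorUnits_qCommute_F (i : Fin 3) (j : Fin 4) :
    QCommute q (-wt i j) (tensorUnits φ ψ hc (unitD j, unitD j) : R)
      (ψ (F i) + ψ (Kinv i) * φ (F i)) := by
  have hK : QCommute q 0 (ψ (unitD j)) (ψ (Kinv i)) :=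
    .of_commute (unitKinv_val i ▸ (glRelations.D_D_div j _ _).units_val.map ψ)
  have hF : QCommute q (-wt i j) (φ (unitD j)) (φ (F i)) := (glRelations.D_F i j).map φ
  have hF' : QCommute q (-wt i j) (ψ (unitD j)) (ψ (F i)) := (glRelations.D_F i j).map ψ
  have hcF := QCommute.mul_left q_ne_zero (.of_commute (hc (unitD j) (F i))) hF'
  have hcKF := (QCommute.mul_left q_ne_zero (.of_commute (hc (unitD j) _)) hK).mul_right q_ne_zero
    (hF.mul_left q_ne_zero (.of_commute (hc (F i) (unitD j)).symm))
  simp only [add_zero, zero_add] at hcF hcKF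
  exact hcF.add_right hcKF

theorem tensor_E_F_same (i : Fin 3) :
    (φ (E i) + φ ↑(unitKinv i)⁻¹ * ψ (E i)) * (ψ (F i) + ψ (Kinv i) * φ (F i)) =
      (ψ (F i) + ψ (Kinv i) * φ (F i)) * (φ (E i) + φ ↑(unitKinv i)⁻¹ * ψ (E i)) +
        (q - q⁻¹)⁻¹ •
          ((tensorUnits φ ψ hc (unitD i.castSucc, unitD i.castSucc) /
              tensorUnits φ ψ hc (unitD i.succ, unitD i.succ) : Rˣ) -
            (tensorUnits φ ψ hc (unitD i.succ, unitD i.succ) /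
              tensorUnits φ ψ hc (unitD i.castSucc, unitD i.castSucc) : Rˣ) : R) := by
  rw [← sub_eq_iff_eq_add', map_add_map_mul_map_commutator hc (K_F i i) (Kinv_E i i), E_F_same]
  simp only [add_sub_cancel_left, map_smul, map_sub, mul_smul_comm, ← smul_add, mul_sub]
  rw [tensorUnits_div, tensorUnits_div, tensorUnits_val, tensorUnits_val, ← unitKinv, ← inv_div,
    ← unitKinv, ← unitKinv_val, (hc _ _).eq, (hc _ _).eq, (hc _ _).eq, sub_add_sub_cancel']

theorem tensor_glRelations : GLRelations
    (fun i => φ (E i) + φ ↑(unitKinv i)⁻¹ * ψ (E i)) (fun i => ψ (F i) + ψ (Kinv i) * φ (F i))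
    fun j => tensorUnits φ ψ hc (unitD j, unitD j) where
  D_D j k := (Prod.commute_iff.2 ⟨commute_unitD j k, commute_unitD j k⟩).map _
  D_E := tensorUnits_qCommute_E hc
  D_F := tensorUnits_qCommute_F hc
  E_F_same := tensor_E_F_same hc
  E_F_ne {i j} hij := by
    rw [Commute, SemiconjBy, ← sub_eq_zero,
      map_add_map_mul_map_commutator hc (K_F i j) (cartan_comm i j ▸ Kinv_E j i),
      (glRelations.E_F_ne hij).eq, sub_self, map_zero, map_zero, mul_zero, mul_zero, add_zero]
  E_E {i j} hij := by
    obtain rfl | hne := eq_or_ne i j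
    · rfl
    have h0 := cartan_of_not_adjacent hne hij
    have h0' := (cartan_comm i j).symm.trans h0
    have hEE := glRelations.E_E hij
    exact commute_map_add_map_mul_map hc hEE (h0 ▸ K_E i j).commute
      (h0' ▸ K_E j i).commute (commute_unitKinv i j).inv_inv.units_val hEE
  F_F {i j} hij := by
    obtain rfl | hne := eq_or_ne i j
    · rfl
    have h0 := cartan_of_not_adjacent hne hij
    have h0' := (cartan_comm i j).symm.trans h0
    have hFF := glRelations.F_F hij
    exact commute_map_add_map_mul_map (fun x y => (hc y x).symm) hFF (h0 ▸ Kinv_F i j).commute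
      (h0' ▸ Kinv_F j i).commute (commute_Kinv i j) hFF
  E_serre {i j} hij := by
    have hs := glRelations.E_serre hij
    exact serre_map_add_map_mul_map q_ne_zero hc (cartan_self i ▸ K_E i i)
      (cartan_of_adjacent hij ▸ K_E i j) (cartan_of_adjacent hij.symm ▸ K_E j i)
      (commute_unitKinv i j).inv_inv.units_val hs hs
  F_serre {i j} hij := by
    have hs := glRelations.F_serre hij
    exact serre_map_add_map_mul_map q_ne_zero (fun x y => (hc y x).symm)
      (cartan_self i ▸ Kinv_F i i) (Kinv_F_of_adjacent hij) (Kinv_F_of_adjacent hij.symm)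
      (commute_Kinv i j) hs hs

/-- The tensor product of two representations with commuting images, formed with the coproduct
`E_i ↦ E_i ⊗ 1 + K_i ⊗ E_i`, `F_i ↦ 1 ⊗ F_i + F_i ⊗ K_i⁻¹`, `D_j ↦ D_j ⊗ D_j`. -/
def tensorHom : UqGL →ₐ[Cq] R := lift (tensor_glRelations hc)

theorem tensorHom_E (i : Fin 3) :
    tensorHom hc (E i) = φ (E i) + φ ↑(unitKinv i)⁻¹ * ψ (E i) := lift_gen _ _

theorem tensorHom_F (i : Fin 3) : tensorHom hc (F i) = ψ (F i) + ψ (Kinv i) * φ (F i) :=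
  lift_gen _ _

theorem tensorHom_of_mem_closure {u : UqGLˣ} (hu : u ∈ Subgroup.closure (Set.range unitD)) :
    tensorHom hc u = φ u * ψ u := by
  have hD : Set.EqOn (Units.map (tensorHom hc : UqGL →* R))
      ((tensorUnits φ ψ hc).comp ((MonoidHom.id _).prod (.id _))) (Set.range unitD) := by
    rintro _ ⟨j, rfl⟩
    exact Units.ext (lift_gen _ _)
  exact congrArg Units.val (MonoidHom.eqOn_closure hD hu)

end TensorHom

end UqGL

namespace UqGL

section VectorRepresentation

open Matrix

/-- The diagonal matrix with entry `q` at the vertex `j` and entries `1` elsewhere, as a unit. -/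
def vecD (j : Fin 4) : (Matrix (Fin 4) (Fin 4) Cq)ˣ where
  val := diagonal fun k => if k = j then q else 1
  inv := diagonal fun k => if k = j then q⁻¹ else 1
  val_inv := by
    rw [diagonal_mul_diagonal, ← diagonal_one]
    congr with k
    split_ifs <;> simp [q_ne_zero]
  inv_val := by
    rw [diagonal_mul_diagonal, ← diagonal_one]
    congr with k
    split_ifs <;> simp [q_ne_zero]

theorem vecD_mul_single (j a b : Fin 4) :
    QCommute q ((if a = j then 1 else 0) - if b = j then 1 else 0)
      (vecD j : Matrix (Fin 4) (Fin 4) Cq) (single a b 1) := by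
  ext k l
  simp only [vecD, diagonal_mul, mul_diagonal, Matrix.smul_apply, single_apply]
  split_ifs <;> simp_all [q_ne_zero]

theorem vecD_div_sub_div {a b : Fin 4} (hab : a ≠ b) :
    (↑(vecD a / vecD b) : Matrix (Fin 4) (Fin 4) Cq) - (↑(vecD b / vecD a) : Matrix _ _ Cq)
      = (q - q⁻¹) • (single a a 1 - single b b 1) := by
  rw [div_eq_mul_inv, div_eq_mul_inv, Units.val_mul, Units.val_mul]
  ext k l
  simp only [vecD, Units.inv_mk, diagonal_mul_diagonal, Matrix.sub_apply, diagonal_apply,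
    Matrix.smul_apply, single_apply, smul_eq_mul]
  split_ifs <;> grind

theorem serre_single {a b c d : Fin 4} (hab : b ≠ a) (h : b ≠ c ∨ d ≠ a) :
    serre q (single a b (1 : Cq)) (single c d 1) = 0 := by
  have hsq : single a b (1 : Cq) * single a b 1 = 0 := single_mul_single_of_ne _ _ _ _ hab _
  have haba : single a b (1 : Cq) * (single c d 1 * single a b 1) = 0 := by
    obtain h | h := h
    · rw [← mul_assoc, single_mul_single_of_ne _ _ _ _ h, zero_mul]
    · rw [single_mul_single_of_ne _ _ _ _ h, mul_zero]
  rw [serre, ← mul_assoc, hsq, haba, zero_mul, smul_zero, sub_zero, mul_zero, add_zero]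

theorem vec_glRelations : GLRelations (fun i => single i.castSucc i.succ (1 : Cq))
    (fun i => single i.succ i.castSucc 1) vecD where
  D_D j k := Units.ext (commute_diagonal _ _)
  D_E i j := vecD_mul_single ..
  D_F i j := by
    rw [wt, neg_sub]
    exact vecD_mul_single ..
  E_F_same i := by
    rw [single_mul_single_same, single_mul_single_same, vecD_div_sub_div Fin.castSucc_lt_succ.ne,
      inv_smul_smul₀ q_sub_inv_ne_zero, one_mul, add_sub_cancel]
  E_F_ne {i j} hij := by
    rw [Commute, SemiconjBy, single_mul_single_of_ne, single_mul_single_of_ne]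
    exacts [by simpa using hij.symm, by simpa using hij]
  E_E {i j} hij := by
    rw [Adjacent, not_or] at hij
    rw [Commute, SemiconjBy, single_mul_single_of_ne _ _ _ _ hij.1,
      single_mul_single_of_ne _ _ _ _ hij.2]
  F_F {i j} hij := by
    rw [Adjacent, not_or] at hij
    rw [Commute, SemiconjBy, single_mul_single_of_ne _ _ _ _ (Ne.symm hij.2),
      single_mul_single_of_ne _ _ _ _ (Ne.symm hij.1)]
  E_serre {i j} hij := serre_single Fin.castSucc_lt_succ.ne' <| by
    simp only [Adjacent, Fin.ext_iff, Fin.val_succ, Fin.val_castSucc] at hij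
    simp only [ne_eq, Fin.ext_iff, Fin.val_succ, Fin.val_castSucc]
    lia
  F_serre {i j} hij := serre_single Fin.castSucc_lt_succ.ne <| by
    simp only [Adjacent, Fin.ext_iff, Fin.val_succ, Fin.val_castSucc] at hij
    simp only [ne_eq, Fin.ext_iff, Fin.val_succ, Fin.val_castSucc]
    lia

/-- The vector representation of `U_q(𝔤𝔩₄)`. -/
def vecRep : UqGL →ₐ[Cq] Matrix (Fin 4) (Fin 4) Cq := lift vec_glRelations

theorem vecRep_E (i : Fin 3) : vecRep (E i) = single i.castSucc i.succ 1 := lift_gen ..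

theorem vecRep_F (i : Fin 3) : vecRep (F i) = single i.succ i.castSucc 1 := lift_gen ..

theorem vecRep_Kinv (i : Fin 3) : vecRep (Kinv i) = diagonal fun k =>
    (if k = i.castSucc then q⁻¹ else 1) * (if k = i.succ then q else 1) := by
  rw [Kinv, map_mul, Dinv, D, vecRep, lift_gen, lift_gen]
  exact diagonal_mul_diagonal ..

theorem vecRep_Dhat (j : Fin 4) : vecRep (Dhat j) = diagonal fun k =>
    (if k = j then q else 1) * (if k = j.rev then q else 1) := by
  rw [Dhat, map_mul, D, D, vecRep, lift_gen, lift_gen]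
  exact diagonal_mul_diagonal ..

end VectorRepresentation

section VectorCoproduct

/-- Scalar matrices with entries in `U_q(𝔤𝔩₄)`. -/
abbrev scalarHom : UqGL →ₐ[Cq] Matrix (Fin 4) (Fin 4) UqGL := Matrix.scalarAlgHom (Fin 4) Cq

/-- The vector representation as matrices with entries in `U_q(𝔤𝔩₄)`. -/
abbrev vecHom : UqGL →ₐ[Cq] Matrix (Fin 4) (Fin 4) UqGL :=
  (Algebra.ofId Cq UqGL).mapMatrix.comp vecRep

theorem scalarHom_mul_vecHom (x y : UqGL) (a b : Fin 4) :
    (scalarHom x * vecHom y) a b = vecRep y a b • x := by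
  rw [Algebra.smul_def, Algebra.commutes]
  simp [Matrix.diagonal_mul, Algebra.ofId_apply]

theorem vecHom_apply (y : UqGL) (a b : Fin 4) : vecHom y a b = vecRep y a b • 1 := by
  rw [← scalarHom_mul_vecHom, map_one, one_mul]

theorem commute_scalarHom_vecHom (x y : UqGL) : Commute (scalarHom x) (vecHom y) :=
  Matrix.ext fun a b => by
    rw [scalarHom_mul_vecHom, Algebra.smul_def]
    simp [Matrix.mul_diagonal, Algebra.ofId_apply]

/-- The coproduct of `U_q(𝔤𝔩₄)`, with the vector representation applied to the second factor. -/
def vecCoprod : UqGL →ₐ[Cq] Matrix (Fin 4) (Fin 4) UqGL := tensorHom commute_scalarHom_vecHom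

theorem vecCoprod_unit_apply {u : UqGLˣ} (hu : u ∈ Subgroup.closure (Set.range unitD))
    (a b : Fin 4) : vecCoprod u a b = vecRep u a b • (u : UqGL) := by
  rw [vecCoprod, tensorHom_of_mem_closure _ hu, scalarHom_mul_vecHom]

theorem unitKinv_mem_closure (i : Fin 3) :
    unitKinv i ∈ Subgroup.closure (Set.range unitD) :=
  div_mem (Subgroup.subset_closure ⟨_, rfl⟩) (Subgroup.subset_closure ⟨_, rfl⟩)

theorem unitDhat_mem_closure (j : Fin 4) :
    unitDhat j ∈ Subgroup.closure (Set.range unitD) :=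
  mul_mem (Subgroup.subset_closure ⟨_, rfl⟩) (Subgroup.subset_closure ⟨_, rfl⟩)

theorem vecCoprod_Kinv (i : Fin 3) :
    vecCoprod (Kinv i) = scalarHom (Kinv i) * vecHom (Kinv i) := by
  rw [← unitKinv_val]
  exact tensorHom_of_mem_closure _ (unitKinv_mem_closure i)

theorem vecCoprod_E_mul_Kinv (i k : Fin 3) : vecCoprod (E i * Kinv k)
    = scalarHom (E i * Kinv k) * vecHom (Kinv k)
      + scalarHom (↑(unitKinv i)⁻¹ * Kinv k) * vecHom (E i * Kinv k) := by
  rw [map_mul, vecCoprod_Kinv, vecCoprod, tensorHom_E, add_mul, ← mul_assoc, ← map_mul, mul_assoc,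
    ← mul_assoc (vecHom _), ← (commute_scalarHom_vecHom _ _).eq, mul_assoc, ← map_mul vecHom,
    ← mul_assoc, ← map_mul]

theorem vecCoprod_F (i : Fin 3) :
    vecCoprod (F i) = vecHom (F i) + scalarHom (F i) * vecHom (Kinv i) := by
  rw [vecCoprod, tensorHom_F, (commute_scalarHom_vecHom _ _).eq]

theorem vecCoprod_B_apply (i : Fin 3) (a b : Fin 4) : vecCoprod (B i) a b
    = vecRep (Kinv i) a b • B i + vecRep (F i) a b • 1
      + vecRep (E i.rev * Kinv i) a b • (↑(unitKinv i.rev)⁻¹ * Kinv i) := by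
  rw [B, map_add, vecCoprod_E_mul_Kinv, vecCoprod_F]
  simp only [Matrix.add_apply, scalarHom_mul_vecHom, vecHom_apply, smul_add]
  abel

theorem vecCoprod_Bzero_apply (a b : Fin 4) : vecCoprod Bzero a b
    = vecRep (Kinv 1) a b • Bzero
      + (vecRep (F 1) a b + q⁻¹ * vecRep (E 1 * Kinv 1) a b) • 1 := by
  rw [Bzero, map_add, map_smul, vecCoprod_E_mul_Kinv, vecCoprod_F, ← unitKinv_val, Units.inv_mul]
  simp only [Matrix.add_apply, Matrix.smul_apply, scalarHom_mul_vecHom, vecHom_apply, smul_add,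
    add_smul, mul_smul, smul_comm q⁻¹ (vecRep (unitKinv 1) a b)]
  abel

end VectorCoproduct

end UqGL

section Coaction

open UqGL

theorem coe_unitK_eq : ((unitK : Uq') : UqGL) = ↑(unitKinv 2)⁻¹ * Kinv 0 := by
  have h := congrArg Units.val (unitDhat_div.trans (commute_unitKinv 0 2).inv_right.eq)
  rw [Units.val_mul, unitKinv_val 0] at h
  exact h

theorem coe_unitK_inv_eq : ((↑unitK⁻¹ : Uq') : UqGL) = ↑(unitKinv 0)⁻¹ * Kinv 2 := by
  have h := congrArg (fun u : UqGLˣ => (↑u⁻¹ : UqGL))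
    (unitDhat_div.trans (commute_unitKinv 0 2).inv_right.eq)
  simp only [mul_inv_rev, inv_inv, Units.val_mul, unitKinv_val] at h
  exact h

theorem vecCoprod_mem (x : Uq') (a b : Fin 4) : vecCoprod x a b ∈ Uq' := by
  induction x using uq'_induction generalizing a b with
  | hB1 =>
    rw [B1, vecCoprod_B_apply, show Fin.rev (0 : Fin 3) = 2 from rfl, ← coe_unitK_eq]
    exact add_mem (add_mem (Uq'.smul_mem B1.2 _) (Uq'.smul_mem (one_mem _) _))
      (Uq'.smul_mem (unitK : Uq').2 _)
  | hBm1 =>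
    rw [Bm1, vecCoprod_B_apply, show Fin.rev (2 : Fin 3) = 0 from rfl, ← coe_unitK_inv_eq]
    exact add_mem (add_mem (Uq'.smul_mem Bm1.2 _) (Uq'.smul_mem (one_mem _) _))
      (Uq'.smul_mem (↑unitK⁻¹ : Uq').2 _)
  | hB0 =>
    rw [B0, vecCoprod_Bzero_apply]
    exact add_mem (Uq'.smul_mem B0.2 _) (Uq'.smul_mem (one_mem _) _)
  | hDd =>
    exact vecCoprod_unit_apply (unitDhat_mem_closure 2) a b ▸ Uq'.smul_mem Dd.2 _
  | hD1 =>
    exact vecCoprod_unit_apply (unitDhat_mem_closure 3) a b ▸ Uq'.smul_mem D1.2 _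
  | hDdInv =>
    exact vecCoprod_unit_apply (inv_mem (unitDhat_mem_closure 2)) a b ▸ Uq'.smul_mem DdInv.2 _
  | hD1Inv =>
    exact vecCoprod_unit_apply (inv_mem (unitDhat_mem_closure 3)) a b ▸ Uq'.smul_mem D1Inv.2 _
  | hc c =>
    have hcoe : ((algebraMap Cq Uq' c : Uq') : UqGL) = algebraMap Cq UqGL c := rfl
    rw [hcoe, AlgHom.commutes, Matrix.algebraMap_matrix_apply]
    split_ifs
    exacts [Uq'.algebraMap_mem c, zero_mem _]
  | hadd x y hx hy =>
    rw [Subalgebra.coe_add, map_add, Matrix.add_apply]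
    exact add_mem (hx _ _) (hy _ _)
  | hmul x y hx hy =>
    rw [Subalgebra.coe_mul, map_mul, Matrix.mul_apply]
    exact sum_mem fun c _ => mul_mem (hx _ _) (hy _ _)

/-- The restriction of `vecCoprod` to the coideal subalgebra. -/
def coact : Uq' →ₐ[Cq] Matrix (Fin 4) (Fin 4) Uq' where
  toFun x := Matrix.of fun a b => ⟨vecCoprod x a b, vecCoprod_mem x a b⟩
  map_one' := by
    ext a b
    rcases eq_or_ne a b with rfl | h
    · simp
    · simp [h]
  map_mul' x y := by
    ext a b
    simp [Matrix.mul_apply]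
  map_zero' := by ext a b; simp
  map_add' x y := by ext a b; simp
  commutes' c := by
    have hcoe : ((algebraMap Cq Uq' c : Uq') : UqGL) = algebraMap Cq UqGL c := rfl
    ext a b
    rw [Matrix.algebraMap_matrix_apply]
    simp only [Matrix.of_apply, hcoe, AlgHom.commutes, Matrix.algebraMap_matrix_apply]
    split_ifs <;> rfl

theorem coact_B1_apply (a b : Fin 4) : coact B1 a b
    = vecRep (Kinv 0) a b • B1 + vecRep (F 0) a b • 1 + vecRep (E 2 * Kinv 0) a b • unitK.val :=
  Subtype.ext <| (vecCoprod_B_apply 0 a b).trans <| coe_unitK_eq ▸ rfl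

theorem coact_Bm1_apply (a b : Fin 4) : coact Bm1 a b
    = vecRep (Kinv 2) a b • Bm1 + vecRep (F 2) a b • 1 + vecRep (E 0 * Kinv 2) a b • unitK⁻¹.val :=
  Subtype.ext <| (vecCoprod_B_apply 2 a b).trans <| coe_unitK_inv_eq ▸ rfl

theorem coact_B0_apply (a b : Fin 4) : coact B0 a b
    = vecRep (Kinv 1) a b • B0 + (vecRep (F 1) a b + q⁻¹ * vecRep (E 1 * Kinv 1) a b) • 1 :=
  Subtype.ext (vecCoprod_Bzero_apply a b)

theorem coact_Dd_apply (a b : Fin 4) : coact Dd a b = vecRep (Dhat 2) a b • Dd :=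
  Subtype.ext (vecCoprod_unit_apply (unitDhat_mem_closure 2) a b)

theorem coact_D1_apply (a b : Fin 4) : coact D1 a b = vecRep (Dhat 3) a b • D1 :=
  Subtype.ext (vecCoprod_unit_apply (unitDhat_mem_closure 3) a b)

end Coaction

/-- The tensor product of a `U_q'`-module with the vector representation of `U_q(𝔤𝔩₄)`. -/
def Tens (W : Type*) : Type _ := Fin 4 → W

namespace Tens

section

variable {W : Type*}

/-- An element of `Tens W` from its components. -/
def mk (a b c d : W) : Tens W := ![a, b, c, d]

theorem mk_inj {a b c d a' b' c' d' : W} (h : mk a b c d = mk a' b' c' d') :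
    a = a' ∧ b = b' ∧ c = c' ∧ d = d' :=
  ⟨congrFun h 0, congrFun h 1, congrFun h 2, congrFun h 3⟩

variable [AddCommGroup W]

instance : AddCommGroup (Tens W) := inferInstanceAs (AddCommGroup (Fin 4 → W))

instance [Module Cq W] : Module Cq (Tens W) := inferInstanceAs (Module Cq (Fin 4 → W))

instance [Module Cq W] [FiniteDimensional Cq W] : FiniteDimensional Cq (Tens W) :=
  inferInstanceAs (FiniteDimensional Cq (Fin 4 → W))

theorem mk_add (a b c d a' b' c' d' : W) :
    mk a b c d + mk a' b' c' d' = mk (a + a') (b + b') (c + c') (d + d') := by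
  funext i
  fin_cases i <;> rfl

theorem smul_mk [Module Cq W] (x : Cq) (a b c d : W) :
    x • mk a b c d = mk (x • a) (x • b) (x • c) (x • d) := by
  funext i
  fin_cases i <;> rfl

theorem mk_zero : (mk 0 0 0 0 : Tens W) = 0 := by
  funext i
  fin_cases i <;> rfl

variable [Module Uq' W]

instance : SMul Uq' (Tens W) := ⟨fun x f i => ∑ j, coact x i j • f j⟩

theorem smul_apply (x : Uq') (f : Tens W) (i : Fin 4) : (x • f) i = ∑ j, coact x i j • f j := rfl

instance : Module Uq' (Tens W) where
  one_smul f := funext fun i => by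
    simp only [smul_apply, map_one, Matrix.one_apply, ite_smul, one_smul, zero_smul]
    exact (Finset.sum_ite_eq _ _ _).trans (if_pos (Finset.mem_univ _))
  mul_smul x y f := funext fun i => by
    simp only [smul_apply, map_mul, Matrix.mul_apply, Finset.sum_smul, Finset.smul_sum, smul_smul]
    exact Finset.sum_comm
  smul_zero x := funext fun i => Finset.sum_eq_zero fun j _ => smul_zero _
  smul_add x f g := funext fun i =>
    (Finset.sum_congr rfl fun j _ => smul_add _ _ _).trans Finset.sum_add_distrib
  add_smul x y f := funext fun i => by
    simp only [smul_apply, map_add, Matrix.add_apply, add_smul, Finset.sum_add_distrib]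
    rfl
  zero_smul f := funext fun i => by
    simp only [smul_apply, map_zero, Matrix.zero_apply, zero_smul, Finset.sum_const_zero]
    rfl

variable [Module Cq W] [IsScalarTower Cq Uq' W]

instance : IsScalarTower Cq Uq' (Tens W) where
  smul_assoc c x f := funext fun i => by
    simp only [smul_apply, map_smul, Matrix.smul_apply, smul_assoc]
    exact Finset.smul_sum.symm

end

section

open UqGL

variable {W : Type*} [AddCommGroup W] [Module Uq' W] [Module Cq W] [IsScalarTower Cq Uq' W]

theorem B1_smul_mk (a b c d : W) : B1 • mk a b c d
    = mk (q⁻¹ • B1 • a) (a + q • B1 • b) (B1 • c + unitK.val • d) (B1 • d) := by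
  funext i
  rw [smul_apply, Fin.sum_univ_four]
  fin_cases i <;>
    simp [coact_B1_apply, vecRep_Kinv, vecRep_E, vecRep_F, mk]

theorem Bm1_smul_mk (a b c d : W) : Bm1 • mk a b c d
    = mk (Bm1 • a + unitK⁻¹.val • b) (Bm1 • b) (q⁻¹ • Bm1 • c) (c + q • Bm1 • d) := by
  funext i
  rw [smul_apply, Fin.sum_univ_four]
  fin_cases i <;>
    simp [coact_Bm1_apply, vecRep_Kinv, vecRep_E, vecRep_F, mk]

theorem B0_smul_mk (a b c d : W) : B0 • mk a b c d
    = mk (B0 • a) (q⁻¹ • B0 • b + c) (b + q • B0 • c) (B0 • d) := by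
  funext i
  rw [smul_apply, Fin.sum_univ_four]
  fin_cases i <;>
    simp [coact_B0_apply, vecRep_Kinv, vecRep_E, vecRep_F, mk, q_ne_zero]

theorem Dd_smul_mk (a b c d : W) : Dd • mk a b c d
    = mk (Dd • a) (q • Dd • b) (q • Dd • c) (Dd • d) := by
  funext i
  rw [smul_apply, Fin.sum_univ_four]
  fin_cases i <;> simp [coact_Dd_apply, vecRep_Dhat, mk]

theorem D1_smul_mk (a b c d : W) : D1 • mk a b c d
    = mk (q • D1 • a) (D1 • b) (D1 • c) (q • D1 • d) := by
  funext i
  rw [smul_apply, Fin.sum_univ_four]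
  fin_cases i <;> simp [coact_D1_apply, vecRep_Dhat, mk]

end

end Tens

section HighestWeight

variable {W : Type*} [AddCommGroup W] [Module Cq W] [Module Uq' W] [IsScalarTower Cq Uq' W]
  {d d₁ : ℤ} {c ζ : Cq} {v : W}

theorem X_smul (m : W) : X • m = B0 • B1 • m - q⁻¹ • B1 • B0 • m := by
  rw [X, qComm, sub_smul, smul_assoc, mul_smul, mul_smul]

theorem Y_smul (m : W) : Y • m = B0 • Bm1 • m - q⁻¹ • Bm1 • B0 • m := by
  rw [Y, qComm, sub_smul, smul_assoc, mul_smul, mul_smul]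

theorem Z_smul (m : W) : Z • m = B1 • Y • m - q⁻¹ • Y • B1 • m := by
  rw [Z, qComm, sub_smul, smul_assoc, mul_smul, mul_smul]

theorem X_smul_eq_zero (h : B1 • v = 0) (h₀ : B0 • v = c • v) : X • v = 0 := by
  rw [X_smul, h, h₀, smul_comm B1, h, smul_zero, smul_zero, smul_zero, sub_zero]

theorem qBr_q_mul (hc : c ≠ 0) : qBr (q * c) 0 = q⁻¹ * qBr c 0 + c := by
  have _ := q_ne_zero
  have _ := q_sq_sub_one_ne_zero
  rw [qBr_zero, qBr_zero]
  field_simp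
  ring

theorem mul_qBr_q_mul (hc : c ≠ 0) : c * qBr (q * c) 0 = q * (c * qBr c 0) + 1 := by
  have _ := q_ne_zero
  have _ := q_sq_sub_one_ne_zero
  rw [qBr_zero, qBr_zero]
  field_simp
  ring

namespace IsHW

theorem B1_smul_Bm1 (h : IsHW d d₁ c ζ v) :
    B1 • Bm1 • v = ((q ^ (d - d₁) - (q ^ (d - d₁))⁻¹) / (q - q⁻¹)) • v := by
  rw [smul_smul, coidealRelations.B₁_Bₘ, add_smul, mul_smul, h.B1_smul, smul_zero, zero_add,
    smul_assoc, sub_smul, h.unitK_smul, units_inv_smul h.unitK_smul, ← sub_smul, smul_smul,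
    inv_mul_eq_div]

theorem B1_smul_B0_smul_Bm1 (h : IsHW d d₁ c ζ v) : B1 • B0 • Bm1 • v
    = (ζ + q⁻¹ * qBr c 0 * ((q ^ (d - d₁) - (q ^ (d - d₁))⁻¹) / (q - q⁻¹))) • v := by
  have hZ := h.Z_smul
  rw [QSP.Z_smul, h.B1_smul, smul_zero, smul_zero, sub_zero, Y_smul, h.B0_smul, smul_comm Bm1,
    smul_sub, smul_comm B1 q⁻¹, smul_comm B1 (qBr c 0), h.B1_smul_Bm1, sub_eq_iff_eq_add] at hZ
  rw [hZ, smul_smul, smul_smul, ← add_smul, mul_assoc]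

end IsHW

namespace Tens

theorem B1_smul_middle (h : IsHW d d₁ c ζ v) : B1 • mk 0 v (c • v) 0 = 0 := by
  rw [B1_smul_mk, smul_comm B1, h.B1_smul]
  simp only [smul_zero, add_zero, mk_zero]

theorem B0_smul_middle (h : B0 • v = qBr c 0 • v) (hc : c ≠ 0) :
    B0 • mk 0 v (c • v) 0 = qBr (q * c) 0 • mk 0 v (c • v) 0 := by
  rw [B0_smul_mk, smul_mk, smul_zero, smul_zero, smul_comm B0, h, smul_smul, ← add_smul,
    ← qBr_q_mul hc, smul_smul c, smul_smul q, smul_smul (qBr (q * c) 0), mul_comm (qBr (q * c) 0) c,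
    mul_qBr_q_mul hc, add_comm v, add_smul, one_smul]

theorem Z_smul_middle (h : IsHW d d₁ c ζ v) (hc : c ≠ 0) : Z • mk 0 v (c • v) 0
    = (ζ - q⁻¹ * (q ^ (d - d₁))⁻¹ * c⁻¹) • mk 0 v (c • v) 0 := by
  have hq := q_ne_zero
  have hk := q_zpow_ne_zero (d - d₁)
  have _ := q_sq_sub_one_ne_zero
  rw [Z_smul, B1_smul_middle h, smul_zero, smul_zero, sub_zero, Y_smul, B0_smul_middle h.B0_smul hc,
    smul_comm Bm1, smul_smul q⁻¹, sub_eq_add_neg, ← neg_smul, Bm1_smul_mk, B0_smul_mk, smul_mk,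
    mk_add, B1_smul_mk, smul_mk]
  simp only [smul_comm (_ : Uq') (_ : Cq) (_ : W), smul_add, smul_zero, zero_add, add_zero,
    h.B1_smul_Bm1, h.B1_smul_B0_smul_Bm1, units_inv_smul h.unitK_smul, h.unitK_smul, h.B0_smul,
    h.B1_smul]
  simp only [smul_smul, ← add_smul, qBr_zero]
  generalize q ^ (d - d₁) = k at *
  congr 2 <;> · field_simp; ring

theorem isHW_middle (h : IsHW d d₁ c ζ v) (hc : c ≠ 0) :
    IsHW (d + 1) d₁ (q * c) (ζ - q⁻¹ * (q ^ (d - d₁))⁻¹ * c⁻¹) (mk 0 v (c • v) 0) where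
  Dd_smul := by
    rw [Dd_smul_mk, smul_mk, smul_comm Dd, h.Dd_smul, zpow_add_one₀ q_ne_zero]
    simp only [smul_zero, smul_smul]
    congr 2 <;> ring
  D1_smul := by
    rw [D1_smul_mk, smul_mk, smul_comm D1, h.D1_smul]
    simp only [smul_zero, smul_smul, mul_comm c]
  B0_smul := B0_smul_middle h.B0_smul hc
  Z_smul := Z_smul_middle h hc
  B1_smul := B1_smul_middle h
  X_smul := X_smul_eq_zero (B1_smul_middle h) (B0_smul_middle h.B0_smul hc)

end Tens

end HighestWeight

/-! ### One-dimensional modules -/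

section Spherical

variable {W : Type*} [AddCommGroup W] [Module Cq W] [Module Uq' W]

/-- `v` spans a one-dimensional module (or is zero) on which `B_{±1}` vanish, `D̂_♦` and `D̂_1` act
by `q ^ d` and `B_0` acts by `β`. -/
structure IsSpherical (d : ℤ) (β : Cq) (v : W) : Prop where
  B1_smul : B1 • v = 0
  Bm1_smul : Bm1 • v = 0
  B0_smul : B0 • v = β • v
  Dd_smul : Dd • v = q ^ d • v
  D1_smul : D1 • v = q ^ d • v

/-- `B_{-1}` and `B_1` move `f` to `g` and back, while `D̂_♦`, `D̂_1`, `B_0` act on `f` by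
`q ^ (d + 1)`, `q ^ d`, `[qc;0]` and on `g` by `q ^ d`, `q ^ (d + 1)`, `[c;0]`. The tensor product
of a spherical line with the vector representation contains such a pair, and the tensor product of
such a pair with the vector representation contains a spherical line. -/
structure IsDoublet (d : ℤ) (c : Cq) (f g : W) : Prop where
  B1_smul_left : B1 • f = 0
  B1_smul_right : B1 • g = f
  Bm1_smul_left : Bm1 • f = g
  Bm1_smul_right : Bm1 • g = 0
  B0_smul_left : B0 • f = qBr (q * c) 0 • f
  B0_smul_right : B0 • g = qBr c 0 • g
  Dd_smul_left : Dd • f = q ^ (d + 1) • f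
  Dd_smul_right : Dd • g = q ^ d • g
  D1_smul_left : D1 • f = q ^ d • f
  D1_smul_right : D1 • g = q ^ (d + 1) • g

variable [IsScalarTower Cq Uq' W] {d : ℤ} {c : Cq} {f g v : W}

theorem IsSpherical.isHW {i : ℤ} (h : IsSpherical d (qBr c i) v) : IsHW d d (q ^ i * c) 0 v where
  Dd_smul := h.Dd_smul
  D1_smul := h.D1_smul
  B0_smul := by rw [h.B0_smul, qBr_eq]
  Z_smul := by
    rw [Z_smul, h.B1_smul, Y_smul, h.Bm1_smul, h.B0_smul, smul_comm Bm1, h.Bm1_smul]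
    simp only [smul_zero, sub_zero, zero_smul]
  B1_smul := h.B1_smul
  X_smul := X_smul_eq_zero h.B1_smul h.B0_smul

theorem IsSpherical.isDoublet (h : IsSpherical d (qBr c 0) v) (hc : c ≠ 0) :
    IsDoublet d c (Tens.mk 0 v (c • v) 0) (Tens.mk v 0 0 (c • v)) := by
  have hw : IsHW d d c 0 v := by simpa only [zpow_zero, one_mul] using h.isHW
  have hK : unitK.val • v = v := by simpa using hw.unitK_smul
  have hKinv : unitK⁻¹.val • v = v := by simpa using units_inv_smul hw.unitK_smul
  have hf := Tens.isHW_middle hw hc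
  exact {
    B1_smul_left := hf.B1_smul
    B1_smul_right := by
      simp only [Tens.B1_smul_mk, smul_comm (_ : Uq') (_ : Cq) (_ : W), hK, h.B1_smul, smul_zero,
        add_zero, zero_add]
    Bm1_smul_left := by
      simp only [Tens.Bm1_smul_mk, smul_comm (_ : Uq') (_ : Cq) (_ : W), hKinv, h.Bm1_smul,
        smul_zero, add_zero, zero_add]
    Bm1_smul_right := by
      simp only [Tens.Bm1_smul_mk, smul_comm (_ : Uq') (_ : Cq) (_ : W), h.Bm1_smul, smul_zero,
        add_zero, Tens.mk_zero]
    B0_smul_left := hf.B0_smul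
    B0_smul_right := by
      simp only [Tens.B0_smul_mk, Tens.smul_mk, smul_comm (_ : Uq') (_ : Cq) (_ : W), h.B0_smul,
        smul_zero, add_zero, smul_comm c]
    Dd_smul_left := hf.Dd_smul
    Dd_smul_right := by
      simp only [Tens.Dd_smul_mk, Tens.smul_mk, smul_comm (_ : Uq') (_ : Cq) (_ : W), h.Dd_smul,
        smul_zero, smul_comm c]
    D1_smul_left := hf.D1_smul
    D1_smul_right := by
      simp only [Tens.D1_smul_mk, Tens.smul_mk, smul_comm (_ : Uq') (_ : Cq) (_ : W), h.D1_smul,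
        smul_zero, smul_comm c, smul_smul q, zpow_add_one₀ q_ne_zero, mul_comm] }

theorem IsDoublet.isSpherical (h : IsDoublet d c f g) (hc : c ≠ 0) :
    IsSpherical (d + 1) (qBr (q * c) 0) (Tens.mk (-q • f) g (c • g) ((-q⁻¹ * c) • f)) := by
  have hq := q_ne_zero
  have hK : unitK.val • f = q • f := by
    simpa using unitK_smul_of_smul h.Dd_smul_left h.D1_smul_left
  have hKinv : unitK⁻¹.val • g = q • g := by
    simpa using units_inv_smul (unitK_smul_of_smul h.Dd_smul_right h.D1_smul_right)
  constructor
  · have hcancel : c + -q⁻¹ * c * q = 0 := by field_simp; ring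
    simp only [Tens.B1_smul_mk, smul_comm (_ : Uq') (_ : Cq) (_ : W), h.B1_smul_left,
      h.B1_smul_right, hK, smul_smul, ← add_smul, neg_add_cancel, hcancel, zero_smul, smul_zero,
      Tens.mk_zero]
  · have hcancel : c + q * (-q⁻¹ * c) = 0 := by field_simp; ring
    simp only [Tens.Bm1_smul_mk, smul_comm (_ : Uq') (_ : Cq) (_ : W), h.Bm1_smul_left,
      h.Bm1_smul_right, hKinv, smul_smul, ← add_smul, neg_add_cancel, hcancel, zero_smul, smul_zero,
      Tens.mk_zero]
  · have hleft : qBr (q * c) 0 = q⁻¹ * qBr c 0 + c := qBr_q_mul hc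
    have hright : c * qBr (q * c) 0 = 1 + q * (c * qBr c 0) := by rw [mul_qBr_q_mul hc, add_comm]
    simp only [Tens.B0_smul_mk, Tens.smul_mk, smul_comm (_ : Uq') (_ : Cq) (_ : W),
      h.B0_smul_left, h.B0_smul_right, smul_smul, ← add_smul, mul_comm (qBr (q * c) 0), hright]
    simp only [add_smul, one_smul, hleft]
  · simp only [Tens.Dd_smul_mk, Tens.smul_mk, smul_comm (_ : Uq') (_ : Cq) (_ : W),
      h.Dd_smul_left, h.Dd_smul_right, smul_smul, zpow_add_one₀ hq]
    congr 2 <;> ring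
  · simp only [Tens.D1_smul_mk, Tens.smul_mk, smul_comm (_ : Uq') (_ : Cq) (_ : W),
      h.D1_smul_left, h.D1_smul_right, smul_smul, zpow_add_one₀ hq]
    congr 2 <;> ring

end Spherical

/-- The one-dimensional `U_q'`-module with character `χ`. -/
def CharMod (_ : Uq' →ₐ[Cq] Cq) : Type := Cq

namespace CharMod

variable (χ : Uq' →ₐ[Cq] Cq)

instance : AddCommGroup (CharMod χ) := inferInstanceAs (AddCommGroup Cq)

instance : Module Cq (CharMod χ) := inferInstanceAs (Module Cq Cq)

instance : FiniteDimensional Cq (CharMod χ) := inferInstanceAs (FiniteDimensional Cq Cq)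

instance : Module Uq' (CharMod χ) := Module.compHom Cq χ.toRingHom

/-- The generator of `CharMod χ`. -/
def one : CharMod χ := (1 : Cq)

theorem one_ne_zero : one χ ≠ 0 := (_root_.one_ne_zero : (1 : Cq) ≠ 0)

variable {χ}

theorem smul_def (x : Uq') (v : CharMod χ) : x • v = χ x • v := rfl

instance : IsScalarTower Cq Uq' (CharMod χ) where
  smul_assoc c x v := by rw [smul_def, smul_def, map_smul, smul_assoc]

theorem isSpherical_one {d : ℤ} {β : Cq} (hB1 : χ B1 = 0) (hBm1 : χ Bm1 = 0) (hB0 : χ B0 = β)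
    (hDd : χ Dd = q ^ d) (hD1 : χ D1 = q ^ d) : IsSpherical d β (one χ) where
  B1_smul := by rw [smul_def, hB1, zero_smul]
  Bm1_smul := by rw [smul_def, hBm1, zero_smul]
  B0_smul := by rw [smul_def, hB0]
  Dd_smul := by rw [smul_def, hDd]
  D1_smul := by rw [smul_def, hD1]

end CharMod

namespace UqGL

theorem det_glRelations (m : ℤ) :
    GLRelations (R := Cq) 0 0 (fun _ => Units.mk0 q q_ne_zero ^ m) where
  D_D _ _ := Commute.all _ _
  D_E _ _ := by simp [QCommute]
  D_F _ _ := by simp [QCommute]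
  E_F_same _ := by simp
  E_F_ne _ := Commute.all _ _
  E_E _ := Commute.all _ _
  F_F _ := Commute.all _ _
  E_serre _ := by simp [serre]
  F_serre _ := by simp [serre]

/-- The `m`-th power of the quantum determinant character of `U_q(𝔤𝔩₄)`. -/
def det (m : ℤ) : UqGL →ₐ[Cq] Cq := lift (det_glRelations m)

theorem det_E (m : ℤ) (i : Fin 3) : det m (E i) = 0 := lift_gen ..

theorem det_F (m : ℤ) (i : Fin 3) : det m (F i) = 0 := lift_gen ..

theorem det_D (m : ℤ) (j : Fin 4) : det m (D j) = q ^ m := (lift_gen ..).trans (by simp [genValue])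

theorem det_B (m : ℤ) (i : Fin 3) : det m (B i) = 0 := by
  rw [B, map_add, map_mul, det_E, det_F, zero_mul, add_zero]

theorem det_Bzero (m : ℤ) : det m Bzero = 0 := by
  rw [Bzero, map_add, map_smul, map_mul, det_E, det_F, zero_mul, smul_zero, add_zero]

theorem det_Dhat (m : ℤ) (j : Fin 4) : det m (Dhat j) = q ^ (2 * m) := by
  rw [Dhat, map_mul, det_D, det_D, ← zpow_add₀ q_ne_zero, two_mul]

end UqGL

/-- There is a `U_q'`-module with a nonzero spherical vector of type `(d, β)`. -/
def ExistsSpherical (d : ℤ) (β : Cq) : Prop :=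
  ∃ (W : Type) (_ : AddCommGroup W) (_ : Module Cq W) (_ : Module Uq' W)
    (_ : IsScalarTower Cq Uq' W) (v : W), v ≠ 0 ∧ IsSpherical d β v

theorem existsSpherical_two_mul (m : ℤ) : ExistsSpherical (2 * m) (qBr 1 0) :=
  ⟨CharMod ((UqGL.det m).comp Uq'.val), inferInstance, inferInstance, inferInstance, inferInstance,
    _, CharMod.one_ne_zero _, CharMod.isSpherical_one (UqGL.det_B m 0) (UqGL.det_B m 2)
      ((UqGL.det_Bzero m).trans (by simp [qBr])) (UqGL.det_Dhat m 2) (UqGL.det_Dhat m 3)⟩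

theorem ExistsSpherical.succ {d : ℤ} {c : Cq} (hc : c ≠ 0) (h : ExistsSpherical d (qBr c 0)) :
    ExistsSpherical (d + 1) (qBr (q * c) 0) := by
  obtain ⟨W, _, _, _, _, v, hv, h⟩ := h
  refine ⟨Tens (Tens W), inferInstance, inferInstance, inferInstance, inferInstance, _,
    fun hzero => hv ?_, (h.isDoublet hc).isSpherical hc⟩
  rw [← Tens.mk_zero] at hzero
  have hsecond := (Tens.mk_inj hzero).2.1
  rw [← Tens.mk_zero] at hsecond
  exact (Tens.mk_inj hsecond).1

theorem existsSpherical_natCast (m : ℤ) (n : ℕ) :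
    ExistsSpherical (2 * m + n) (qBr (q ^ (n : ℤ)) 0) := by
  induction n with
  | zero => simpa only [Nat.cast_zero, add_zero, zpow_zero] using existsSpherical_two_mul m
  | succ n ih =>
    have h := ih.succ (q_zpow_ne_zero n)
    rwa [mul_comm q, ← q_zpow_succ, add_assoc, ← Nat.cast_add_one] at h

theorem qBr_q_zpow_injective : Function.Injective fun n : ℕ => qBr (q ^ (n : ℤ)) 0 := by
  intro n n' h
  rcases eq_or_mul_eq_neg_one_of_qBr_eq (q_zpow_ne_zero n) (q_zpow_ne_zero n') h with heq | hmul
  · exact_mod_cast q_zpow_injective heq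
  · rw [← zpow_add₀ q_ne_zero] at hmul
    have hsq : q ^ ((n + n' : ℤ) * 2) = 1 := by rw [zpow_mul, hmul]; norm_num
    by_contra hne
    exact q_zpow_ne_one (by omega) hsq

theorem infinite_existsSpherical (d : ℤ) : {β | ExistsSpherical d β}.Infinite := by
  obtain ⟨m, e, rfl⟩ : ∃ (m : ℤ) (e : ℕ), d = 2 * m + e := ⟨d / 2, (d % 2).toNat, by omega⟩
  refine Set.infinite_of_injective_forall_mem (f := fun t : ℕ => qBr (q ^ ((e + 2 * t : ℕ) : ℤ)) 0)
    (fun t t' h => ?_) fun t => ?_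
  · have := qBr_q_zpow_injective h
    omega
  · have hd : 2 * m + (e : ℤ) = 2 * (m - t) + (e + 2 * t : ℕ) := by
      push_cast
      ring
    rw [hd]
    exact existsSpherical_natCast (m - t) (e + 2 * t)

section Interpolation

open Polynomial

variable {d : ℤ} {x y : Uq'} {p r : Cq[X]}

/-- The element `x` acts on each spherical vector of type `(d, β)` by the scalar `p(β)`. -/
def ActsOnSpherical (d : ℤ) (x : Uq') (p : Cq[X]) : Prop :=
  ∀ ⦃W : Type⦄ [AddCommGroup W] [Module Cq W] [Module Uq' W] [IsScalarTower Cq Uq' W] ⦃v : W⦄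
    ⦃β : Cq⦄, IsSpherical d β v → x • v = p.eval β • v

theorem ActsOnSpherical.add (hx : ActsOnSpherical d x p) (hy : ActsOnSpherical d y r) :
    ActsOnSpherical d (x + y) (p + r) := fun W _ _ _ _ v β h => by
  rw [add_smul, hx h, hy h, eval_add, add_smul]

theorem ActsOnSpherical.mul (hx : ActsOnSpherical d x p) (hy : ActsOnSpherical d y r) :
    ActsOnSpherical d (x * y) (p * r) := fun W _ _ _ _ v β h => by
  rw [mul_smul, hy h, smul_comm, hx h, smul_smul, eval_mul, mul_comm]

theorem actsOnSpherical_C (d : ℤ) (c : Cq) : ActsOnSpherical d (algebraMap Cq Uq' c) (C c) :=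
  fun W _ _ _ _ v β _ => by rw [algebraMap_smul, eval_C]

theorem actsOnSpherical_B1 (d : ℤ) : ActsOnSpherical d B1 0 := fun W _ _ _ _ v β h => by
  rw [h.B1_smul, eval_zero, zero_smul]

theorem actsOnSpherical_Bm1 (d : ℤ) : ActsOnSpherical d Bm1 0 := fun W _ _ _ _ v β h => by
  rw [h.Bm1_smul, eval_zero, zero_smul]

theorem actsOnSpherical_B0 (d : ℤ) : ActsOnSpherical d B0 Polynomial.X := fun W _ _ _ _ v β h => by
  rw [h.B0_smul, eval_X]

theorem actsOnSpherical_Dd (d : ℤ) : ActsOnSpherical d Dd (C (q ^ d)) := fun W _ _ _ _ v β h => by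
  rw [h.Dd_smul, eval_C]

theorem actsOnSpherical_D1 (d : ℤ) : ActsOnSpherical d D1 (C (q ^ d)) := fun W _ _ _ _ v β h => by
  rw [h.D1_smul, eval_C]

theorem exists_actsOnSpherical (d : ℤ) (x : Uq') : ∃ p, ActsOnSpherical d x p := by
  induction x using uq'_induction with
  | hB1 => exact ⟨_, actsOnSpherical_B1 d⟩
  | hBm1 => exact ⟨_, actsOnSpherical_Bm1 d⟩
  | hB0 => exact ⟨_, actsOnSpherical_B0 d⟩
  | hDd => exact ⟨_, actsOnSpherical_Dd d⟩
  | hD1 => exact ⟨_, actsOnSpherical_D1 d⟩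
  | hDdInv =>
    exact ⟨C (q ^ d)⁻¹, fun W _ _ _ _ v β h => by
      rw [eval_C]
      exact units_inv_smul (u := unitDd) h.Dd_smul⟩
  | hD1Inv =>
    exact ⟨C (q ^ d)⁻¹, fun W _ _ _ _ v β h => by
      rw [eval_C]
      exact units_inv_smul (u := unitD1) h.D1_smul⟩
  | hc c => exact ⟨_, actsOnSpherical_C d c⟩
  | hadd x y hx hy =>
    obtain ⟨p, hp⟩ := hx
    obtain ⟨r, hr⟩ := hy
    exact ⟨_, hp.add hr⟩
  | hmul x y hx hy =>
    obtain ⟨p, hp⟩ := hx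
    obtain ⟨r, hr⟩ := hy
    exact ⟨_, hp.mul hr⟩

theorem ActsOnSpherical.unique (hp : ActsOnSpherical d x p) (hr : ActsOnSpherical d x r) :
    p = r := by
  refine eq_of_infinite_eval_eq _ _ ((infinite_existsSpherical d).mono ?_)
  rintro β ⟨W, _, _, _, _, v, hv, h⟩
  exact smul_left_injective Cq hv ((hp h).symm.trans (hr h))

/-- The family of characters of `U_q'` annihilating `B_{±1}` and taking the value `q ^ d` at `D̂_♦`
and `D̂_1`, parametrized by the value at `B_0`. As no presentation of `U_q'` is at hand, it is
interpolated from the infinitely many members found in tensor products. -/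
def sphericalHom (d : ℤ) : Uq' →ₐ[Cq] Cq[X] :=
  have hspec (x : Uq') := (exists_actsOnSpherical d x).choose_spec
  { toFun := fun x => (exists_actsOnSpherical d x).choose
    map_one' := (hspec 1).unique (map_one (algebraMap Cq Uq') ▸ actsOnSpherical_C d 1)
    map_zero' := (hspec 0).unique (C_0 (R := Cq) ▸ map_zero (algebraMap Cq Uq') ▸
      actsOnSpherical_C d 0)
    map_add' := fun x y => (hspec (x + y)).unique ((hspec x).add (hspec y))
    map_mul' := fun x y => (hspec (x * y)).unique ((hspec x).mul (hspec y))
    commutes' := fun c => (hspec _).unique (actsOnSpherical_C d c) }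

theorem ActsOnSpherical.sphericalHom_eq (h : ActsOnSpherical d x p) : sphericalHom d x = p :=
  (exists_actsOnSpherical d x).choose_spec.unique h

/-- The member of the family `sphericalHom d` with `B_0 ↦ β`. -/
def sphericalChar (d : ℤ) (β : Cq) : Uq' →ₐ[Cq] Cq := (aeval β).comp (sphericalHom d)

theorem ActsOnSpherical.sphericalChar_eq (h : ActsOnSpherical d x p) (β : Cq) :
    sphericalChar d β x = p.eval β := by
  rw [sphericalChar, AlgHom.comp_apply, h.sphericalHom_eq, coe_aeval_eq_eval]

theorem isSpherical_sphericalChar (d : ℤ) (β : Cq) :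
    IsSpherical d β (CharMod.one (sphericalChar d β)) :=
  CharMod.isSpherical_one (((actsOnSpherical_B1 d).sphericalChar_eq β).trans eval_zero)
    (((actsOnSpherical_Bm1 d).sphericalChar_eq β).trans eval_zero)
    (((actsOnSpherical_B0 d).sphericalChar_eq β).trans eval_X)
    (((actsOnSpherical_Dd d).sphericalChar_eq β).trans eval_C)
    (((actsOnSpherical_D1 d).sphericalChar_eq β).trans eval_C)

end Interpolation

/-! ### Finite-dimensional highest weight modules -/

/-- There is a finite-dimensional `U_q'`-module with a nonzero highest weight vector of the given
weight. -/
def ExistsHW (d d₁ : ℤ) (μ ζ : Cq) : Prop :=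
  ∃ (W : Type) (_ : AddCommGroup W) (_ : Module Cq W) (_ : Module Uq' W)
    (_ : IsScalarTower Cq Uq' W) (_ : FiniteDimensional Cq W) (v : W), v ≠ 0 ∧ IsHW d d₁ μ ζ v

theorem zetaOf_q_mul {c : Cq} (hc : c ≠ 0) (κ i : ℤ) :
    zetaOf κ c i - q⁻¹ * (q ^ κ)⁻¹ * c⁻¹ = zetaOf (κ + 1) (q * c) (i + 1) := by
  have hshift : qBr (q * c) (κ + 1 - 2 * (i + 1)) = qBr c (κ - 2 * i) := by
    rw [qBr_eq, qBr_eq c, ← mul_assoc, ← zpow_add_one₀ q_ne_zero]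
    ring_nf
  have hqBr : q⁻¹ * qBr (q * c) 0 = qBr c 0 + q⁻¹ * c⁻¹ := by
    apply mul_left_cancel₀ hc
    rw [mul_left_comm, mul_qBr_q_mul hc, mul_add, mul_add, mul_left_comm c q⁻¹,
      mul_inv_cancel₀ hc, inv_mul_cancel_left₀ q_ne_zero]
  rw [zetaOf, zetaOf, hshift, zpow_neg, zpow_neg, zpow_add_one₀ q_ne_zero, mul_inv, mul_assoc _ q⁻¹,
    hqBr]
  ring

namespace ExistsHW

variable {d d₁ i : ℤ} {c ζ : Cq}

theorem plus (hc : c ≠ 0) (h : ExistsHW d d₁ c (zetaOf (d - d₁) c i)) :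
    ExistsHW (d + 1) d₁ (q * c) (zetaOf (d + 1 - d₁) (q * c) (i + 1)) := by
  obtain ⟨W, _, _, _, _, _, v, hv, h⟩ := h
  have hmiddle := Tens.isHW_middle h hc
  rw [zetaOf_q_mul hc, sub_add_eq_add_sub] at hmiddle
  refine ⟨Tens W, inferInstance, inferInstance, inferInstance, inferInstance, inferInstance, _,
    fun hzero => hv ?_, hmiddle⟩
  rw [← Tens.mk_zero] at hzero
  exact (Tens.mk_inj hzero).2.1

theorem neg_inv (h : ExistsHW d d₁ c ζ) : ExistsHW d d₁ (-c⁻¹) ζ := by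
  obtain ⟨W, _, _, _, _, _, v, hv, h⟩ := h
  exact ⟨W, inferInstance, inferInstance, inferInstance, inferInstance, inferInstance, v, hv,
    h.neg_inv⟩

theorem minus (hc : c ≠ 0) (h : ExistsHW d d₁ c (zetaOf (d - d₁) c i)) :
    ExistsHW (d + 1) d₁ (q⁻¹ * c) (zetaOf (d + 1 - d₁) (q⁻¹ * c) i) := by
  rw [← zetaOf_neg_inv] at h
  have hplus := (h.neg_inv.plus (neg_ne_zero.2 (inv_ne_zero hc))).neg_inv
  have hparam : -(q * -c⁻¹)⁻¹ = q⁻¹ * c := by rw [mul_inv, neg_inv_inv, mul_neg, neg_neg]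
  have hindex : d + 1 - d₁ - (d - d₁ - i + 1) = i := by ring
  rwa [hparam, ← zetaOf_neg_inv, hparam, hindex] at hplus

end ExistsHW

theorem existsHW_zetaOf_zero (d : ℤ) (μ : Cq) : ExistsHW d d μ (zetaOf (d - d) μ 0) := by
  refine ⟨CharMod (sphericalChar d (qBr μ 0)), inferInstance, inferInstance, inferInstance,
    inferInstance, inferInstance, _, CharMod.one_ne_zero _, ?_⟩
  simpa [zetaOf] using (isSpherical_sphericalChar d (qBr μ 0)).isHW (i := 0)

theorem existsHW_natCast (d₁ : ℤ) {μ : Cq} (hμ : μ ≠ 0) (i j : ℕ) :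
    ExistsHW (d₁ + (i + j)) d₁ (q ^ ((i : ℤ) - j) * μ)
      (zetaOf (d₁ + (i + j) - d₁) (q ^ ((i : ℤ) - j) * μ) i) := by
  induction i with
  | succ i ih =>
    have h := ih.plus (mul_ne_zero (q_zpow_ne_zero _) hμ)
    rwa [← mul_assoc, ← zpow_one_add₀ q_ne_zero, add_assoc d₁, add_right_comm (i : ℤ),
      ← Nat.cast_add_one, ← add_sub_assoc, add_comm 1, ← Nat.cast_add_one] at h
  | zero =>
    induction j with
    | zero => simpa using existsHW_zetaOf_zero d₁ μ
    | succ j ih =>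
      have h := ih.minus (mul_ne_zero (q_zpow_ne_zero _) hμ)
      rwa [← mul_assoc, ← zpow_neg_one, ← zpow_add₀ q_ne_zero, add_assoc d₁, add_assoc,
        ← Nat.cast_add_one, neg_add_eq_sub, sub_sub, ← Nat.cast_add_one] at h

/-- Starting from a one-dimensional module with `B_0`-eigenvalue `[q^{κ-2i}μ;0]`, tensor `i` times
with a step `μ ↦ qμ` and `κ - i` times with a step `μ ↦ q⁻¹μ`. -/
theorem existsHW_zetaOf {d d₁ : ℤ} {μ : Cq} (hμ : μ ≠ 0) {i : ℕ} (hi : (i : ℤ) ≤ d - d₁) :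
    ExistsHW d d₁ μ (zetaOf (d - d₁) μ i) := by
  obtain ⟨j, hj⟩ := Int.le.dest hi
  have h := existsHW_natCast d₁ (mul_ne_zero (q_zpow_ne_zero (j - i)) hμ) i j
  rwa [← mul_assoc, ← zpow_add₀ q_ne_zero, sub_add_sub_cancel, sub_self, zpow_zero, one_mul, hj,
    add_sub_cancel] at h

/-! ### Quotients of the Verma module -/

theorem finiteDimensional_quotient {k A M W : Type*} [Field k] [Ring A] [Algebra k A]
    [AddCommGroup M] [Module k M] [Module A M] [IsScalarTower k A M] [AddCommGroup W] [Module k W]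
    [Module A W] [IsScalarTower k A W] [FiniteDimensional k W] (f : M →ₗ[A] W) {N : Submodule A M}
    (h : LinearMap.ker f ≤ N) : FiniteDimensional k (M ⧸ N) := by
  have hinj : Function.Injective ((LinearMap.ker f).liftQ f le_rfl) :=
    LinearMap.ker_eq_bot.1 (Submodule.ker_liftQ_eq_bot _ _ _ le_rfl)
  have : FiniteDimensional k (M ⧸ LinearMap.ker f) :=
    Module.Finite.of_injective (((LinearMap.ker f).liftQ f le_rfl).restrictScalars k) hinj
  exact Module.Finite.of_surjective ((Submodule.factor h).restrictScalars k)
    (Submodule.factor_surjective h)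

section Quotients

variable {M : Type*} [AddCommGroup M] [Module Uq' M] {d d₁ : ℤ} {μ ζ : Cq} {v : M}

theorem mkQ_FFvec (N : Submodule Uq' M) (a b : ℕ) :
    N.mkQ (FFvec μ v a b) = FFvec μ (N.mkQ v) a b := by
  rw [FFvec, FFvec, map_smul, map_smul]

theorem mkQ_ne_zero {A M : Type*} [Ring A] [AddCommGroup M] [Module A M] {v : M}
    (hgen : ∀ m : M, ∃ x : A, x • v = m) {N : Submodule A M} (hN : N ≠ ⊤) : N.mkQ v ≠ 0 :=
  (Submodule.Quotient.mk_eq_zero N).not.2 (notMem_of_ne_top hgen hN)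

variable [Module Cq M] [IsScalarTower Cq Uq' M]

theorem IsHW.const_smul (h : IsHW d d₁ μ ζ v) (c : Cq) : IsHW d d₁ μ ζ (c • v) :=
  ⟨h.toIsWt.const_smul c, by rw [smul_comm, h.B1_smul, smul_zero],
    by rw [smul_comm, h.X_smul, smul_zero]⟩

theorem IsHW.map {M' : Type*} [AddCommGroup M'] [Module Uq' M'] [Module Cq M']
    [IsScalarTower Cq Uq' M'] (h : IsHW d d₁ μ ζ v) (f : M →ₗ[Uq'] M') : IsHW d d₁ μ ζ (f v) := by
  have heigen {x : Uq'} {c : Cq} (hx : x • v = c • v) : x • f v = c • f v := by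
    rw [← map_smul, hx, ← algebraMap_smul Uq' c v, map_smul, algebraMap_smul]
  exact ⟨⟨heigen h.Dd_smul, heigen h.D1_smul, heigen h.B0_smul, heigen h.Z_smul⟩,
    by rw [← map_smul, h.B1_smul, map_zero], by rw [← map_smul, h.X_smul, map_zero]⟩

theorem IsFDIrreducibleQuotient.isCoatom {N : Submodule Uq' M} (hN : IsFDIrreducibleQuotient N) :
    IsCoatom N :=
  isSimpleModule_iff_isCoatom.1 hN.1

theorem IsHW.exists_eq_zetaOf_of_quotient (h : IsHW d d₁ μ ζ v) (hμ : IsGood μ)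
    (hgen : ∀ m : M, ∃ x : Uq', x • v = m) {N : Submodule Uq' M} (hN : IsFDIrreducibleQuotient N) :
    ∃ i : ℕ, (i : ℤ) ≤ d - d₁ ∧ ζ = zetaOf (d - d₁) μ i :=
  have := hN.2
  (h.map N.mkQ).exists_eq_zetaOf (mkQ_ne_zero hgen hN.isCoatom.1) hμ

theorem IsHW.isWeightBasis_mkQ {i : ℕ} (h : IsHW d d₁ μ (zetaOf (d - d₁) μ i) v) (hμ : IsGood μ)
    (hi : (i : ℤ) ≤ d - d₁) (hgen : ∀ m : M, ∃ x : Uq', x • v = m) {N : Submodule Uq' M}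
    (hN : IsFDIrreducibleQuotient N) {c : Cq} (hc : c ≠ 0) :
    IsWeightBasis fun p : {p : ℕ × ℕ // p.1 ≤ i ∧ (p.2 : ℤ) ≤ d - d₁ - i} =>
      N.mkQ (FFvec μ (c • v) p.1.1 p.1.2) := by
  have := hN.1
  simp only [mkQ_FFvec]
  exact ((h.const_smul c).map N.mkQ).isWeightBasis
    (smul_ne_zero hc (mkQ_ne_zero hgen hN.isCoatom.1)) hμ hi

theorem exists_isFDIrreducibleQuotient_of_map (hgen : ∀ m : M, ∃ x : Uq', x • v = m) {W : Type*}
    [AddCommGroup W] [Module Cq W] [Module Uq' W] [IsScalarTower Cq Uq' W]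
    [FiniteDimensional Cq W] {f : M →ₗ[Uq'] W} (hf : f ≠ 0) :
    ∃ N : Submodule Uq' M, IsFDIrreducibleQuotient N := by
  have : Module.Finite Uq' M := Module.Finite.of_surjective (LinearMap.toSpanSingleton Uq' M v) hgen
  obtain ⟨N, hN, hfN⟩ := (eq_top_or_exists_le_coatom (LinearMap.ker f)).resolve_left
    fun h => hf (LinearMap.ker_eq_top.1 h)
  exact ⟨N, isSimpleModule_iff_isCoatom.2 hN, finiteDimensional_quotient f hfN⟩

end Quotients

section Verma

variable (κd κ1 : ℤ) (β ζ : Cq) {μ : Cq}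

/-- Shortcut for the `U_q'`-module structure of a cyclic module. -/
abbrev quotientModule (I : Submodule Uq' Uq') : Module Uq' (Uq' ⧸ I) := Submodule.Quotient.module I

/-- Shortcut for the scalar multiplication of a cyclic module. -/
abbrev quotientSMul (I : Submodule Uq' Uq') : SMul Uq' (Uq' ⧸ I) :=
  (quotientModule I).toDistribMulAction.toSMul

attribute [local instance] quotientModule quotientSMul

theorem smul_vermaGen (x : Uq') :
    x • vermaGen κd κ1 β ζ = Submodule.Quotient.mk (p := vermaIdeal κd κ1 β ζ) x := by
  rw [vermaGen, ← Submodule.Quotient.mk_smul, smul_eq_mul, mul_one]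

theorem exists_smul_vermaGen (m : Verma κd κ1 β ζ) : ∃ x : Uq', x • vermaGen κd κ1 β ζ = m :=
  (Submodule.Quotient.mk_surjective _ m).imp fun x hx => (smul_vermaGen κd κ1 β ζ x).trans hx

variable {κd κ1 β ζ}

theorem smul_vermaGen_of_mem {x : Uq'} (hx : x ∈ vermaIdeal κd κ1 β ζ) :
    x • vermaGen κd κ1 β ζ = 0 := by
  rw [smul_vermaGen, Submodule.Quotient.mk_eq_zero]
  exact hx

theorem smul_vermaGen_of_sub_mem {x : Uq'} {c : Cq}
    (hx : x - algebraMap Cq Uq' c ∈ vermaIdeal κd κ1 β ζ) :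
    x • vermaGen κd κ1 β ζ = c • vermaGen κd κ1 β ζ := by
  have h := smul_vermaGen_of_mem hx
  rwa [sub_smul, algebraMap_smul, sub_eq_zero] at h

variable (κd κ1 μ ζ) in
theorem isHW_vermaGen : IsHW κd κ1 μ ζ (vermaGen κd κ1 (qBr μ 0) ζ) where
  Dd_smul := smul_vermaGen_of_sub_mem (Submodule.subset_span (by simp))
  D1_smul := smul_vermaGen_of_sub_mem (Submodule.subset_span (by simp))
  B0_smul := smul_vermaGen_of_sub_mem (Submodule.subset_span (by simp))
  Z_smul := smul_vermaGen_of_sub_mem (Submodule.subset_span (by simp))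
  B1_smul := smul_vermaGen_of_mem (Submodule.subset_span (by simp))
  X_smul := smul_vermaGen_of_mem (Submodule.subset_span (by simp))

theorem IsHW.vermaIdeal_le_ker {W : Type*} [AddCommGroup W] [Module Cq W] [Module Uq' W]
    [IsScalarTower Cq Uq' W] {w : W} (h : IsHW κd κ1 μ ζ w) :
    vermaIdeal κd κ1 (qBr μ 0) ζ ≤ LinearMap.ker (LinearMap.toSpanSingleton Uq' W w) := by
  have heigen {x : Uq'} {c : Cq} (hx : x • w = c • w) : (x - algebraMap Cq Uq' c) • w = 0 := by
    rw [sub_smul, algebraMap_smul, hx, sub_self]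
  rw [vermaIdeal, Submodule.span_le]
  rintro x (rfl | rfl | rfl | rfl | rfl | rfl)
  exacts [h.B1_smul, h.X_smul, heigen h.Dd_smul, heigen h.D1_smul, heigen h.B0_smul,
    heigen h.Z_smul]

theorem exists_isFDIrreducibleQuotient (h : ExistsHW κd κ1 μ ζ) :
    ∃ N : Submodule Uq' (Verma κd κ1 (qBr μ 0) ζ), IsFDIrreducibleQuotient N := by
  obtain ⟨W, _, _, _, _, _, w, hw, h⟩ := h
  refine exists_isFDIrreducibleQuotient_of_map (exists_smul_vermaGen κd κ1 (qBr μ 0) ζ)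
    (f := Submodule.liftQ _ (LinearMap.toSpanSingleton Uq' W w) h.vermaIdeal_le_ker)
    fun hzero => hw ?_
  have hmap := LinearMap.congr_fun hzero (vermaGen κd κ1 (qBr μ 0) ζ)
  rw [vermaGen, Submodule.liftQ_apply, LinearMap.toSpanSingleton_apply, one_smul] at hmap
  exact hmap

end Verma

end QSP

end

theorem theorem4p15 (κd κ1 : ℤ) (μ ζ : QSP.Cq) (hμ : QSP.IsGood μ) :
    ((∃ N : Submodule QSP.Uq' (QSP.Verma κd κ1 (QSP.qBr μ 0) ζ), QSP.IsFDIrreducibleQuotient N) ↔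
      ∃ i : ℕ, (i : ℤ) ≤ κd - κ1 ∧
        ζ = QSP.qBr μ (κd - κ1 - 2 * i) - QSP.q ^ (-(κd - κ1)) * QSP.qBr μ 0) ∧
    ∀ i : ℕ, (i : ℤ) ≤ κd - κ1 →
      ζ = QSP.qBr μ (κd - κ1 - 2 * i) - QSP.q ^ (-(κd - κ1)) * QSP.qBr μ 0 →
      (∃! N : Submodule QSP.Uq' (QSP.Verma κd κ1 (QSP.qBr μ 0) ζ),
        QSP.IsFDIrreducibleQuotient N) ∧
      ∀ N : Submodule QSP.Uq' (QSP.Verma κd κ1 (QSP.qBr μ 0) ζ),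
        QSP.IsFDIrreducibleQuotient N →
        ∀ v : QSP.Verma κd κ1 (QSP.qBr μ 0) ζ, QSP.IsHighestWeightVector v →
          QSP.IsWeightBasis
            (fun p : {p : ℕ × ℕ // p.1 ≤ i ∧ (p.2 : ℤ) ≤ κd - κ1 - i} =>
              N.mkQ (QSP.FFvec μ v p.1.1 p.1.2)) := by
  have hhw := QSP.isHW_vermaGen κd κ1 ζ μ
  have hgen := QSP.exists_smul_vermaGen κd κ1 (QSP.qBr μ 0) ζ
  have hex (i : ℕ) (hi : (i : ℤ) ≤ κd - κ1) (hζ : ζ = QSP.zetaOf (κd - κ1) μ i) :=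
    QSP.exists_isFDIrreducibleQuotient (hζ ▸ QSP.existsHW_zetaOf hμ.1 hi)
  refine ⟨⟨fun ⟨N, hN⟩ => hhw.exists_eq_zetaOf_of_quotient hμ hgen hN,
    fun ⟨i, hi, hζ⟩ => hex i hi hζ⟩, fun i hi hζ => ⟨?_, ?_⟩⟩
  · obtain ⟨N, hN⟩ := hex i hi hζ
    exact ⟨N, hN, fun N' hN' => hhw.isCoatom_unique hμ hgen hN'.isCoatom hN.isCoatom⟩
  · rintro N hN v ⟨c, hc, rfl⟩
    subst hζ
    exact hhw.isWeightBasis_mkQ hμ hi hgen hN hc
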